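/- A geometry is a set $X$ of points with a family of subsets (subspaces) that contains $\emptyset$, $X$ and all one-point sets, is closed under intersections, satisfies the exchange axiom (if $S$ is a subspace and $x\notin S$, no subspace lies strictly between $S$ and $S\vee x$) and the finitary axiom (a point in the closure of $A$ is in the closure of a finite subset of $A$). The dimension of a subspace is the cardinality of a basis minus $1$; lines and planes have dimension $1$ and $2$; a hyperplane is a maximal proper subspace. A subset $A\subseteq X$ is a geometry (a subgeometry) with subspaces $S\cap A$. For a subspace $E$, the quotient $X/E$ is the set of classes of points of $X\setminus E$ under $x\sim y\iff x\vee E=y\vee E$, with subspaces the images $S/E$ of the subspaces $S\supseteq E$. A morphism of geometries is a map for which preimages of subspaces are subspaces. A geometry of dimension $\ge 2$ has enough points if each of its planes contains four points, no three of which are collinear. For a left vector space $V$ over a division ring $K$, $\mathbb P(V)$ is the geometry of one-dimensional subspaces of $V$, whose subspaces are the $\mathbb P(W)$, $W\subseteq V$ a vector subspace. A partial projective morphism $\mathbb P(V)\dashrightarrow\mathbb P(V')$ is a map $\langle v\rangle\mapsto\langle\Phi(v)\rangle$, defined on $\mathbb P(V)\setminus\mathbb P(\ker\Phi)$, where $\Phi\colon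 V\to V'$ is additive and $\Phi(\lambda v)=\sigma(\lambda)\Phi(v)$ for some ring homomorphism $\sigma\colon K\to K'$ (not necessarily surjective). A subset $X\subseteq\mathbb P(V)$ is a locally affino-projective subgeometry if for every $x\in X$ there is a hyperplane $H$ of $\mathbb P(V)/x$ such that $(X/x)\cup H=\mathbb P(V)/x$. **Theorem.** Let $V,V'$ be vector spaces over division rings $K,K'$, with $|K|\ge 4$ or $|K|=3=\operatorname{char}K'$. Let $X\subseteq\mathbb P(V)$ be a locally affino-projective subgeometry with enough points. Then any morphism of geometries $\varphi\colon X\to\mathbb P(V')$ whose image is not contained in a plane (that is, in no subspace of $\mathbb P(V')$ of dimension $\le 2$) is the restriction of a unique partial projective morphism $\mathbb P(V)\dashrightarrow\mathbb P(V')$. Moreover, the following subsets of $\mathbb P(\mathbb R^4)$ are locally affino-projective subgeometries with enough points: the Möbius geometries (ellipsoids, i.e. quadrics with equation $x^2+y^2+z^2=t^2$ in suitable homogeneous coordinates), the Minkowski geometries (non-singular ruled quadrics, i.e. $x^2+y^2=z^2+t^2$ in suitable coordinates), and the Laguerre geometries (cones, i.e. $x^2+y^2=z^2$ in suitable coordinates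 $x,y,z,t$, with the singular point removed). -/

import Mathlib

open scoped LinearAlgebra.Projectivization

/-- The least member of the family `F` containing `A` (when `F` is closed under intersections):
the intersection of all members of `F` that contain `A`. -/
def flatClosure {X : Type*} (F : Set X → Prop) (A : Set X) : Set X :=
  ⋂₀ {S | F S ∧ A ⊆ S}

/-- A geometry on the set of points `X`: a family of subsets (flats, or subspaces) that contains
the empty set, the whole set and the points, is closed under intersections, and satisfies the
exchange axiom and the finitary axiom. -/
structure PointGeometry (X : Type*) where
  IsFlat : Set X → Prop
  isFlat_empty : IsFlat ∅
  isFlat_univ : IsFlat Set.univ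
  isFlat_singleton : ∀ x, IsFlat {x}
  isFlat_sInter : ∀ F : Set (Set X), (∀ S ∈ F, IsFlat S) → IsFlat (⋂₀ F)
  exchange : ∀ S, IsFlat S → ∀ x, x ∉ S → ∀ S', IsFlat S' → S ⊂ S' →
    ¬ S' ⊂ flatClosure IsFlat (insert x S)
  finitary : ∀ (A : Set X) (x : X), x ∈ flatClosure IsFlat A →
    ∃ B : Set X, B ⊆ A ∧ B.Finite ∧ x ∈ flatClosure IsFlat B

namespace PointGeometry

section Basic

variable {X : Type*} (G : PointGeometry X)

/-- The closure of `A`: the least subspace containing `A`. -/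
def closure (A : Set X) : Set X := flatClosure G.IsFlat A

/-- `A` is independent: no point of `A` is in the closure of the others. -/
def Indep (A : Set X) : Prop := ∀ a ∈ A, a ∉ G.closure (A \ {a})

/-- `S` is a subspace with a basis of `r` points, that is, a subspace of dimension `r - 1`. -/
def HasRank (S : Set X) (r : ℕ) : Prop :=
  G.IsFlat S ∧ ∃ B : Set X, G.Indep B ∧ G.closure B = S ∧ B.encard = r

/-- A line is a subspace of dimension `1`. -/
def IsLine (L : Set X) : Prop := G.HasRank L 2

/-- A plane is a subspace of dimension `2`. -/
def IsPlane (S : Set X) : Prop := G.HasRank S 3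

/-- A hyperplane is a maximal proper subspace. -/
def IsHyperplane (H : Set X) : Prop :=
  G.IsFlat H ∧ H ≠ Set.univ ∧ ∀ S, G.IsFlat S → H ⊂ S → S = Set.univ

/-- The geometry has dimension at least `2`, and every plane has four points,
no three of which are collinear. -/
def HasEnoughPoints : Prop :=
  (∃ A : Set X, G.Indep A ∧ A.encard = 3) ∧
  ∀ S, G.IsPlane S → ∃ Q ⊆ S, Q.encard = 4 ∧
    ∀ T ⊆ Q, T.encard = 3 → ¬ ∃ L, G.IsLine L ∧ T ⊆ L

/-- `A` is contained in a subspace of dimension at most `2`. -/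
def ContainedInPlane (A : Set X) : Prop :=
  ∃ (S : Set X) (r : ℕ), r ≤ 3 ∧ G.HasRank S r ∧ A ⊆ S

/-- A morphism of geometries: preimages of subspaces are subspaces. -/
def IsMorphism {Y : Type*} (G' : PointGeometry Y) (f : X → Y) : Prop :=
  ∀ S, G'.IsFlat S → G.IsFlat (f ⁻¹' S)

theorem subset_closure (A : Set X) : A ⊆ G.closure A :=
  Set.subset_sInter fun _ h => h.2

theorem isFlat_closure (A : Set X) : G.IsFlat (G.closure A) :=
  G.isFlat_sInter _ fun _ h => h.1

theorem closure_subset {A S : Set X} (hS : G.IsFlat S) (h : A ⊆ S) : G.closure A ⊆ S :=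
  Set.sInter_subset_of_mem ⟨hS, h⟩

theorem isFlat_inter {S T : Set X} (hS : G.IsFlat S) (hT : G.IsFlat T) : G.IsFlat (S ∩ T) := by
  rw [← Set.sInter_pair]
  exact G.isFlat_sInter _ (by rintro U (rfl | rfl) <;> assumption)

theorem closure_insert_eq {S : Set X} (hS : G.IsFlat S) {x y : X} (hy : y ∉ S)
    (h : y ∈ G.closure (insert x S)) : G.closure (insert y S) = G.closure (insert x S) := by
  have hx : x ∉ S := fun hx => hy <| by
    rw [Set.insert_eq_of_mem hx] at h
    exact G.closure_subset hS subset_rfl h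
  have hsub : G.closure (insert y S) ⊆ G.closure (insert x S) :=
    G.closure_subset (G.isFlat_closure _)
      (Set.insert_subset h ((Set.subset_insert _ _).trans (G.subset_closure _)))
  by_contra hne
  refine G.exchange S hS x hx _ (G.isFlat_closure (insert y S)) ?_ (hsub.ssubset_of_ne hne)
  exact ⟨(Set.subset_insert _ _).trans (G.subset_closure _),
    fun hc => hy (hc (G.subset_closure _ (Set.mem_insert _ _)))⟩

end Basic

section Subgeometry

variable {X : Type*} (G : PointGeometry X) (A : Set X)

theorem flatClosure_restrict (B : Set A) :
    flatClosure (fun T : Set A => ∃ S, G.IsFlat S ∧ T = Subtype.val ⁻¹' S) B =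
      Subtype.val ⁻¹' G.closure (Subtype.val '' B) := by
  apply Set.Subset.antisymm
  · exact Set.sInter_subset_of_mem ⟨⟨_, G.isFlat_closure _, rfl⟩,
      fun b hb => G.subset_closure _ ⟨b, hb, rfl⟩⟩
  · rintro x hx T ⟨⟨S, hS, rfl⟩, hT⟩
    exact G.closure_subset hS (by rintro _ ⟨b, hb, rfl⟩; exact hT hb) hx

/-- The subgeometry on a subset `A`: its subspaces are the intersections `S ∩ A` with `S` a
subspace of the ambient geometry. -/
def restrict : PointGeometry A where
  IsFlat T := ∃ S, G.IsFlat S ∧ T = Subtype.val ⁻¹' S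
  isFlat_empty := ⟨∅, G.isFlat_empty, rfl⟩
  isFlat_univ := ⟨Set.univ, G.isFlat_univ, rfl⟩
  isFlat_singleton x := ⟨{x.1}, G.isFlat_singleton _, by ext y; simp [Subtype.ext_iff]⟩
  isFlat_sInter F hF := by
    refine ⟨⋂₀ {S | G.IsFlat S ∧ Subtype.val ⁻¹' S ∈ F}, G.isFlat_sInter _ fun S h => h.1, ?_⟩
    ext x
    constructor
    · rintro hx S ⟨-, hS⟩
      exact hx _ hS
    · intro hx T hT
      obtain ⟨S, hS, rfl⟩ := hF T hT
      exact hx S ⟨hS, hT⟩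
  exchange := by
    rintro _ ⟨S, hS, rfl⟩ x hx _ ⟨S', hS', rfl⟩ h h'
    rw [flatClosure_restrict] at h'
    obtain ⟨y, hyS', hyS⟩ := Set.exists_of_ssubset h
    set S₀ := G.closure (Subtype.val '' (Subtype.val ⁻¹' S : Set A)) with hS₀
    have hS₀S : S₀ ⊆ S := G.closure_subset hS (by rintro _ ⟨b, hb, rfl⟩; exact hb)
    have hkey : ∀ z : A, G.closure (Subtype.val '' (insert z (Subtype.val ⁻¹' S : Set A))) =
        G.closure (insert z.1 S₀) := by
      intro z
      apply Set.Subset.antisymm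
      · apply G.closure_subset (G.isFlat_closure _)
        rintro _ ⟨b, rfl | hb, rfl⟩
        · exact G.subset_closure _ (Set.mem_insert _ _)
        · exact G.subset_closure _ (Set.mem_insert_of_mem _ (G.subset_closure _ ⟨b, hb, rfl⟩))
      · apply G.closure_subset (G.isFlat_closure _)
        refine Set.insert_subset (G.subset_closure _ ⟨z, Set.mem_insert _ _, rfl⟩) ?_
        apply G.closure_subset (G.isFlat_closure _)
        rintro _ ⟨b, hb, rfl⟩
        exact G.subset_closure _ ⟨b, Set.mem_insert_of_mem _ hb, rfl⟩
    have hy : y.1 ∈ G.closure (insert x.1 S₀) := by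
      rw [← hkey]
      exact h'.1 hyS'
    have heq := G.closure_insert_eq (G.isFlat_closure _) (fun hc => hyS (hS₀S hc)) hy
    refine h'.2 ?_
    rw [hkey, ← heq]
    intro z hz
    refine G.closure_subset hS' (Set.insert_subset hyS' ?_) hz
    apply G.closure_subset hS'
    rintro _ ⟨b, hb, rfl⟩
    exact h.1 hb
  finitary B x hx := by
    rw [flatClosure_restrict] at hx
    obtain ⟨C, hC, hfin, hxC⟩ := G.finitary _ _ hx
    refine ⟨Subtype.val ⁻¹' C, ?_, hfin.preimage Subtype.val_injective.injOn, ?_⟩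
    · intro c hc
      obtain ⟨b, hb, hbc⟩ := hC hc
      rwa [← Subtype.ext hbc]
    · rw [flatClosure_restrict]
      have : Subtype.val '' (Subtype.val ⁻¹' C : Set A) = C := by
        rw [Subtype.image_preimage_coe]
        exact Set.inter_eq_right.2 fun c hc => by obtain ⟨b, -, rfl⟩ := hC hc; exact b.2
      rw [this]
      exact hxC

end Subgeometry

section Quotient

variable {X : Type*} (G : PointGeometry X) (E : Set X)

/-- Two points outside `E` are equivalent when they span the same subspace with `E`. -/
def quotSetoid : Setoid {x : X // x ∉ E} where
  r x y := G.closure (insert x.1 E) = G.closure (insert y.1 E)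
  iseqv := ⟨fun _ => rfl, fun h => h.symm, fun h h' => h.trans h'⟩

/-- The set of points of the quotient space `X / E`. -/
def QuotSpace : Type _ := Quotient (G.quotSetoid E)

variable {E} in
/-- The class in `X / E` of a point outside `E`. -/
def toQuot (x : {x : X // x ∉ E}) : G.QuotSpace E := Quotient.mk (G.quotSetoid E) x

variable {E} in
theorem toQuot_surjective : Function.Surjective (G.toQuot (E := E)) := Quotient.mk_surjective

variable {E} in
theorem toQuot_eq_iff (x y : {x : X // x ∉ E}) :
    G.toQuot x = G.toQuot y ↔ G.closure (insert x.1 E) = G.closure (insert y.1 E) :=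
  Quotient.eq

/-- The image `S / E` of a set `S` of points in the quotient `X / E`:
the classes of the points of `S` outside `E`. -/
def quotImage (S : Set X) : Set (G.QuotSpace E) :=
  {q | ∃ x : {x : X // x ∉ E}, x.1 ∈ S ∧ G.toQuot x = q}

variable {E}

theorem mk_mem_quotImage {S : Set X} (hS : G.IsFlat S) (hES : E ⊆ S) (x : {x : X // x ∉ E}) :
    G.toQuot x ∈ G.quotImage E S ↔ x.1 ∈ S := by
  constructor
  · rintro ⟨y, hy, hyx⟩
    have h : G.closure (insert y.1 E) = G.closure (insert x.1 E) := (G.toQuot_eq_iff _ _).1 hyx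
    have hx : x.1 ∈ G.closure (insert y.1 E) := by
      rw [h]
      exact G.subset_closure _ (Set.mem_insert _ _)
    exact G.closure_subset hS (Set.insert_subset hy hES) hx
  · exact fun h => ⟨x, h, rfl⟩

theorem quotImage_subset_iff {S T : Set X} (hT : G.IsFlat T) (hET : E ⊆ T) :
    G.quotImage E S ⊆ G.quotImage E T ↔ S ⊆ T := by
  constructor
  · intro h x hx
    by_cases hxE : x ∈ E
    · exact hET hxE
    · exact (G.mk_mem_quotImage hT hET ⟨x, hxE⟩).1 (h ⟨⟨x, hxE⟩, hx, rfl⟩)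
  · rintro h _ ⟨x, hx, rfl⟩
    exact ⟨x, h hx, rfl⟩

theorem flatClosure_quotient (B : Set (G.QuotSpace E)) :
    flatClosure (fun T : Set (G.QuotSpace E) => ∃ S, G.IsFlat S ∧ E ⊆ S ∧ T = G.quotImage E S) B =
      G.quotImage E (G.closure (E ∪ {x | ∃ h : x ∉ E,
        G.toQuot ⟨x, h⟩ ∈ B})) := by
  apply Set.Subset.antisymm
  · refine Set.sInter_subset_of_mem ⟨⟨_, G.isFlat_closure _,
      Set.subset_union_left.trans (G.subset_closure _), rfl⟩, ?_⟩
    intro q hq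
    obtain ⟨x, rfl⟩ := G.toQuot_surjective q
    exact ⟨x, G.subset_closure _ (Or.inr ⟨x.2, hq⟩), rfl⟩
  · rintro _ ⟨x, hx, rfl⟩ T ⟨⟨S, hS, hES, rfl⟩, hT⟩
    refine (G.mk_mem_quotImage hS hES x).2 (G.closure_subset hS ?_ hx)
    rintro y (hy | ⟨hy, hyB⟩)
    · exact hES hy
    · exact (G.mk_mem_quotImage hS hES ⟨y, hy⟩).1 (hT hyB)

/-- The quotient geometry `X / E`: its subspaces are the `S / E` with `S` a subspace of `X`
containing `E`. -/
def quotient (hE : G.IsFlat E) : PointGeometry (G.QuotSpace E) where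
  IsFlat T := ∃ S, G.IsFlat S ∧ E ⊆ S ∧ T = G.quotImage E S
  isFlat_empty := ⟨E, hE, subset_rfl, by
    ext q
    simp only [Set.mem_empty_iff_false, false_iff]
    rintro ⟨x, hx, -⟩
    exact x.2 hx⟩
  isFlat_univ := ⟨Set.univ, G.isFlat_univ, Set.subset_univ _, by
    ext q
    obtain ⟨x, rfl⟩ := G.toQuot_surjective q
    exact ⟨fun _ => ⟨x, trivial, rfl⟩, fun _ => trivial⟩⟩
  isFlat_singleton q := by
    obtain ⟨x, rfl⟩ := G.toQuot_surjective q
    have hEx : E ⊆ G.closure (insert x.1 E) :=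
      (Set.subset_insert _ _).trans (G.subset_closure _)
    refine ⟨G.closure (insert x.1 E), G.isFlat_closure _, hEx, ?_⟩
    ext p
    obtain ⟨y, rfl⟩ := G.toQuot_surjective p
    rw [G.mk_mem_quotImage (G.isFlat_closure _) hEx y]
    constructor
    · intro h
      have h' : G.closure (insert y.1 E) = G.closure (insert x.1 E) := (G.toQuot_eq_iff _ _).1 h
      rw [← h']
      exact G.subset_closure _ (Set.mem_insert _ _)
    · exact fun h => (G.toQuot_eq_iff _ _).2 (G.closure_insert_eq hE y.2 h)
  isFlat_sInter F hF := by
    refine ⟨⋂₀ {S | (G.IsFlat S ∧ E ⊆ S) ∧ G.quotImage E S ∈ F},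
      G.isFlat_sInter _ fun S h => h.1.1, Set.subset_sInter fun S h => h.1.2, ?_⟩
    ext q
    obtain ⟨x, rfl⟩ := G.toQuot_surjective q
    rw [G.mk_mem_quotImage (G.isFlat_sInter _ fun _ h => h.1.1)
      (Set.subset_sInter fun S h => h.1.2)]
    constructor
    · rintro hx S ⟨⟨hS, hES⟩, hSF⟩
      exact (G.mk_mem_quotImage hS hES x).1 (hx _ hSF)
    · intro hx T hT
      obtain ⟨S, hS, hES, rfl⟩ := hF T hT
      exact (G.mk_mem_quotImage hS hES x).2 (hx S ⟨⟨hS, hES⟩, hT⟩)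
  exchange := by
    rintro _ ⟨S, hS, hES, rfl⟩ q hq _ ⟨S', hS', hES', rfl⟩ h h'
    obtain ⟨x, rfl⟩ := G.toQuot_surjective q
    rw [G.mk_mem_quotImage hS hES] at hq
    have hEx : E ⊆ G.closure (insert x.1 S) :=
      hES.trans ((Set.subset_insert _ _).trans (G.subset_closure _))
    have hle : flatClosure (fun T : Set (G.QuotSpace E) =>
        ∃ S, G.IsFlat S ∧ E ⊆ S ∧ T = G.quotImage E S)
        (insert (G.toQuot x) (G.quotImage E S)) ⊆
        G.quotImage E (G.closure (insert x.1 S)) := by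
      refine Set.sInter_subset_of_mem ⟨⟨_, G.isFlat_closure _, hEx, rfl⟩, ?_⟩
      refine Set.insert_subset ⟨x, G.subset_closure _ (Set.mem_insert _ _), rfl⟩ ?_
      rintro _ ⟨y, hy, rfl⟩
      exact ⟨y, G.subset_closure _ (Set.mem_insert_of_mem _ hy), rfl⟩
    have h1 : S ⊂ S' := ⟨(G.quotImage_subset_iff hS' hES').1 h.1,
      fun hc => h.2 ((G.quotImage_subset_iff hS hES).2 hc)⟩
    have h2 : S' ⊂ G.closure (insert x.1 S) := by
      have h3 := h'.trans_subset hle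
      exact ⟨(G.quotImage_subset_iff (G.isFlat_closure _) hEx).1 h3.1,
        fun hc => h3.2 ((G.quotImage_subset_iff hS' hES').2 hc)⟩
    exact G.exchange S hS x.1 hq S' hS' h1 h2
  finitary B q hq := by
    rw [flatClosure_quotient] at hq
    obtain ⟨x, hx, rfl⟩ := hq
    obtain ⟨C, hC, hfin, hxC⟩ := G.finitary _ _ hx
    refine ⟨{q | ∃ y : {y : X // y ∉ E}, y.1 ∈ C ∧ G.toQuot y = q},
      ?_, ?_, ?_⟩
    · rintro _ ⟨y, hy, rfl⟩
      obtain hyE | ⟨_, hyB⟩ := hC hy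
      · exact absurd hyE y.2
      · exact hyB
    · exact (hfin.preimage Subtype.val_injective.injOn).image G.toQuot
    · rw [flatClosure_quotient]
      refine ⟨x, ?_, rfl⟩
      refine G.closure_subset (G.isFlat_closure _) ?_ hxC
      intro y hy
      by_cases hyE : y ∈ E
      · exact G.subset_closure _ (Or.inl hyE)
      · exact G.subset_closure _ (Or.inr ⟨hyE, ⟨y, hyE⟩, hy, rfl⟩)

end Quotient

section AffinoProjective

variable {P : Type*} (G : PointGeometry P)

/-- A set `X` of points of the projective space `G` is affino-projective when together with some
hyperplane it covers the whole space. -/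
def IsAffinoProjective (X : Set P) : Prop :=
  ∃ H, G.IsHyperplane H ∧ X ∪ H = Set.univ

/-- `X` is locally affino-projective when, for every `x ∈ X`, the quotient `X / x` is an
affino-projective subset of the quotient `P / x`. -/
def IsLocallyAffinoProjective (X : Set P) : Prop :=
  ∀ x ∈ X, (G.quotient (G.isFlat_singleton x)).IsAffinoProjective (G.quotImage {x} X)

end AffinoProjective

end PointGeometry

section ProjectiveSpace

variable (K V : Type*) [DivisionRing K] [AddCommGroup V] [Module K V]

variable {K V} in
/-- The projectivization of a vector subspace `W`, as a set of points. -/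
def projSet (W : Submodule K V) : Set (ℙ K V) := {p | p.submodule ≤ W}

variable {K V} in
theorem mk_mem_projSet {W : Submodule K V} {v : V} (hv : v ≠ 0) :
    Projectivization.mk K v hv ∈ projSet W ↔ v ∈ W := by
  change (Projectivization.mk K v hv).submodule ≤ W ↔ _
  rw [Projectivization.submodule_mk, Submodule.span_singleton_le_iff_mem]

variable {K V} in
theorem projSet_subset_iff {W W' : Submodule K V} : projSet W ⊆ projSet W' ↔ W ≤ W' := by
  constructor
  · intro h v hv
    by_cases h0 : v = 0
    · exact h0 ▸ W'.zero_mem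
    · exact (mk_mem_projSet h0).1 (h ((mk_mem_projSet h0).2 hv))
  · exact fun h p hp => le_trans hp h

variable {K V} in
theorem projSet_ssubset_iff {W W' : Submodule K V} : projSet W ⊂ projSet W' ↔ W < W' := by
  rw [ssubset_iff_subset_not_subset, lt_iff_le_not_ge, projSet_subset_iff, projSet_subset_iff]

variable {K V} in
theorem flatClosure_proj (A : Set (ℙ K V)) :
    flatClosure (fun S : Set (ℙ K V) => ∃ W : Submodule K V, S = projSet W) A =
      projSet (⨆ p ∈ A, p.submodule) := by
  apply Set.Subset.antisymm
  · exact Set.sInter_subset_of_mem ⟨⟨_, rfl⟩,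
      fun p hp => le_iSup₂_of_le (f := fun (q : ℙ K V) (_ : q ∈ A) => q.submodule) p hp le_rfl⟩
  · rintro p hp _ ⟨⟨W, rfl⟩, hA⟩
    exact le_trans (show p.submodule ≤ _ from hp) (iSup₂_le fun q hq => hA hq)

/-- The projective space `ℙ(V)` as a geometry: its subspaces are the projectivizations of the
vector subspaces of `V`. -/
def projGeometry : PointGeometry (ℙ K V) where
  IsFlat S := ∃ W : Submodule K V, S = projSet W
  isFlat_empty := ⟨⊥, by
    ext p
    induction p with
    | h v hv => simpa [mk_mem_projSet] using hv⟩
  isFlat_univ := ⟨⊤, by ext p; simp [projSet]⟩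
  isFlat_singleton p := ⟨p.submodule, by
    ext q
    constructor
    · rintro rfl
      exact le_refl q.submodule
    · intro h
      apply Projectivization.submodule_injective
      exact Submodule.eq_of_le_of_finrank_eq h
        (by rw [Projectivization.finrank_submodule, Projectivization.finrank_submodule])⟩
  isFlat_sInter F hF := by
    refine ⟨sInf {W | projSet W ∈ F}, ?_⟩
    ext p
    constructor
    · exact fun h => (le_sInf fun W hW => h _ hW : p.submodule ≤ _)
    · intro h S hS
      obtain ⟨W, rfl⟩ := hF S hS
      exact le_trans (show p.submodule ≤ _ from h) (sInf_le hS)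
  exchange := by
    rintro _ ⟨W, rfl⟩ p hp _ ⟨W', rfl⟩ h h'
    rw [flatClosure_proj, projSet_ssubset_iff] at h'
    rw [projSet_ssubset_iff] at h
    induction p with
    | h v hv =>
      rw [mk_mem_projSet] at hp
      refine (Submodule.covBy_span_singleton_sup hp).2 h (h'.trans_le ?_)
      refine iSup₂_le fun q hq => ?_
      rcases hq with rfl | hq
      · rw [Projectivization.submodule_mk]
        exact le_sup_left
      · exact le_trans hq le_sup_right
  finitary A p hp := by
    rw [flatClosure_proj] at hp
    induction p with
    | h v hv =>
      rw [mk_mem_projSet, ← sSup_image, Submodule.mem_sSup_iff_exists_finset] at hp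
      obtain ⟨s, hs, hv'⟩ := hp
      refine ⟨{q ∈ A | q.submodule ∈ s}, fun q h => h.1,
        Set.Finite.of_finite_image (f := fun q : ℙ K V => q.submodule)
          (s.finite_toSet.subset (by rintro _ ⟨q, hq, rfl⟩; exact hq.2))
          Projectivization.submodule_injective.injOn, ?_⟩
      rw [flatClosure_proj, mk_mem_projSet]
      refine (iSup₂_le fun M hM => ?_ : (⨆ M ∈ s, M) ≤ _) hv'
      obtain ⟨q, hq, rfl⟩ := hs hM
      exact le_iSup₂_of_le (f := fun (q : ℙ K V) (_ : q ∈ {q ∈ A | q.submodule ∈ s}) =>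
        q.submodule) q ⟨hq, hM⟩ le_rfl

end ProjectiveSpace

section PartialProjective

variable {K K' V V' : Type*} [DivisionRing K] [DivisionRing K'] [AddCommGroup V]
  [AddCommGroup V'] [Module K V] [Module K' V']

/-- The partial map `ℙ(V) ⇢ ℙ(V')`, `⟨v⟩ ↦ ⟨Φ v⟩`, associated to a semilinear map `Φ`. It is
defined on the complement of `ℙ(ker Φ)`, and does not depend on the choice of `v`. -/
noncomputable def partialProj {σ : K →+* K'} (Φ : V →ₛₗ[σ] V') : ℙ K V →. ℙ K' V' :=
  fun p => ⟨Φ p.rep ≠ 0, fun h => Projectivization.mk K' (Φ p.rep) h⟩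

theorem mem_partialProj_mk {σ : K →+* K'} (Φ : V →ₛₗ[σ] V') {v : V} (hv : v ≠ 0)
    (q : ℙ K' V') : q ∈ partialProj Φ (Projectivization.mk K v hv) ↔
      ∃ h : Φ v ≠ 0, q = Projectivization.mk K' (Φ v) h := by
  obtain ⟨a, ha⟩ := Projectivization.exists_smul_eq_mk_rep K v hv
  have hΦ : Φ (Projectivization.mk K v hv).rep = σ a • Φ v := by
    rw [← ha, Units.smul_def, Φ.map_smulₛₗ]
  have hσ : σ a ≠ 0 := by simp
  constructor
  · rintro ⟨h, rfl⟩
    have h' : Φ v ≠ 0 := fun hc => h (by rw [hΦ, hc, smul_zero])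
    exact ⟨h', (Projectivization.mk_eq_mk_iff' K' _ _ _ _).2 ⟨σ a, hΦ.symm⟩⟩
  · rintro ⟨h, rfl⟩
    have h' : Φ (Projectivization.mk K v hv).rep ≠ 0 := by
      rw [hΦ]
      exact smul_ne_zero hσ h
    exact ⟨h',
      (Projectivization.mk_eq_mk_iff' K' _ _ _ _).2 ⟨σ a, hΦ.symm⟩⟩

/-- A partial projective morphism `ℙ(V) ⇢ ℙ(V')`: a partial map induced by a semilinear map
(with respect to some, not necessarily surjective, ring homomorphism `K → K'`). -/
def IsPartialProjective (φ : ℙ K V →. ℙ K' V') : Prop :=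
  ∃ (σ : K →+* K') (Φ : V →ₛₗ[σ] V'), φ = partialProj Φ

end PartialProjective

section BenzPlanes

/-- The quadric `Q = 0` in the real projective space of dimension `3`. -/
def quadric (Q : QuadraticForm ℝ (Fin 4 → ℝ)) : Set (ℙ ℝ (Fin 4 → ℝ)) :=
  {p | Q p.rep = 0}

/-- The singular points of the quadric `Q = 0`: the points in the radical of the polar form. -/
def singularPoints (Q : QuadraticForm ℝ (Fin 4 → ℝ)) : Set (ℙ ℝ (Fin 4 → ℝ)) :=
  {p ∈ quadric Q | ∀ w, QuadraticMap.polar Q p.rep w = 0}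

/-- A Möbius geometry: an ellipsoid, that is, a quadric with equation `x² + y² + z² = t²` in
suitable homogeneous coordinates. -/
def IsMoebiusGeometry (X : Set (ℙ ℝ (Fin 4 → ℝ))) : Prop :=
  ∃ Q : QuadraticForm ℝ (Fin 4 → ℝ),
    Q.Equivalent (QuadraticMap.weightedSumSquares ℝ (![1, 1, 1, -1] : Fin 4 → ℝ)) ∧
    X = quadric Q

/-- A Minkowski geometry: a non-singular ruled quadric, that is, a quadric with equation
`x² + y² = z² + t²` in suitable homogeneous coordinates. -/
def IsMinkowskiGeometry (X : Set (ℙ ℝ (Fin 4 → ℝ))) : Prop :=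
  ∃ Q : QuadraticForm ℝ (Fin 4 → ℝ),
    Q.Equivalent (QuadraticMap.weightedSumSquares ℝ (![1, 1, -1, -1] : Fin 4 → ℝ)) ∧
    X = quadric Q

/-- A Laguerre geometry: a cone without its vertex, where a cone is a quadric with equation
`x² + y² = z²` in suitable homogeneous coordinates `x, y, z, t`. -/
def IsLaguerreGeometry (X : Set (ℙ ℝ (Fin 4 → ℝ))) : Prop :=
  ∃ Q : QuadraticForm ℝ (Fin 4 → ℝ),
    Q.Equivalent (QuadraticMap.weightedSumSquares ℝ (![1, 1, -1, 0] : Fin 4 → ℝ)) ∧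
    X = quadric Q \ singularPoints Q

end BenzPlanes

/-! ### Independence of two or three vectors over a division ring -/

section LinearIndependence

variable {K M : Type*} [DivisionRing K] [AddCommGroup M] [Module K M]

/-! The morphism is studied by projecting from its points. Fix `x ∈ X`. In `ℙ(V)/x` the quotient
`X/x` covers the complement of a hyperplane, which is an affine space, and `φ` followed by the
projection from `φ(x)` gives a partial map on this affine space that preserves collinearity. As the
image of `φ` is not in a plane, the projected image is not on a line. A fundamental theorem of
affine geometry for such maps (`LinePreserving.exists_semilinear`) then yields a semilinear map `V →
V'/φ(x)` that induces `φ` modulo `φ(x)` (`IsLocalMorphism.exists_isLift`).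

Two such lifts, at `x` and `u` with `φ(x) ≠ φ(u)`, agree up to a scalar modulo the line `φ(x) ∨
φ(u)` (`IsLocalMorphism.isLift_unique`). After rescaling they glue to one semilinear map `Θ : V →
V'` (`exists_glue`). Off that line `Θ` induces `φ`, because a point is the intersection of its joins
with the two centres; points on the line are reached with a third centre. Uniqueness comes from the
same comparison of scalars.

The affine theorem starts with planes. Images of parallel lines are concurrent: with at least four
scalars by Desargues applied to two triangles perspective from an axis, and for three scalars by
explicit coordinates in characteristic 3. Concurrency in the two coordinate directions gives
coordinates in which the map is `(x, y) ↦ e + a(x)d₁ + b(y)d₂`. The diagonal gives `a = b`, lines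
through the origin give multiplicativity, and concurrency in the diagonal direction gives
additivity. In higher dimension, representatives are propagated from a frame of three points through
triangles, and lines whose image degenerates are treated by moving off them.

For the quadrics, a line through a regular point outside the tangent plane meets the quadric once
more; this is stereographic projection. A plane spanned by three points of the quadric is not
totally isotropic, so it meets the quadric in a conic or a pair of lines containing four points in
general position. -/

theorem linearIndependent_triple_iff {a b c : M} : LinearIndependent K ![a, b, c] ↔
    ∀ x y z : K, x • a + y • b + z • c = 0 → x = 0 ∧ y = 0 ∧ z = 0 := by
  rw [Fintype.linearIndependent_iff]
  constructor
  · intro h x y z hxyz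
    have := h ![x, y, z] (by simpa [Fin.sum_univ_three] using hxyz)
    exact ⟨this 0, this 1, this 2⟩
  · intro h g hg
    have := h (g 0) (g 1) (g 2) (by simpa [Fin.sum_univ_three] using hg)
    intro i
    fin_cases i
    exacts [this.1, this.2.1, this.2.2]

theorem LinearIndependent.eq_of_triple {a b c : M} (h : LinearIndependent K ![a, b, c])
    {x y z x' y' z' : K} (e : x • a + y • b + z • c = x' • a + y' • b + z' • c) :
    x = x' ∧ y = y' ∧ z = z' := by
  have := linearIndependent_triple_iff.1 h (x - x') (y - y') (z - z') (by
    rw [sub_smul, sub_smul, sub_smul]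
    rw [← sub_eq_zero] at e
    rw [← e]
    abel)
  simpa [sub_eq_zero] using this

/-- A dimension count: `n` vectors whose span contains `n` independent ones span dimension `n`.
Nearly every independence claim about triangles is obtained through this. -/
theorem LinearIndependent.of_forall_mem_span_range {n : ℕ} {v w : Fin n → M}
    (hv : LinearIndependent K v) (h : ∀ i, v i ∈ Submodule.span K (Set.range w)) :
    LinearIndependent K w := by
  rw [linearIndependent_iff_card_le_finrank_span]
  have h1 := linearIndependent_iff_card_eq_finrank_span.1 hv
  rw [h1]
  have : FiniteDimensional K (Submodule.span K (Set.range w)) :=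
    FiniteDimensional.span_of_finite K (Set.finite_range w)
  exact Submodule.finrank_mono (Submodule.span_le.2 (by rintro _ ⟨i, rfl⟩; exact h i))

theorem range_pair {M : Type*} (a b : M) : Set.range ![a, b] = {a, b} := by
  simp [Set.pair_comm]

theorem range_triple {M : Type*} (a b c : M) : Set.range ![a, b, c] = {a, b, c} := by
  ext x
  simp [Matrix.range_cons]
  tauto

theorem LinearIndependent.triple_of_mem_span {a b c p q r : M}
    (h : LinearIndependent K ![a, b, c]) (ha : a ∈ Submodule.span K {p, q, r})
    (hb : b ∈ Submodule.span K {p, q, r}) (hc : c ∈ Submodule.span K {p, q, r}) :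
    LinearIndependent K ![p, q, r] := by
  refine h.of_forall_mem_span_range fun i => ?_
  rw [range_triple]
  fin_cases i
  exacts [ha, hb, hc]

theorem LinearIndependent.pair_of_mem_span {a b p q : M}
    (h : LinearIndependent K ![a, b]) (ha : a ∈ Submodule.span K {p, q})
    (hb : b ∈ Submodule.span K {p, q}) :
    LinearIndependent K ![p, q] := by
  refine h.of_forall_mem_span_range fun i => ?_
  rw [range_pair]
  fin_cases i
  exacts [ha, hb]

theorem linearIndependent_triple_iff_notMem {a b c : M} : LinearIndependent K ![a, b, c] ↔
    LinearIndependent K ![a, b] ∧ c ∉ Submodule.span K {a, b} := by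
  constructor
  · intro h
    rw [linearIndependent_triple_iff] at h
    refine ⟨LinearIndependent.pair_iff.2 fun s t hst => ?_, fun hc => ?_⟩
    · have := h s t 0 (by simpa using hst)
      exact ⟨this.1, this.2.1⟩
    · obtain ⟨s, t, rfl⟩ := Submodule.mem_span_pair.1 hc
      have := h s t (-1) (by rw [neg_smul, one_smul, add_neg_cancel])
      simpa using this.2.2
  · rintro ⟨h, hc⟩
    rw [linearIndependent_triple_iff]
    intro x y z e
    have hz : z = 0 := by
      by_contra hz
      refine hc (Submodule.mem_span_pair.2 ⟨-(z⁻¹ * x), -(z⁻¹ * y), ?_⟩)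
      rw [add_eq_zero_iff_eq_neg'] at e
      have : c = z⁻¹ • (z • c) := by rw [smul_smul, inv_mul_cancel₀ hz, one_smul]
      rw [this, e, smul_neg, smul_add, neg_smul, neg_smul, mul_smul, mul_smul]
      abel
    subst hz
    rw [zero_smul, add_zero] at e
    have := LinearIndependent.pair_iff.1 h x y e
    exact ⟨this.1, this.2, rfl⟩

theorem linearIndependent_pair_iff_notMem {a b : M} : LinearIndependent K ![a, b] ↔
    a ≠ 0 ∧ b ∉ Submodule.span K {a} := by
  constructor
  · intro h
    have ha : a ≠ 0 := h.ne_zero 0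
    refine ⟨ha, fun hb => ?_⟩
    obtain ⟨t, rfl⟩ := Submodule.mem_span_singleton.1 hb
    exact (LinearIndependent.pair_iff' ha).1 h t rfl
  · rintro ⟨ha, hb⟩
    exact (LinearIndependent.pair_iff' ha).2 fun t ht =>
      hb (Submodule.mem_span_singleton.2 ⟨t, ht⟩)

theorem LinearIndependent.pair_swap {a b : M} (h : LinearIndependent K ![a, b]) :
    LinearIndependent K ![b, a] :=
  h.pair_of_mem_span (Submodule.subset_span (by simp)) (Submodule.subset_span (by simp))

theorem LinearIndependent.triple_perm {a b c p q r : M} (h : LinearIndependent K ![a, b, c])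
    (e : ({a, b, c} : Set M) ⊆ {p, q, r}) : LinearIndependent K ![p, q, r] :=
  h.triple_of_mem_span (Submodule.subset_span (e (by simp)))
    (Submodule.subset_span (e (by simp))) (Submodule.subset_span (e (by simp)))

theorem mem_span_pair_exchange {x y z : M} (h : z ∈ Submodule.span K {x, y})
    (hz : z ∉ Submodule.span K {x}) : y ∈ Submodule.span K {x, z} := by
  obtain ⟨a, b, rfl⟩ := Submodule.mem_span_pair.1 h
  have hb : b ≠ 0 := by
    rintro rfl
    exact hz (Submodule.mem_span_singleton.2 ⟨a, by simp⟩)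
  refine Submodule.mem_span_pair.2 ⟨-(b⁻¹ * a), b⁻¹, ?_⟩
  rw [smul_add, smul_smul b⁻¹ b, inv_mul_cancel₀ hb, one_smul, neg_smul, mul_smul]
  abel

theorem span_pair_eq_of_linearIndependent {a b p q : M} (h : LinearIndependent K ![p, q])
    (hp : p ∈ Submodule.span K {a, b}) (hq : q ∈ Submodule.span K {a, b}) :
    Submodule.span K {p, q} = Submodule.span K {a, b} := by
  have : FiniteDimensional K (Submodule.span K ({a, b} : Set M)) :=
    FiniteDimensional.span_of_finite K (by simp)
  refine Submodule.eq_of_le_of_finrank_le (Submodule.span_le.2 ?_) ?_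
  · rintro _ (rfl | rfl) <;> assumption
  · have h1 := finrank_span_eq_card h
    rw [range_pair] at h1
    rw [h1, ← range_pair]
    exact finrank_range_le_card _

theorem span_singleton_eq_iff {u v : M} : Submodule.span K {u} = Submodule.span K {v} ↔
    ∃ c : K, c ≠ 0 ∧ u = c • v := by
  rw [eq_comm, Submodule.span_singleton_eq_span_singleton]
  constructor
  · rintro ⟨z, rfl⟩
    exact ⟨z, z.ne_zero, rfl⟩
  · rintro ⟨c, hc, rfl⟩
    exact ⟨Units.mk0 c hc, rfl⟩

theorem span_smul_singleton {c : K} (hc : c ≠ 0) (u : M) :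
    Submodule.span K {c • u} = Submodule.span K {u} :=
  span_singleton_eq_iff.2 ⟨c, hc, rfl⟩

theorem span_singleton_eq_of_mem {u v : M} (hu : u ≠ 0) (h : u ∈ Submodule.span K {v}) :
    Submodule.span K {u} = Submodule.span K {v} := by
  obtain ⟨c, rfl⟩ := Submodule.mem_span_singleton.1 h
  exact span_smul_singleton (by rintro rfl; simp at hu) v

theorem LinearIndependent.pair_congr {a b p q : M} (h : LinearIndependent K ![a, b])
    (ha : Submodule.span K {a} = Submodule.span K {p})
    (hb : Submodule.span K {b} = Submodule.span K {q}) : LinearIndependent K ![p, q] := by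
  refine h.pair_of_mem_span (Submodule.span_mono (s := {p}) (by simp) ?_)
    (Submodule.span_mono (s := {q}) (by simp) ?_)
  · rw [← ha]; exact Submodule.mem_span_singleton_self a
  · rw [← hb]; exact Submodule.mem_span_singleton_self b

theorem LinearIndependent.triple_congr {a b c p q r : M} (h : LinearIndependent K ![a, b, c])
    (ha : Submodule.span K {a} = Submodule.span K {p})
    (hb : Submodule.span K {b} = Submodule.span K {q})
    (hc : Submodule.span K {c} = Submodule.span K {r}) : LinearIndependent K ![p, q, r] := by
  refine h.triple_of_mem_span (Submodule.span_mono (s := {p}) (by simp) ?_)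
    (Submodule.span_mono (s := {q}) (by simp) ?_) (Submodule.span_mono (s := {r}) (by simp) ?_)
  · rw [← ha]; exact Submodule.mem_span_singleton_self a
  · rw [← hb]; exact Submodule.mem_span_singleton_self b
  · rw [← hc]; exact Submodule.mem_span_singleton_self c

theorem span_pair_congr {a b p q : M} (ha : Submodule.span K {a} = Submodule.span K {p})
    (hb : Submodule.span K {b} = Submodule.span K {q}) :
    Submodule.span K {a, b} = Submodule.span K {p, q} := by
  rw [Submodule.span_insert, Submodule.span_insert, ha, hb]

end LinearIndependence

/-! ### Maps preserving collinearity, and Desargues' theorem -/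

section LinePreserving

variable {K K' H Z : Type*} [DivisionRing K] [DivisionRing K'] [AddCommGroup H] [Module K H]
  [AddCommGroup Z] [Module K' Z]

variable (K K') in
/-- The map `γ` sends collinear points of the affine space `H` to collinear points of the
projective space of `Z`; the points where `γ` vanishes are those where the projective map is
undefined. -/
def LinePreserving (γ : H → Z) : Prop :=
  ∀ (p q : H) (c : K), γ (p + c • (q - p)) ∈ Submodule.span K' {γ p, γ q}

theorem LinePreserving.comp_affine {γ : H → Z} (hγ : LinePreserving K K' γ) {H₁ : Type*}
    [AddCommGroup H₁] [Module K H₁] (g : H₁ → H)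
    (hg : ∀ p q (c : K), g (p + c • (q - p)) = g p + c • (g q - g p)) :
    LinePreserving K K' (γ ∘ g) := by
  intro p q c
  simp only [Function.comp, hg]
  exact hγ _ _ _

/-- Every point of the plane `pqr` lies on a line joining a point of `pq` to a point of `pr`, namely
the points with parameters `x / (1 - t)` and `y / t`. This needs a scalar `t` other than 0 and 1. -/
theorem LinePreserving.mem_of_plane (hK : ∃ t : K, t ≠ 0 ∧ t ≠ 1) {γ : H → Z}
    (hγ : LinePreserving K K' γ) {N : Submodule K' Z} {p q r : H} (hp : γ p ∈ N) (hq : γ q ∈ N)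
    (hr : γ r ∈ N) (x y : K) : γ (p + x • (q - p) + y • (r - p)) ∈ N := by
  have key : ∀ u v (c : K), γ u ∈ N → γ v ∈ N → γ (u + c • (v - u)) ∈ N := fun u v c hu hv =>
    Submodule.span_le.2 (by rintro _ (rfl | rfl) <;> assumption) (hγ u v c)
  obtain ⟨t, h0, h1⟩ := hK
  have h1' : 1 - t ≠ 0 := sub_ne_zero.2 h1.symm
  have := key _ _ t (key p q ((1 - t)⁻¹ * x) hp hq) (key p r (t⁻¹ * y) hp hr)
  convert this using 2
  have e1 : x = (1 - t) * ((1 - t)⁻¹ * x) := by rw [← mul_assoc, mul_inv_cancel₀ h1', one_mul]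
  have e2 : y = t * (t⁻¹ * y) := by rw [← mul_assoc, mul_inv_cancel₀ h0, one_mul]
  conv_lhs => rw [e1, e2]
  generalize (1 - t)⁻¹ * x = x'
  generalize t⁻¹ * y = y'
  simp only [sub_mul, one_mul, sub_smul, smul_add, smul_sub, mul_smul]
  abel

/-- The points `p` and `q` lie on the line through any two distinct points of their line, so the
images of those two points span at least as much as `γ p` and `γ q`. -/
theorem LinePreserving.span_line_eq {γ : H → Z} (hγ : LinePreserving K K' γ) {p q : H}
    (h : LinearIndependent K' ![γ p, γ q]) {x y : K} (hxy : x ≠ y) :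
    LinearIndependent K' ![γ (p + x • (q - p)), γ (p + y • (q - p))] ∧
    Submodule.span K' {γ (p + x • (q - p)), γ (p + y • (q - p))} =
      Submodule.span K' {γ p, γ q} := by
  have hd : y - x ≠ 0 := sub_ne_zero.2 hxy.symm
  have hi : LinearIndependent K' ![γ (p + x • (q - p)), γ (p + y • (q - p))] := by
    have hz : ∀ z : K, γ (p + z • (q - p)) ∈
        Submodule.span K' {γ (p + x • (q - p)), γ (p + y • (q - p))} := fun z => by
      have := hγ (p + x • (q - p)) (p + y • (q - p)) ((z - x) * (y - x)⁻¹)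
      convert this using 2
      have : p + y • (q - p) - (p + x • (q - p)) = (y - x) • (q - p) := by
        rw [sub_smul]; abel
      rw [this, smul_smul, mul_assoc, inv_mul_cancel₀ hd, mul_one, sub_smul]
      abel
    refine h.pair_of_mem_span ?_ ?_
    · simpa using hz 0
    · simpa using hz 1
  exact ⟨hi, span_pair_eq_of_linearIndependent hi (hγ _ _ _) (hγ _ _ _)⟩

/-- Triangles are mapped to triangles. -/
theorem LinePreserving.linearIndependent_triple (hK : ∃ t : K, t ≠ 0 ∧ t ≠ 1) {γ : K × K → Z}
    (hγ : LinePreserving K K' γ)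
    (h : LinearIndependent K' ![γ (0, 0), γ (1, 0), γ (0, 1)]) {p q r : K × K}
    (hpqr : LinearIndependent K ![q - p, r - p]) : LinearIndependent K' ![γ p, γ q, γ r] := by
  have htop : Submodule.span K {q - p, r - p} = ⊤ := by
    rw [← range_pair]
    exact hpqr.span_eq_top_of_card_eq_finrank (by simp)
  -- The triangle generates the whole affine plane, so its image spans the image of the reference
  -- triangle.
  have key : ∀ u, γ u ∈ Submodule.span K' {γ p, γ q, γ r} := by
    intro u
    have hu : u - p ∈ Submodule.span K {q - p, r - p} := htop ▸ Submodule.mem_top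
    obtain ⟨x, y, hxy⟩ := Submodule.mem_span_pair.1 hu
    have : u = p + x • (q - p) + y • (r - p) := by rw [add_assoc, hxy]; abel
    rw [this]
    apply hγ.mem_of_plane hK <;> exact Submodule.subset_span (by simp)
  exact h.triple_of_mem_span (key _) (key _) (key _)

/-- Desargues: triangles that are perspective from a line are perspective from a point. -/
theorem exists_center_of_axis {M : Submodule K' Z} {w A₁ B₁ C₁ A₂ B₂ C₂ P Q R : Z}
    (hw : w ∉ M)
    (hA₁ : A₁ - w ∈ M) (hB₁ : B₁ - w ∈ M) (hC₁ : C₁ - w ∈ M)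
    (hA₂ : A₂ - w ∈ M) (hB₂ : B₂ - w ∈ M) (hC₂ : C₂ - w ∈ M)
    (hP : P ∈ M) (hQ : Q ∈ M) (hR : R ∈ M) (hP0 : P ≠ 0) (hQ0 : Q ≠ 0) (hR0 : R ≠ 0)
    (h : LinearIndependent K' ![A₁, B₁, C₁])
    (hP₁ : P ∈ Submodule.span K' {A₁, B₁}) (hP₂ : P ∈ Submodule.span K' {A₂, B₂})
    (hQ₁ : Q ∈ Submodule.span K' {B₁, C₁}) (hQ₂ : Q ∈ Submodule.span K' {B₂, C₂})
    (hR₁ : R ∈ Submodule.span K' {A₁, C₁}) (hR₂ : R ∈ Submodule.span K' {A₂, C₂}) :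
    ∃ ρ : K', A₂ - ρ • A₁ = B₂ - ρ • B₁ ∧ A₂ - ρ • A₁ = C₂ - ρ • C₁ := by
  -- The vectors are normalized to lie in the chart `w + M`; a combination of two of them falls into
  -- `M` only when its coefficients add up to 0.
  have key : ∀ {A B P : Z}, A - w ∈ M → B - w ∈ M → P ∈ M → P ∈ Submodule.span K' {A, B} →
      ∃ c : K', P = c • (A - B) := by
    intro A B P hA hB hP h
    obtain ⟨a, b, rfl⟩ := Submodule.mem_span_pair.1 h
    have h1 : (a + b) • w ∈ M := by
      have := M.sub_mem (M.sub_mem hP (M.smul_mem a hA)) (M.smul_mem b hB)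
      convert this using 1
      rw [smul_sub, smul_sub, add_smul]
      abel
    have h2 : a + b = 0 := by
      by_contra h2
      exact hw ((M.smul_mem_iff h2).1 h1)
    refine ⟨a, ?_⟩
    rw [eq_neg_of_add_eq_zero_right h2, neg_smul, smul_sub, sub_eq_add_neg]
  have key2 : ∀ {A B A' B' P : Z}, A - w ∈ M → B - w ∈ M → A' - w ∈ M → B' - w ∈ M →
      P ∈ M → P ≠ 0 → P ∈ Submodule.span K' {A, B} → P ∈ Submodule.span K' {A', B'} →
      ∃ c : K', A' - B' = c • (A - B) := by
    intro A B A' B' P hA hB hA' hB' hP hP0 h1 h2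
    obtain ⟨c, hc⟩ := key hA hB hP h1
    obtain ⟨c', hc'⟩ := key hA' hB' hP h2
    have h0 : c' ≠ 0 := by rintro rfl; exact hP0 (by simpa using hc')
    refine ⟨c'⁻¹ * c, ?_⟩
    rw [mul_smul, ← hc, hc', smul_smul, inv_mul_cancel₀ h0, one_smul]
  obtain ⟨a, ha⟩ := key2 hA₁ hB₁ hA₂ hB₂ hP hP0 hP₁ hP₂
  obtain ⟨b, hb⟩ := key2 hB₁ hC₁ hB₂ hC₂ hQ hQ0 hQ₁ hQ₂
  obtain ⟨c, hc⟩ := key2 hA₁ hC₁ hA₂ hC₂ hR hR0 hR₁ hR₂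
  -- The two expressions of `A₂ - C₂`, directly and through `B₂`, are compared in the basis `A₁, B₁,
  -- C₁`; the three ratios coincide and give `ρ`.
  have e : a • A₁ + (b - a) • B₁ + (-b) • C₁ = c • A₁ + (0 : K') • B₁ + (-c) • C₁ := by
    have : a • (A₁ - B₁) + b • (B₁ - C₁) = c • (A₁ - C₁) := by
      rw [← ha, ← hb, ← hc]; abel
    simp only [smul_sub] at this
    rw [sub_smul, neg_smul, neg_smul, zero_smul, add_zero, ← sub_eq_add_neg, ← sub_eq_add_neg,
      ← this]
    abel
  obtain ⟨h1, h2, -⟩ := h.eq_of_triple e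
  rw [sub_eq_zero] at h2
  subst h1 h2
  refine ⟨b, ?_, ?_⟩
  · rw [smul_sub] at ha
    rw [sub_eq_sub_iff_sub_eq_sub, ha]
  · rw [smul_sub] at hc
    rw [sub_eq_sub_iff_sub_eq_sub, hc]

end LinePreserving

/-! ### Images of parallel lines are concurrent -/

section Concurrency

variable {K K' Z : Type*} [DivisionRing K] [DivisionRing K'] [AddCommGroup Z] [Module K' Z]

/-- The conditions make `(0, 1)`, `(1, k)`, `(s, k')` a triangle with vertices off the axis `y = 0`
and no side parallel to it, as Desargues requires. -/
theorem exists_avoiding_pair {k₀ k₁ : K} (h₀ : k₀ ≠ 0 ∧ k₀ ≠ 1) (h₁ : k₁ ≠ 0 ∧ k₁ ≠ 1)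
    (h₀₁ : k₀ ≠ k₁) {s : K} (hs : s ≠ 1) :
    ∃ k k' : K, k ≠ 0 ∧ k ≠ 1 ∧ k' ≠ 0 ∧ k' ≠ 1 ∧ k ≠ k' ∧ k' - 1 ≠ s * (k - 1) := by
  by_cases h : k₁ - 1 = s * (k₀ - 1)
  · by_cases h' : k₀ - 1 = s * (k₁ - 1)
    · have hk₀ : k₀ - 1 ≠ 0 := sub_ne_zero.2 h₀.2
      have hss : s * s = 1 := by
        have : (s * s - 1) * (k₀ - 1) = 0 := by
          rw [sub_mul, mul_assoc, ← h, ← h', one_mul, sub_self]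
        exact sub_eq_zero.1 ((mul_eq_zero.1 this).resolve_right hk₀)
      have hs' : s = -1 := (mul_self_eq_one_iff.1 hss).resolve_left hs
      subst hs'
      have h2 : k₀ + k₁ = 2 := by
        rw [neg_one_mul] at h
        rw [← one_add_one_eq_two, ← sub_eq_zero]
        rw [← sub_eq_zero] at h
        rw [← h]
        abel
      have h20 : (2 : K) ≠ 0 := fun h2 => hs (by
        rw [← one_add_one_eq_two] at h2
        exact (eq_neg_of_add_eq_zero_left h2).symm)
      -- Here both orders of `k₀, k₁` fail, which forces `s = -1`, `k₀ + k₁ = 2` and characteristic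
      -- different from 2; the scalar 2 then serves.
      refine ⟨k₀, 2, h₀.1, h₀.2, h20, ?_, ?_, ?_⟩
      · intro h21
        rw [← one_add_one_eq_two] at h21
        simp at h21
      · intro h02
        rw [h02] at h2
        exact h₁.1 (by simpa using h2)
      · intro h02
        rw [← one_add_one_eq_two, neg_one_mul, add_sub_cancel_right, neg_sub, eq_sub_iff_add_eq] at h02
        exact h₀.1 (by simpa using h02)
    · exact ⟨k₁, k₀, h₁.1, h₁.2, h₀.1, h₀.2, h₀₁.symm, h'⟩
  · exact ⟨k₀, k₁, h₀.1, h₀.2, h₁.1, h₁.2, h₀₁, h⟩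

theorem linearIndependent_prod_pair {x y x' y' : K} (hx : x ≠ 0) (h : y' ≠ x' * (x⁻¹ * y)) :
    LinearIndependent K ![((x, y) : K × K), (x', y')] := by
  rw [LinearIndependent.pair_iff]
  intro s t hst
  simp only [Prod.smul_mk, smul_eq_mul, Prod.mk_add_mk, Prod.mk_eq_zero] at hst
  obtain ⟨h1, h2⟩ := hst
  have hs : s = -(t * x' * x⁻¹) := by
    rw [add_eq_zero_iff_eq_neg] at h1
    rw [← neg_mul, ← h1, mul_assoc, mul_inv_cancel₀ hx, mul_one]
  have ht : t = 0 := by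
    by_contra ht
    apply h
    rw [hs] at h2
    have : t * y' = t * (x' * (x⁻¹ * y)) := by
      rw [neg_mul, neg_add_eq_zero] at h2
      rw [← h2]
      simp only [mul_assoc]
    exact mul_left_cancel₀ ht this
  subst ht
  exact ⟨by simpa using hs, rfl⟩

theorem linearIndependent_prod_pair_zero {y x' y' : K} (hy : y ≠ 0) (h : x' ≠ 0) :
    LinearIndependent K ![((0, y) : K × K), (x', y')] := by
  rw [LinearIndependent.pair_iff]
  intro s t hst
  simp only [Prod.smul_mk, smul_eq_mul, Prod.mk_add_mk, Prod.mk_eq_zero] at hst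
  obtain ⟨h1, h2⟩ := hst
  have ht : t = 0 := by simpa [h] using h1
  subst ht
  exact ⟨by simpa [hy] using h2, rfl⟩

variable {γ : K × K → Z} (hγ : LinePreserving K K' γ)
  (h : LinearIndependent K' ![γ (0, 0), γ (1, 0), γ (0, 1)])

include hγ

theorem LinePreserving.mem_prod {x₁ y₁ x₂ y₂ x y : K} (c : K) (hx : x = x₁ + c * (x₂ - x₁))
    (hy : y = y₁ + c * (y₂ - y₁)) :
    γ (x, y) ∈ Submodule.span K' {γ (x₁, y₁), γ (x₂, y₂)} := by
  convert hγ (x₁, y₁) (x₂, y₂) c using 2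
  ext <;> simp [hx, hy]

theorem LinePreserving.mem_vertical (x y : K) :
    γ (x, y) ∈ Submodule.span K' {γ (x, 0), γ (x, 1)} :=
  hγ.mem_prod y (by simp) (by simp)

theorem LinePreserving.mem_horizontal (x y : K) :
    γ (x, y) ∈ Submodule.span K' {γ (0, y), γ (1, y)} :=
  hγ.mem_prod x (by simp) (by simp)

include h

variable (hK : ∃ t : K, t ≠ 0 ∧ t ≠ 1)
include hK

theorem LinePreserving.linearIndependent_pair {p q : K × K} (hpq : p ≠ q) :
    LinearIndependent K' ![γ p, γ q] := by
  have hd : q - p ≠ 0 := sub_ne_zero.2 hpq.symm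
  obtain ⟨r, hr⟩ : ∃ r : K × K, LinearIndependent K ![q - p, r] := by
    by_cases h1 : (q - p).1 = 0
    · have h2 : (q - p).2 ≠ 0 := fun h2 => hd (Prod.ext h1 h2)
      refine ⟨(1, 0), ?_⟩
      rw [← Prod.mk.eta (p := q - p), h1]
      exact linearIndependent_prod_pair_zero h2 one_ne_zero
    · refine ⟨(0, 1), ?_⟩
      rw [← Prod.mk.eta (p := q - p)]
      exact linearIndependent_prod_pair h1 (by simp)
  have := hγ.linearIndependent_triple hK h (p := p) (q := q) (r := r + p) (by simpa using hr)
  exact (linearIndependent_triple_iff_notMem.1 this).1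

theorem LinePreserving.ne_zero (p : K × K) : γ p ≠ 0 := by
  obtain ⟨q, hq⟩ := exists_ne p
  exact (hγ.linearIndependent_pair h hK hq.symm).ne_zero 0

/-- A point off the axis `y = 0` has an image off the image of the axis, so it can be scaled into
the chart based at `γ (0, 1)`. This is the form that `exists_center_of_axis` takes. -/
theorem LinePreserving.exists_normalized {y : K} (hy : y ≠ 0) (x : K) :
    ∃ A, Submodule.span K' {A} = Submodule.span K' {γ (x, y)} ∧
      A - γ (0, 1) ∈ Submodule.span K' {γ (0, 0), γ (1, 0)} := by
  have h1 : γ (x, y) ∈ Submodule.span K' {γ (0, 0), γ (1, 0), γ (0, 1)} := by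
    have := hγ.mem_of_plane hK (N := Submodule.span K' {γ (0, 0), γ (1, 0), γ (0, 1)})
      (p := (0, 0)) (q := (1, 0)) (r := (0, 1)) (Submodule.subset_span (by simp))
      (Submodule.subset_span (by simp)) (Submodule.subset_span (by simp)) x y
    simpa using this
  obtain ⟨a, b, c, habc⟩ := Submodule.mem_span_triple.1 h1
  have hc : c ≠ 0 := by
    rintro rfl
    have h2 := hγ.linearIndependent_triple hK h (p := (0, 0)) (q := (1, 0)) (r := (x, y)) (by
      simp only [Prod.mk_sub_mk, sub_zero]
      exact linearIndependent_prod_pair one_ne_zero (by simpa using hy))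
    refine (linearIndependent_triple_iff_notMem.1 h2).2 (Submodule.mem_span_pair.2 ⟨a, b, ?_⟩)
    simpa using habc
  refine ⟨c⁻¹ • γ (x, y), span_smul_singleton (inv_ne_zero hc) _, ?_⟩
  refine Submodule.mem_span_pair.2 ⟨c⁻¹ * a, c⁻¹ * b, ?_⟩
  rw [← habc, smul_add, smul_add, smul_smul c⁻¹ c, inv_mul_cancel₀ hc, one_smul, mul_smul, mul_smul]
  abel

/-- The images of three parallel lines are concurrent, when there are at least four scalars. -/
theorem LinePreserving.exists_concurrent_three {k₀ k₁ : K} (h₀ : k₀ ≠ 0 ∧ k₀ ≠ 1)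
    (h₁ : k₁ ≠ 0 ∧ k₁ ≠ 1) (h₀₁ : k₀ ≠ k₁) {s : K} (hs1 : s ≠ 1) :
    ∃ O : Z, O ≠ 0 ∧ O ∈ Submodule.span K' {γ (0, 0), γ (0, 1)} ∧
      O ∈ Submodule.span K' {γ (1, 0), γ (1, 1)} ∧
      O ∈ Submodule.span K' {γ (s, 0), γ (s, 1)} := by
  obtain ⟨t, ht0, ht1⟩ := hK
  have hK : ∃ t : K, t ≠ 0 ∧ t ≠ 1 := ⟨t, ht0, ht1⟩
  -- The first triangle is `(0, 1)`, `(1, k)`, `(s, k')`; the second is obtained by multiplying the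
  -- ordinates by `t` on the right. Corresponding sides meet on the axis `y = 0`, and corresponding
  -- vertices lie on the three vertical lines, so the centre of perspectivity is the required point.
  obtain ⟨k, k', hk0, hk1, hk'0, hk'1, hkk', hk⟩ := exists_avoiding_pair h₀ h₁ h₀₁ hs1
  obtain ⟨A₁, hA₁, hA₁'⟩ := hγ.exists_normalized h hK one_ne_zero 0
  obtain ⟨B₁, hB₁, hB₁'⟩ := hγ.exists_normalized h hK hk0 1
  obtain ⟨C₁, hC₁, hC₁'⟩ := hγ.exists_normalized h hK hk'0 s
  obtain ⟨A₂, hA₂, hA₂'⟩ := hγ.exists_normalized h hK ht0 0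
  obtain ⟨B₂, hB₂, hB₂'⟩ := hγ.exists_normalized h hK (mul_ne_zero hk0 ht0) 1
  obtain ⟨C₂, hC₂, hC₂'⟩ := hγ.exists_normalized h hK (mul_ne_zero hk'0 ht0) s
  have axis : ∀ x, γ (x, 0) ∈ Submodule.span K' {γ (0, 0), γ (1, 0)} := fun x =>
    hγ.mem_horizontal x 0
  have side : ∀ {x₁ y₁ x₂ y₂ c : K}, y₁ + c * (y₂ - y₁) = 0 →
      γ (x₁ + c * (x₂ - x₁), 0) ∈ Submodule.span K' {γ (x₁, y₁), γ (x₂, y₂)} ∧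
      γ (x₁ + c * (x₂ - x₁), 0) ∈ Submodule.span K' {γ (x₁, y₁ * t), γ (x₂, y₂ * t)} := by
    intro x₁ y₁ x₂ y₂ c hc
    refine ⟨hγ.mem_prod c rfl hc.symm, hγ.mem_prod c rfl ?_⟩
    rw [← sub_mul, ← mul_assoc, ← add_mul, hc, zero_mul]
  have solve : ∀ {y₁ y₂ : K}, y₁ ≠ y₂ → y₁ + (-(y₁ * (y₂ - y₁)⁻¹)) * (y₂ - y₁) = 0 := by
    intro y₁ y₂ hy
    rw [neg_mul, mul_assoc, inv_mul_cancel₀ (sub_ne_zero.2 hy.symm), mul_one, add_neg_cancel]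
  have hP := side (x₁ := 0) (x₂ := 1) (solve hk1.symm)
  have hQ := side (x₁ := 1) (x₂ := s) (solve hkk')
  have hR := side (x₁ := 0) (x₂ := s) (solve hk'1.symm)
  rw [one_mul t, ← span_pair_congr hA₁ hB₁, ← span_pair_congr hA₂ hB₂] at hP
  rw [← span_pair_congr hB₁ hC₁, ← span_pair_congr hB₂ hC₂] at hQ
  rw [one_mul t, ← span_pair_congr hA₁ hC₁, ← span_pair_congr hA₂ hC₂] at hR
  have hABC := (hγ.linearIndependent_triple hK h (p := (0, 1)) (q := (1, k)) (r := (s, k')) (by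
      simp only [Prod.mk_sub_mk, sub_zero]
      exact linearIndependent_prod_pair one_ne_zero (by simpa using hk))).triple_congr
      hA₁.symm hB₁.symm hC₁.symm
  obtain ⟨ρ, hρ1, hρ2⟩ := exists_center_of_axis (linearIndependent_triple_iff_notMem.1 h).2
    hA₁' hB₁' hC₁' hA₂' hB₂' hC₂' (axis _) (axis _) (axis _)
    (hγ.ne_zero h hK _) (hγ.ne_zero h hK _) (hγ.ne_zero h hK _) hABC hP.1 hP.2 hQ.1 hQ.2 hR.1 hR.2
  have line : ∀ {x y₁ y₂ : K} {A A' : Z}, Submodule.span K' {A} = Submodule.span K' {γ (x, y₁)} →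
      Submodule.span K' {A'} = Submodule.span K' {γ (x, y₂)} →
      A' - ρ • A ∈ Submodule.span K' {γ (x, 0), γ (x, 1)} := by
    intro x y₁ y₂ A A' hA hA'
    have key : ∀ {A y}, Submodule.span K' {A} = Submodule.span K' {γ (x, y)} →
        A ∈ Submodule.span K' {γ (x, 0), γ (x, 1)} := fun {A y} hA => by
      obtain ⟨c, -, rfl⟩ := span_singleton_eq_iff.1 hA
      exact Submodule.smul_mem _ _ (hγ.mem_vertical x y)
    exact Submodule.sub_mem _ (key hA') (Submodule.smul_mem _ _ (key hA))
  refine ⟨A₂ - ρ • A₁, ?_, line hA₁ hA₂, hρ1 ▸ line hB₁ hB₂, hρ2 ▸ line hC₁ hC₂⟩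
  -- A zero centre would make `A₁` and `A₂` proportional, while they represent the images of the
  -- distinct points `(0, 1)` and `(0, t)`.
  intro h0
  have hAA := (hγ.linearIndependent_pair h hK (p := (0, 1)) (q := (0, t))
    (by simpa using ht1.symm)).pair_congr hA₁.symm hA₂.symm
  refine (linearIndependent_pair_iff_notMem.1 hAA).2 (Submodule.mem_span_singleton.2 ⟨ρ, ?_⟩)
  rw [sub_eq_zero.1 h0]

/-- The images of the lines `x = 0` and `x = 1` are different, so they have only one common point,
and it is the same for every third line. -/
theorem LinePreserving.exists_concurrent_of_three
    (H : ∀ s : K, s ≠ 1 → ∃ O : Z, O ≠ 0 ∧ O ∈ Submodule.span K' {γ (0, 0), γ (0, 1)} ∧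
      O ∈ Submodule.span K' {γ (1, 0), γ (1, 1)} ∧
      O ∈ Submodule.span K' {γ (s, 0), γ (s, 1)}) :
    ∃ O : Z, O ≠ 0 ∧ ∀ s, O ∈ Submodule.span K' {γ (s, 0), γ (s, 1)} := by
  obtain ⟨t, ht0, ht1⟩ := hK
  obtain ⟨O, hO, hO0, hO1, -⟩ := H t ht1
  refine ⟨O, hO, fun s => ?_⟩
  by_cases hs1 : s = 1
  · rwa [hs1]
  obtain ⟨O', hO', hO'0, hO'1, hO's⟩ := H s hs1
  suffices hmem : O ∈ Submodule.span K' {O'} from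
    Submodule.span_le.2 (Set.singleton_subset_iff.2 hO's) hmem
  by_contra hne
  have hi := linearIndependent_pair_iff_notMem.2 ⟨hO', hne⟩
  have e0 := span_pair_eq_of_linearIndependent hi hO'0 hO0
  have e1 := span_pair_eq_of_linearIndependent hi hO'1 hO1
  have hind := hγ.linearIndependent_triple ⟨t, ht0, ht1⟩ h (p := (0, 0)) (q := (0, 1))
    (r := (1, 0)) (by
      simp only [Prod.mk_sub_mk, sub_zero]
      exact linearIndependent_prod_pair_zero one_ne_zero one_ne_zero)
  refine (linearIndependent_triple_iff_notMem.1 hind).2 ?_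
  rw [← e0, e1]
  exact Submodule.subset_span (by simp)

-- With three scalars there is no room for the two triangles, so the nine points are written in
-- coordinates normalized by `γ (1, 1) = a + b + c`. The incidences leave one parameter with `β² - β
-- + 1 = 0`. Only in characteristic 3 does this force `β = -1`; over ℂ its roots correspond to the
-- Hesse configuration, an embedding of the affine plane of order 3 that is not linear.
omit hK in
theorem LinePreserving.exists_concurrent_of_three_elements (h2 : (1 : K) + 1 ≠ 0)
    (h3K : (1 : K) + 1 + 1 = 0)
    (h3 : (1 : K') + 1 + 1 = 0) (hall : ∀ x : K, x = 0 ∨ x = 1 ∨ x = -1) (s : K) (hs : s ≠ 1) :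
    ∃ O : Z, O ≠ 0 ∧ O ∈ Submodule.span K' {γ (0, 0), γ (0, 1)} ∧
      O ∈ Submodule.span K' {γ (1, 0), γ (1, 1)} ∧
      O ∈ Submodule.span K' {γ (s, 0), γ (s, 1)} := by
  have hn1 : (-1 : K) ≠ 1 := fun e => h2 (by nth_rw 1 [← e]; exact neg_add_cancel 1)
  have hK : ∃ t : K, t ≠ 0 ∧ t ≠ 1 := ⟨-1, by simp, hn1⟩
  have h11 : (1 : K) + 1 = -1 := eq_neg_of_add_eq_zero_left h3K
  have hn11 : (-1 : K) + -1 = 1 := by rw [← neg_add, h11, neg_neg]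
  have hγ11 : γ (1, 1) ∈ Submodule.span K' {γ (0, 0), γ (1, 0), γ (0, 1)} := by
    have := hγ.mem_of_plane hK (N := Submodule.span K' {γ (0, 0), γ (1, 0), γ (0, 1)})
      (p := (0, 0)) (q := (1, 0)) (r := (0, 1)) (Submodule.subset_span (by simp))
      (Submodule.subset_span (by simp)) (Submodule.subset_span (by simp)) 1 1
    simpa using this
  obtain ⟨p, q, r, hpqr⟩ := Submodule.mem_span_triple.1 hγ11
  have hr : r ≠ 0 := by
    rintro rfl
    have h2 := hγ.linearIndependent_triple hK h (p := (0, 0)) (q := (1, 0)) (r := (1, 1)) (by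
      simp only [Prod.mk_sub_mk, sub_zero]
      exact linearIndependent_prod_pair one_ne_zero (by simp))
    refine (linearIndependent_triple_iff_notMem.1 h2).2 (Submodule.mem_span_pair.2 ⟨p, q, ?_⟩)
    simpa using hpqr
  have hq : q ≠ 0 := by
    rintro rfl
    have h2 := hγ.linearIndependent_triple hK h (p := (0, 0)) (q := (0, 1)) (r := (1, 1)) (by
      simp only [Prod.mk_sub_mk, sub_zero]
      exact linearIndependent_prod_pair_zero one_ne_zero one_ne_zero)
    refine (linearIndependent_triple_iff_notMem.1 h2).2 (Submodule.mem_span_pair.2 ⟨p, r, ?_⟩)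
    simpa using hpqr
  have hp : p ≠ 0 := by
    rintro rfl
    have h2 := hγ.linearIndependent_triple hK h (p := (1, 0)) (q := (0, 1)) (r := (1, 1)) (by
      simp only [Prod.mk_sub_mk, sub_zero, zero_sub, sub_self]
      exact linearIndependent_prod_pair (by simp) (by simp))
    refine (linearIndependent_triple_iff_notMem.1 h2).2 (Submodule.mem_span_pair.2 ⟨q, r, ?_⟩)
    simpa using hpqr
  obtain ⟨a, ha⟩ : ∃ a, a = p • γ (0, 0) := ⟨_, rfl⟩
  obtain ⟨b, hb⟩ : ∃ b, b = q • γ (1, 0) := ⟨_, rfl⟩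
  obtain ⟨c, hc⟩ : ∃ c, c = r • γ (0, 1) := ⟨_, rfl⟩
  rw [← ha, ← hb, ← hc] at hpqr
  have sa : Submodule.span K' {γ (0, 0)} = Submodule.span K' {a} := by
    rw [ha, span_smul_singleton hp]
  have sb : Submodule.span K' {γ (1, 0)} = Submodule.span K' {b} := by
    rw [hb, span_smul_singleton hq]
  have sc : Submodule.span K' {γ (0, 1)} = Submodule.span K' {c} := by
    rw [hc, span_smul_singleton hr]
  have hi : LinearIndependent K' ![a, b, c] := h.triple_congr sa sb sc
  -- the point `(-1, 0)`
  have m1 : γ (-1, 0) ∈ Submodule.span K' {a, b} := by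
    rw [← span_pair_congr sa sb]
    exact hγ.mem_prod (-1) (by simp) (by simp)
  obtain ⟨x₁, x₂, hx⟩ := Submodule.mem_span_pair.1 m1
  have hx₁ : x₁ ≠ 0 := by
    rintro rfl
    have := hγ.linearIndependent_pair h hK (p := (1, 0)) (q := (-1, 0)) (by simpa using hn1.symm)
    refine (linearIndependent_pair_iff_notMem.1 this).2 ?_
    rw [sb]
    exact Submodule.mem_span_singleton.2 ⟨x₂, by simpa using hx⟩
  -- the point `(0, -1)`
  have m2 : γ (0, -1) ∈ Submodule.span K' {a, c} := by
    rw [← span_pair_congr sa sc]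
    exact hγ.mem_prod (-1) (by simp) (by simp)
  obtain ⟨y₁, y₂, hy⟩ := Submodule.mem_span_pair.1 m2
  have hy₁ : y₁ ≠ 0 := by
    rintro rfl
    have := hγ.linearIndependent_pair h hK (p := (0, 1)) (q := (0, -1)) (by simpa using hn1.symm)
    refine (linearIndependent_pair_iff_notMem.1 this).2 ?_
    rw [sc]
    exact Submodule.mem_span_singleton.2 ⟨y₂, by simpa using hy⟩
  obtain ⟨β, hβ⟩ : ∃ β, β = x₁⁻¹ * x₂ := ⟨_, rfl⟩
  obtain ⟨δ, hδ⟩ : ∃ δ, δ = y₁⁻¹ * y₂ := ⟨_, rfl⟩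
  have sx : Submodule.span K' {γ (-1, 0)} = Submodule.span K' {a + β • b} := by
    refine span_singleton_eq_iff.2 ⟨x₁, hx₁, ?_⟩
    rw [← hx, smul_add, smul_smul, hβ, mul_inv_cancel_left₀ hx₁]
  have sy : Submodule.span K' {γ (0, -1)} = Submodule.span K' {a + δ • c} := by
    refine span_singleton_eq_iff.2 ⟨y₁, hy₁, ?_⟩
    rw [← hy, smul_add, smul_smul, hδ, mul_inv_cancel_left₀ hy₁]
  -- the point `(-1, -1)`
  have sz : Submodule.span K' {γ (-1, -1)} = Submodule.span K' {b + c} := by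
    have n1 : γ (-1, -1) ∈ Submodule.span K' {a, a + b + c} := by
      rw [hpqr, ← span_pair_congr sa rfl]
      exact hγ.mem_prod (-1) (by simp) (by simp)
    have n2 : γ (-1, -1) ∈ Submodule.span K' {b, c} := by
      rw [← span_pair_congr sb sc]
      exact hγ.mem_prod (-1) (by simp [h11]) (by simp)
    obtain ⟨u, v, huv⟩ := Submodule.mem_span_pair.1 n1
    obtain ⟨u', v', huv'⟩ := Submodule.mem_span_pair.1 n2
    have e : (u + v) • a + v • b + v • c = (0 : K') • a + u' • b + v' • c := by
      rw [zero_smul, zero_add, huv', ← huv, add_smul, smul_add, smul_add]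
      abel
    obtain ⟨-, e2, e3⟩ := hi.eq_of_triple e
    refine span_singleton_eq_of_mem (hγ.ne_zero h hK _) (Submodule.mem_span_singleton.2 ⟨v, ?_⟩)
    rw [← huv', ← e2, ← e3, smul_add]
  -- collinearity of `(1, 1)`, `(-1, 0)`, `(0, -1)`
  have n1 : a + b + c ∈ Submodule.span K' {a + β • b, a + δ • c} := by
    rw [hpqr, ← span_pair_congr sx sy]
    exact hγ.mem_prod (-1) (by simp [hn11]) (by simp)
  obtain ⟨s₁, t₁, hst⟩ := Submodule.mem_span_pair.1 n1
  have e : (s₁ + t₁) • a + (s₁ * β) • b + (t₁ * δ) • c = (1 : K') • a + (1 : K') • b + (1 : K') • c := by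
    rw [one_smul, one_smul, one_smul, ← hst, add_smul, smul_add, smul_add, mul_smul, mul_smul]
    abel
  obtain ⟨e1, e2, e3⟩ := hi.eq_of_triple e
  -- the three lines through `(-1, 1)`
  have k1 : γ (-1, 1) ∈ Submodule.span K' {c, a + b + c} := by
    rw [hpqr, ← span_pair_congr sc rfl]
    exact hγ.mem_prod (-1) (by simp) (by simp)
  have k2 : γ (-1, 1) ∈ Submodule.span K' {b, a + δ • c} := by
    rw [← span_pair_congr sb sy]
    exact hγ.mem_prod (-1) (by simp [h11]) (by simp)
  have k3 : γ (-1, 1) ∈ Submodule.span K' {a + β • b, b + c} := by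
    rw [← span_pair_congr sx sz]
    exact hγ.mem_prod (-1) (by simp) (by simp)
  obtain ⟨x, y, hxy⟩ := Submodule.mem_span_pair.1 k1
  obtain ⟨z, w, hzw⟩ := Submodule.mem_span_pair.1 k2
  obtain ⟨u, v, huv⟩ := Submodule.mem_span_pair.1 k3
  have f1 : y • a + y • b + (x + y) • c = w • a + z • b + (w * δ) • c := by
    have : y • a + y • b + (x + y) • c = γ (-1, 1) := by
      rw [← hxy, add_smul, smul_add, smul_add]; abel
    rw [this, ← hzw, smul_add, mul_smul]; abel
  have f2 : w • a + z • b + (w * δ) • c = u • a + (u * β + v) • b + v • c := by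
    have : w • a + z • b + (w * δ) • c = γ (-1, 1) := by
      rw [← hzw, smul_add, mul_smul]; abel
    rw [this, ← huv, smul_add, smul_add, add_smul, mul_smul]; abel
  obtain ⟨g1, g2, -⟩ := hi.eq_of_triple f1
  obtain ⟨g3, g4, g5⟩ := hi.eq_of_triple f2
  have hw : w ≠ 0 := by
    rintro rfl
    apply hγ.ne_zero h hK (-1, 1)
    rw [← hzw, ← g2, g1, zero_smul, zero_smul, add_zero]
  -- This expresses that the three lines through `(-1, 1)` have concurrent images.
  have hβδ : β + δ = 1 := by
    apply mul_left_cancel₀ hw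
    rw [mul_add, g5, mul_one]
    conv_lhs => rw [g3]
    rw [← g4, ← g2, g1]
  have hβ0 : β ≠ 0 := by rintro rfl; simp at e2
  have hδ0 : δ ≠ 0 := by rintro rfl; simp at e3
  -- The collinearity of `(1, 1)`, `(-1, 0)`, `(0, -1)` reads `β⁻¹ + δ⁻¹ = 1`, and the left side
  -- equals `β⁻¹ (β + δ) δ⁻¹`, even without commutativity.
  have hβ1 : δ * β = 1 := by
    have h1 : s₁ = β⁻¹ := eq_inv_of_mul_eq_one_left e2
    have h2 : t₁ = δ⁻¹ := eq_inv_of_mul_eq_one_left e3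
    rw [h1, h2, inv_add_inv' hβ0 hδ0, hβδ, mul_one, ← mul_inv_rev] at e1
    exact inv_eq_one.1 e1
  have hβn : β = -1 := by
    have hδ' : δ = 1 - β := eq_sub_of_add_eq' hβδ
    have : (β + 1) * (β + 1) = 0 := by
      have h4 : (β + 1) * (β + 1) = 1 - (1 - β) * β + (1 + 1 + 1) * β := by noncomm_ring
      rw [h4, ← hδ', hβ1, h3, sub_self, zero_mul, add_zero]
    exact eq_neg_of_add_eq_zero_left (mul_self_eq_zero.1 this)
  have O0 : a + c ∈ Submodule.span K' {γ (0, 0), γ (0, 1)} := by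
    rw [span_pair_congr sa sc]
    exact Submodule.mem_span_pair.2 ⟨1, 1, by simp⟩
  -- Since `β = -1`, the point `a + c` equals `(a + b + c) - b` and `(a + β b) + (b + c)`, which
  -- puts it on the images of the three vertical lines.
  refine ⟨a + c, fun h0 => ?_, O0, ?_, ?_⟩
  · have := linearIndependent_triple_iff.1 hi 1 0 1 (by simpa using h0)
    exact one_ne_zero this.1
  · rw [span_pair_congr sb rfl, ← hpqr]
    exact Submodule.mem_span_pair.2 ⟨-1, 1, by simp; abel⟩
  · rcases hall s with rfl | rfl | rfl
    · exact O0
    · exact absurd rfl hs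
    · have l1 : a + β • b ∈ Submodule.span K' {γ (-1, 0), γ (-1, 1)} := by
        have : a + β • b ∈ Submodule.span K' {γ (-1, 0)} :=
          sx ▸ Submodule.mem_span_singleton_self _
        exact Submodule.span_mono (by simp) this
      have l2 : b + c ∈ Submodule.span K' {γ (-1, 0), γ (-1, 1)} := by
        have : b + c ∈ Submodule.span K' {γ (-1, -1)} :=
          sz ▸ Submodule.mem_span_singleton_self _
        exact Submodule.span_le.2 (Set.singleton_subset_iff.2 (hγ.mem_vertical _ _)) this
      convert Submodule.add_mem _ l1 l2 using 1
      rw [hβn, neg_smul, one_smul]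
      abel

end Concurrency

/-- The scalars have enough elements for affine planes to embed only linearly. -/
def EnoughScalars (K K' : Type*) [DivisionRing K] [DivisionRing K'] : Prop :=
  (∃ k₀ k₁ : K, k₀ ≠ 0 ∧ k₀ ≠ 1 ∧ k₁ ≠ 0 ∧ k₁ ≠ 1 ∧ k₀ ≠ k₁) ∨
  ((1 : K) + 1 ≠ 0 ∧ (1 : K) + 1 + 1 = 0 ∧ (1 : K') + 1 + 1 = 0 ∧
    ∀ x : K, x = 0 ∨ x = 1 ∨ x = -1)

theorem EnoughScalars.exists_ne {K K' : Type*} [DivisionRing K] [DivisionRing K']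
    (h : EnoughScalars K K') : ∃ t : K, t ≠ 0 ∧ t ≠ 1 := by
  rcases h with ⟨k, _, h0, h1, -⟩ | ⟨h2, -⟩
  · exact ⟨k, h0, h1⟩
  · exact ⟨-1, by simp, fun e => h2 (by nth_rw 1 [← e]; exact neg_add_cancel 1)⟩

theorem enoughScalars_of_card {K K' : Type*} [DivisionRing K] [DivisionRing K']
    (h : 4 ≤ Cardinal.mk K ∨ (Cardinal.mk K = 3 ∧ ringChar K' = 3)) : EnoughScalars K K' := by
  classical
  rcases h with h | ⟨h, h'⟩
  · left
    have key : ∀ s : Finset K, s.card ≤ 3 → ∃ x, x ∉ s := by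
      intro s hs
      by_contra! hall
      let _ : Fintype K := ⟨s, hall⟩
      have : Cardinal.mk K ≤ 3 := by
        rw [Cardinal.mk_fintype]
        exact_mod_cast hs
      have := h.trans this
      norm_cast at this
    obtain ⟨k₀, h₀⟩ := key {0, 1} (Finset.card_le_two.trans (by norm_num))
    obtain ⟨k₁, h₁⟩ := key {0, 1, k₀} Finset.card_le_three
    simp only [Finset.mem_insert, Finset.mem_singleton, not_or] at h₀ h₁
    exact ⟨k₀, k₁, h₀.1, h₀.2, h₁.1, h₁.2.1, fun e => h₁.2.2 e.symm⟩
  · right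
    have hfin : Finite K := by
      rw [← Cardinal.lt_aleph0_iff_finite, h]
      exact_mod_cast Cardinal.natCast_lt_aleph0 (n := 3)
    have : Fintype K := Fintype.ofFinite K
    have hcard : Fintype.card K = 3 := by
      rw [Cardinal.mk_fintype] at h
      exact_mod_cast h
    have h3K : (1 : K) + 1 + 1 = 0 := by
      have := Nat.cast_card_eq_zero K
      rw [hcard] at this
      push_cast at this
      rw [← this]; norm_num
    have h2 : (1 : K) + 1 ≠ 0 := by
      intro h2
      rw [h2, zero_add] at h3K
      exact one_ne_zero h3K
    have hn1 : (1 : K) ≠ -1 := fun e => h2 (by nth_rw 2 [e]; exact add_neg_cancel 1)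
    refine ⟨h2, h3K, ?_, ?_⟩
    · have := ringChar.Nat.cast_ringChar (R := K')
      rw [h'] at this
      push_cast at this
      rw [← this]; norm_num
    · intro x
      have hs : ({0, 1, -1} : Finset K) = Finset.univ := by
        rw [← Finset.card_eq_iff_eq_univ, hcard]
        exact Finset.card_eq_three.2 ⟨0, 1, -1, zero_ne_one, by simp, hn1, rfl⟩
      have := hs ▸ Finset.mem_univ x
      simpa using this

section Concurrency

variable {K K' Z : Type*} [DivisionRing K] [DivisionRing K'] [AddCommGroup Z] [Module K' Z]

/-- The images of parallel lines are concurrent. -/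
theorem LinePreserving.exists_concurrent (hK : EnoughScalars K K') {γ : K × K → Z}
    (hγ : LinePreserving K K' γ)
    (h : LinearIndependent K' ![γ (0, 0), γ (1, 0), γ (0, 1)]) :
    ∃ O : Z, O ≠ 0 ∧ ∀ s, O ∈ Submodule.span K' {γ (s, 0), γ (s, 1)} := by
  refine hγ.exists_concurrent_of_three h hK.exists_ne ?_
  rcases id hK with ⟨k₀, k₁, h0, h1, h2, h3, h4⟩ | ⟨h1, h2, h3, h4⟩
  · exact fun s hs => hγ.exists_concurrent_three h hK.exists_ne ⟨h0, h1⟩ ⟨h2, h3⟩ h4 hs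
  · exact hγ.exists_concurrent_of_three_elements h h1 h2 h3 h4

end Concurrency

/-! ### Affine planes: coordinates and the ring homomorphism -/

section PlaneLift

variable {K K' Z : Type*} [DivisionRing K] [DivisionRing K'] [AddCommGroup Z] [Module K' Z]

/-- If the centre were the image of `p`, a vertical line not through `p` would form with `p` a
triangle with collinear image. -/
theorem notMem_span_of_concurrent (hK : ∃ t : K, t ≠ 0 ∧ t ≠ 1) {γ : K × K → Z}
    (hγ : LinePreserving K K' γ)
    (h : LinearIndependent K' ![γ (0, 0), γ (1, 0), γ (0, 1)]) {O : Z} (hO : O ≠ 0)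
    (hs : ∀ s, O ∈ Submodule.span K' {γ (s, 0), γ (s, 1)}) (p : K × K) :
    O ∉ Submodule.span K' {γ p} := by
  intro hp
  obtain ⟨x, hx⟩ := exists_ne p.1
  have := hγ.linearIndependent_triple hK h (p := (x, 0)) (q := (x, 1)) (r := p) (by
    rw [← Prod.mk.eta (p := p)]
    simp only [Prod.mk_sub_mk, sub_zero, sub_self]
    exact linearIndependent_prod_pair_zero one_ne_zero (sub_ne_zero.2 hx.symm))
  refine (linearIndependent_triple_iff_notMem.1 this).2 ?_
  have h1 := span_singleton_eq_of_mem hO hp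
  exact Submodule.span_le.2 (Set.singleton_subset_iff.2 (hs x))
    (h1 ▸ Submodule.mem_span_singleton_self (γ p))

theorem exists_span_eq_add_smul {e O u : Z} (hu : u ∈ Submodule.span K' {e, O}) (hu0 : u ≠ 0)
    (hO : O ∉ Submodule.span K' {u}) :
    ∃ a : K', Submodule.span K' {u} = Submodule.span K' {e + a • O} := by
  obtain ⟨x, y, rfl⟩ := Submodule.mem_span_pair.1 hu
  have hx : x ≠ 0 := by
    rintro rfl
    rw [zero_smul, zero_add] at hO hu0
    have hy : y ≠ 0 := by rintro rfl; simp at hu0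
    refine hO ?_
    rw [span_smul_singleton hy]
    exact Submodule.mem_span_singleton_self _
  refine ⟨x⁻¹ * y, span_singleton_eq_iff.2 ⟨x, hx, ?_⟩⟩
  rw [smul_add, smul_smul, mul_inv_cancel_left₀ hx]

/-- The centres `d₁`, `d₂` of the horizontal and vertical lines act as points at infinity, and `γ
(x, y)` is the intersection of the join of `γ (x, 0)` with `d₂` and the join of `γ (0, y)` with
`d₁`. -/
theorem LinePreserving.exists_grid (hK : EnoughScalars K K') {γ : K × K → Z}
    (hγ : LinePreserving K K' γ)
    (h : LinearIndependent K' ![γ (0, 0), γ (1, 0), γ (0, 1)]) :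
    ∃ (e d₁ d₂ : Z) (a b : K → K'), LinearIndependent K' ![e, d₁, d₂] ∧
      a 0 = 0 ∧ a 1 = 1 ∧ b 0 = 0 ∧ b 1 = 1 ∧
      ∀ x y, Submodule.span K' {γ (x, y)} = Submodule.span K' {e + a x • d₁ + b y • d₂} := by
  have side : ∀ {γ : K × K → Z}, LinePreserving K K' γ →
      LinearIndependent K' ![γ (0, 0), γ (1, 0), γ (0, 1)] → ∃ (O : Z) (b : K → K'), O ≠ 0 ∧
      (∀ x y, γ (x, y) ∈ Submodule.span K' {γ (x, 0), O}) ∧ b 0 = 0 ∧ b 1 = 1 ∧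
      ∀ y, Submodule.span K' {γ (0, y)} = Submodule.span K' {γ (0, 0) + b y • O} := by
    intro γ hγ h
    obtain ⟨O, hO, hs⟩ := hγ.exists_concurrent hK h
    have hn := notMem_span_of_concurrent hK.exists_ne hγ h hO hs
    have hmem : ∀ x y, γ (x, y) ∈ Submodule.span K' {γ (x, 0), O} := by
      intro x y
      have h1 := mem_span_pair_exchange (hs x) (hn _)
      refine Submodule.span_le.2 ?_ (hγ.mem_vertical x y)
      rintro _ (rfl | rfl)
      · exact Submodule.subset_span (by simp)
      · exact h1
    choose b hb using fun y => exists_span_eq_add_smul (hmem 0 y)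
      (hγ.ne_zero h hK.exists_ne _) (hn _)
    have hi : LinearIndependent K' ![γ (0, 0), O] :=
      linearIndependent_pair_iff_notMem.2 ⟨hγ.ne_zero h hK.exists_ne _, hn _⟩
    have hb0 : b 0 = 0 := by
      obtain ⟨c, -, hc⟩ := span_singleton_eq_iff.1 (hb 0).symm
      have e : (1 : K') • γ (0, 0) + b 0 • O = c • γ (0, 0) + (0 : K') • O := by
        rw [one_smul, hc, zero_smul, add_zero]
      exact (hi.eq_of_pair e).2
    have hb1 : b 1 ≠ 0 := by
      intro hb1
      have h1 := hb 1
      rw [hb1, zero_smul, add_zero] at h1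
      refine (linearIndependent_pair_iff_notMem.1
        (hγ.linearIndependent_pair h hK.exists_ne (p := (0, 0)) (q := (0, 1)) (by simp))).2 ?_
      rw [← h1]
      exact Submodule.mem_span_singleton_self _
    -- The centre is rescaled so that the coordinate function takes the value 1 at 1.
    refine ⟨b 1 • O, fun y => b y * (b 1)⁻¹, smul_ne_zero hb1 hO, fun x y => ?_,
      by simp [hb0], mul_inv_cancel₀ hb1, fun y => ?_⟩
    · rw [span_pair_congr rfl (span_smul_singleton hb1 O)]
      exact hmem x y
    · rw [hb, smul_smul, mul_assoc, inv_mul_cancel₀ hb1, mul_one]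
  obtain ⟨d₂, b, hd₂, hv, hb0, hb1, hb⟩ := side hγ h
  obtain ⟨d₁, a, hd₁, hh, ha0, ha1, ha⟩ := side (γ := γ ∘ Prod.swap)
    (hγ.comp_affine Prod.swap fun p q c => by ext <;> simp)
    (h.triple_perm (by simp [Set.pair_comm]))
  simp only [Function.comp, Prod.swap_prod_mk] at hh ha
  have hi : LinearIndependent K' ![γ (0, 0), d₁, d₂] := by
    refine h.triple_of_mem_span (Submodule.subset_span (by simp)) ?_ ?_
    · exact Submodule.span_mono (by simp [Set.insert_subset_iff]) (hh 0 1)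
    · exact Submodule.span_mono (by simp [Set.insert_subset_iff]) (hv 0 1)
  refine ⟨γ (0, 0), d₁, d₂, a, b, hi, ha0, ha1, hb0, hb1, fun x y => ?_⟩
  have m1 := hv x y
  have m2 := hh y x
  rw [span_pair_congr (ha x) rfl] at m1
  rw [span_pair_congr (hb y) rfl] at m2
  obtain ⟨u, v, huv⟩ := Submodule.mem_span_pair.1 m1
  obtain ⟨u', v', huv'⟩ := Submodule.mem_span_pair.1 m2
  have e : u • γ (0, 0) + (u * a x) • d₁ + v • d₂ =
      u' • γ (0, 0) + v' • d₁ + (u' * b y) • d₂ := by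
    have : u • γ (0, 0) + (u * a x) • d₁ + v • d₂ = γ (x, y) := by
      rw [← huv, smul_add, mul_smul]
    rw [this, ← huv', smul_add, mul_smul]
    abel
  obtain ⟨e1, e2, e3⟩ := hi.eq_of_triple e
  refine span_singleton_eq_of_mem (hγ.ne_zero h hK.exists_ne _)
    (Submodule.mem_span_singleton.2 ⟨u, ?_⟩)
  rw [← huv, e3, e1]
  simp only [smul_add, smul_smul]

/-- An embedding of an affine plane in a projective space is induced by a semilinear map. -/
theorem LinePreserving.exists_plane_lift (hK : EnoughScalars K K') {γ : K × K → Z}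
    (hγ : LinePreserving K K' γ)
    (h : LinearIndependent K' ![γ (0, 0), γ (1, 0), γ (0, 1)]) :
    ∃ (σ : K →+* K') (e d₁ d₂ : Z), LinearIndependent K' ![e, d₁, d₂] ∧
      ∀ x y, Submodule.span K' {γ (x, y)} = Submodule.span K' {e + σ x • d₁ + σ y • d₂} := by
  obtain ⟨t, ht0, ht1⟩ := hK.exists_ne
  have hK3 := hK.exists_ne
  obtain ⟨e, d₁, d₂, a, b, hi, ha0, ha1, hb0, hb1, hab⟩ := hγ.exists_grid hK h
  -- The point `(x, x)` lies on the line through `(0, 0)` and `(1, 1)`.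
  have hba : ∀ x, b x = a x := by
    intro x
    have h1 : γ (x, x) ∈ Submodule.span K' {γ (0, 0), γ (1, 1)} :=
      hγ.mem_prod x (by simp) (by simp)
    rw [span_pair_congr (hab 0 0) (hab 1 1)] at h1
    have h2 := Submodule.span_le.2 (Set.singleton_subset_iff.2 h1)
    rw [hab] at h2
    obtain ⟨u, v, huv⟩ := Submodule.mem_span_pair.1 (h2 (Submodule.mem_span_singleton_self _))
    rw [ha0, hb0, ha1, hb1] at huv
    have E : (u + v) • e + v • d₁ + v • d₂ = (1 : K') • e + a x • d₁ + b x • d₂ := by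
      rw [one_smul, ← huv]
      simp only [zero_smul, add_zero, one_smul, smul_add, add_smul]
      abel
    obtain ⟨-, e2, e3⟩ := hi.eq_of_triple E
    rw [← e2, ← e3]
  obtain rfl : b = a := funext hba
  -- The point `(x, x * m)` lies on the line through `(0, 0)` and `(1, m)`.
  have hmul : ∀ x m, b (x * m) = b x * b m := by
    intro x m
    have h1 : γ (x, x * m) ∈ Submodule.span K' {γ (0, 0), γ (1, m)} :=
      hγ.mem_prod x (by simp) (by simp)
    rw [span_pair_congr (hab 0 0) (hab 1 m)] at h1
    have h2 := Submodule.span_le.2 (Set.singleton_subset_iff.2 h1)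
    rw [hab] at h2
    obtain ⟨u, v, huv⟩ := Submodule.mem_span_pair.1 (h2 (Submodule.mem_span_singleton_self _))
    rw [hb0, hb1] at huv
    have E : (u + v) • e + v • d₁ + (v * b m) • d₂ =
        (1 : K') • e + b x • d₁ + b (x * m) • d₂ := by
      rw [one_smul, ← huv]
      simp only [zero_smul, add_zero, one_smul, smul_add, add_smul, mul_smul]
      abel
    obtain ⟨-, e2, e3⟩ := hi.eq_of_triple E
    rw [← e2, ← e3]
  have hinj : ∀ x, b x = 1 → x = 1 := by
    intro x hx
    by_contra hne
    have h1 := hγ.linearIndependent_pair h hK3 (p := (x, 0)) (q := (1, 0)) (by simpa using hne)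
    refine (linearIndependent_pair_iff_notMem.1 h1).2 ?_
    rw [hab x, hx, ← hb1, ← hab]
    exact Submodule.mem_span_singleton_self _
  -- Concurrency for the lines in the direction `(1, 1)`, obtained by shearing them into vertical
  -- lines.
  obtain ⟨D, hD, hDs⟩ : ∃ O : Z, O ≠ 0 ∧ ∀ s, O ∈ Submodule.span K' {γ (s, 0), γ (s + 1, 1)} := by
    have hg : LinePreserving K K' (γ ∘ fun p : K × K => (p.1 + p.2, p.2)) :=
      hγ.comp_affine _ fun p q c => by
        ext
        · simp [mul_sub, mul_add]; abel
        · simp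
    obtain ⟨O, hO, hs⟩ := hg.exists_concurrent hK (by
      simp only [Function.comp]
      refine hγ.linearIndependent_triple hK3 h ?_
      simp only [Prod.mk_sub_mk, zero_add, add_zero, sub_zero]
      exact linearIndependent_prod_pair one_ne_zero (by simp))
    exact ⟨O, hO, fun s => by simpa using hs s⟩
  have h00 := hDs 0
  rw [zero_add, span_pair_congr (hab 0 0) (hab 1 1), hb0, hb1] at h00
  obtain ⟨u, v, huv⟩ := Submodule.mem_span_pair.1 h00
  have hv : v ≠ 0 := by
    rintro rfl
    have hu : u ≠ 0 := by rintro rfl; simp at huv; exact hD huv.symm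
    have h1 : Submodule.span K' {D} = Submodule.span K' {γ (0, 0)} := by
      rw [hab, hb0, ← huv, zero_smul K' (e + _ + _), add_zero, zero_smul K' d₁, zero_smul K' d₂, add_zero, add_zero,
        span_smul_singleton hu]
    have h2 := hγ.linearIndependent_triple hK3 h (p := (1, 0)) (q := (1 + 1, 1)) (r := (0, 0)) (by
      simp only [Prod.mk_sub_mk, add_sub_cancel_right, sub_zero, zero_sub, sub_self]
      exact linearIndependent_prod_pair one_ne_zero (by simp))
    refine (linearIndependent_triple_iff_notMem.1 h2).2 ?_
    exact Submodule.span_le.2 (Set.singleton_subset_iff.2 (hDs 1))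
      (h1 ▸ Submodule.mem_span_singleton_self _)
  -- The centre of the diagonal direction is scaled to `κ e + d₁ + d₂`. That it lies on the line of
  -- `d₁` and `d₂`, that is `κ = 0`, is not known yet; `κ` measures the failure of additivity.
  obtain ⟨κ, hκ⟩ : ∃ κ : K', ∀ s, κ • e + d₁ + d₂ ∈ Submodule.span K' {γ (s, 0), γ (s + 1, 1)} := by
    refine ⟨v⁻¹ * (u + v), fun s => ?_⟩
    have : (v⁻¹ * (u + v)) • e + d₁ + d₂ = v⁻¹ • D := by
      rw [← huv]
      simp only [zero_smul, add_zero, one_smul, smul_add, smul_smul, mul_add, add_smul,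
        inv_mul_cancel₀ hv]
      abel
    rw [this]
    exact Submodule.smul_mem _ _ (hDs s)
  -- The centre is collinear with the images of `(x, 0)` and `(x + y, y)`; the coefficients are
  -- compared in the basis `e, d₁, d₂`.
  have hadd' : ∀ x y, y ≠ 0 → b (x + y) = b x + b y - b y * κ * b x := by
    intro x y hy
    have h1 := hκ x
    have hl := (hγ.span_line_eq (p := (x, 0)) (q := (x + 1, 1))
      (hγ.linearIndependent_pair h hK3 (by simp)) (x := 0) (y := y) hy.symm).2
    rw [← hl] at h1
    simp only [Prod.mk_sub_mk, add_sub_cancel_left, sub_zero, Prod.smul_mk, smul_eq_mul, mul_one,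
      Prod.mk_add_mk, zero_add, add_zero, zero_smul] at h1
    rw [span_pair_congr (hab x 0) (hab (x + y) y), hb0] at h1
    obtain ⟨A, B, hAB⟩ := Submodule.mem_span_pair.1 h1
    have E : (A + B) • e + (A * b x + B * b (x + y)) • d₁ + (B * b y) • d₂ =
        κ • e + (1 : K') • d₁ + (1 : K') • d₂ := by
      rw [one_smul, one_smul, ← hAB]
      simp only [zero_smul, add_zero, smul_add, add_smul, mul_smul]
      abel
    obtain ⟨e1, e2, e3⟩ := hi.eq_of_triple E
    have e4 : b y * B = 1 := mul_eq_one_symm e3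
    have e5 : b y * (A * b x + B * b (x + y)) = b y := by rw [e2, mul_one]
    rw [mul_add, ← mul_assoc (b y) B, e4, one_mul] at e5
    rw [← e1]
    have : b y * (A + B) * b x = b y * (A * b x) + b x := by
      rw [mul_add, e4, add_mul, one_mul, mul_assoc]
    rw [this]
    rw [eq_sub_of_add_eq' e5]
    abel
  -- Outside characteristic 2 the pair `(-1, 1)` suffices, as `b (-1) = -1`. In characteristic 2 the
  -- pair `(1, 1)` gives `κ = 1 + 1` and the pair `(t, t)` gives `b t * κ * (b t - 1) = 0`, where `b
  -- t` is neither 0 nor 1.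
  have hκ0 : κ = 0 := by
    by_cases h2 : (1 : K) + 1 = 0
    · have h3 := hadd' 1 1 one_ne_zero
      rw [h2, hb0, hb1, one_mul, mul_one] at h3
      have h4 := hadd' t t ht0
      have htt : t + t = 0 := by rw [← mul_one t, ← mul_add, h2, mul_zero]
      rw [htt, hb0] at h4
      have hbt : b t ≠ 0 := by
        intro h0
        have : b (t * t⁻¹) = 0 := by rw [hmul, h0, zero_mul]
        rw [mul_inv_cancel₀ ht0, hb1] at this
        exact one_ne_zero this
      have hκ2 : κ = 1 + 1 := (sub_eq_zero.1 h3.symm).symm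
      by_contra hne
      have h5 : b t * κ * (b t - 1) = 0 := by
        have : b t + b t = b t * κ := by rw [hκ2, mul_add, mul_one]
        rw [this] at h4
        rw [mul_sub, mul_one, ← neg_sub, ← h4, neg_zero]
      have h6 : b t = 1 := by
        simpa [hbt, hne, sub_eq_zero] using h5
      exact ht1 (hinj t h6)
    · have h3 : b (-1) = -1 := by
        have h4 : b (-1) * b (-1) = 1 := by rw [← hmul]; simpa using hb1
        refine (mul_self_eq_one_iff.1 h4).resolve_left fun h5 => h2 ?_
        nth_rw 2 [← hinj _ h5]
        exact add_neg_cancel 1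
      have h4 := hadd' (-1) 1 one_ne_zero
      rw [neg_add_cancel, hb0, h3, hb1] at h4
      simpa using h4.symm
  have hadd : ∀ x y, b (x + y) = b x + b y := by
    intro x y
    by_cases hy : y = 0
    · simp [hy, hb0]
    · rw [hadd' x y hy, hκ0, mul_zero, zero_mul, sub_zero]
  exact ⟨{ toFun := b, map_one' := hb1, map_mul' := hmul, map_zero' := hb0, map_add' := hadd },
    e, d₁, d₂, hi, hab⟩

end PlaneLift

theorem LinearIndependent.exists_notMem {K M : Type*} [DivisionRing K] [AddCommGroup M]
    [Module K M] {n : ℕ} {v : Fin n → M} (hv : LinearIndependent K v) (N : Submodule K M)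
    [FiniteDimensional K N] (hN : Module.finrank K N < n) : ∃ i, v i ∉ N := by
  by_contra! h
  have h1 := finrank_span_eq_card hv
  have h2 := Submodule.finrank_mono (Submodule.span_le.2 (by rintro _ ⟨i, rfl⟩; exact h i) :
    Submodule.span K (Set.range v) ≤ N)
  rw [h1, Fintype.card_fin] at h2
  omega

theorem LinearIndependent.exists_notMem_span_pair {K M : Type*} [DivisionRing K] [AddCommGroup M]
    [Module K M] {v : Fin 3 → M} (hv : LinearIndependent K v) (x y : M) :
    ∃ i, v i ∉ Submodule.span K {x, y} := by
  have : FiniteDimensional K (Submodule.span K {x, y}) :=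
    FiniteDimensional.span_of_finite K (by simp)
  refine hv.exists_notMem _ ?_
  rw [← range_pair]
  have := finrank_range_le_card (R := K) ![x, y]
  rw [Fintype.card_fin] at this
  exact Nat.lt_succ_of_le this

theorem linearIndependent_pair_of_notMem_left {K M : Type*} [DivisionRing K] [AddCommGroup M]
    [Module K M] {a b : M} (hb : b ≠ 0) (h : a ∉ Submodule.span K {b}) :
    LinearIndependent K ![a, b] :=
  (linearIndependent_pair_iff_notMem.2 ⟨hb, h⟩).pair_swap

/-! ### Propagating representatives along lines and triangles -/

section LineLift

variable {K K' H Z : Type*} [DivisionRing K] [DivisionRing K'] [AddCommGroup H] [Module K H]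
  [AddCommGroup Z] [Module K' Z]

/-- On the line through `p` and `q`, the map `γ` is induced by the affine semilinear map
that sends `p` and `q` to `P` and `Q`. -/
def IsLineLift (γ : H → Z) (σ : K →+* K') (p : H) (P : Z) (q : H) (Q : Z) : Prop :=
  ∀ x : K, Submodule.span K' {γ (p + x • (q - p))} = Submodule.span K' {P + σ x • (Q - P)}

variable {γ : H → Z} {σ τ : K →+* K'} {p q r : H} {P Q R : Z}

theorem IsLineLift.span_left (h : IsLineLift γ σ p P q Q) :
    Submodule.span K' {γ p} = Submodule.span K' {P} := by
  simpa using h 0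

theorem IsLineLift.span_right (h : IsLineLift γ σ p P q Q) :
    Submodule.span K' {γ q} = Submodule.span K' {Q} := by
  simpa using h 1

theorem IsLineLift.symm (h : IsLineLift γ σ p P q Q) : IsLineLift γ σ q Q p P := by
  intro x
  convert h (1 - x) using 3
  · congr 1
    rw [sub_smul, one_smul, smul_sub, smul_sub]
    abel
  · rw [map_sub, map_one, sub_smul, one_smul, smul_sub, smul_sub]
    abel

theorem IsLineLift.restrict (h : IsLineLift γ σ p P q Q) (x : K) :
    IsLineLift γ σ p P (p + x • (q - p)) (P + σ x • (Q - P)) := by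
  intro y
  rw [add_sub_cancel_left, add_sub_cancel_left, smul_smul, smul_smul, ← map_mul]
  exact h (y * x)

/-- The values at 1 give `Q' = k Q`. Comparing coefficients at `y⁻¹` gives `τ y - 1 = k (σ y - 1)`
for all `y ≠ 0`, and two consecutive nonzero arguments force `k = 1`. -/
theorem lineLift_unique (hK : ∃ t : K, t ≠ 0 ∧ t ≠ 1) {Q' : Z}
    (hi : LinearIndependent K' ![P, Q])
    (h : ∀ x, Submodule.span K' {P + σ x • (Q - P)} = Submodule.span K' {P + τ x • (Q' - P)}) :
    Q = Q' ∧ σ = τ := by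
  have h1 := h 1
  simp only [map_one, one_smul, add_sub_cancel] at h1
  obtain ⟨k, hk, rfl⟩ := span_singleton_eq_iff.1 h1.symm
  have key : ∀ y : K, y ≠ 0 → τ y - 1 = k * σ y - k := by
    intro y hy
    obtain ⟨c, -, hc⟩ := span_singleton_eq_iff.1 (h y⁻¹).symm
    have e : (1 - τ y⁻¹) • P + (τ y⁻¹ * k) • Q = (c * (1 - σ y⁻¹)) • P + (c * σ y⁻¹) • Q := by
      have : (1 - τ y⁻¹) • P + (τ y⁻¹ * k) • Q = P + τ y⁻¹ • (k • Q - P) := by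
        rw [smul_sub, sub_smul, one_smul, smul_smul]; abel
      rw [this, hc, mul_smul, mul_smul, ← smul_add, sub_smul, one_smul, smul_sub]
      congr 1
      abel
    obtain ⟨e1, e2⟩ := hi.eq_of_pair e
    have hs : σ y⁻¹ * σ y = 1 := by rw [← map_mul, inv_mul_cancel₀ hy, map_one]
    have ht : τ y * τ y⁻¹ = 1 := by rw [← map_mul, mul_inv_cancel₀ hy, map_one]
    have e3 : c = τ y⁻¹ * k * σ y := by
      rw [e2, mul_assoc, hs, mul_one]
    have e4 : τ y * (1 - τ y⁻¹) = τ y * (c * (1 - σ y⁻¹)) := by rw [e1]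
    rw [mul_sub, ht, mul_one] at e4
    have hs' : σ y * σ y⁻¹ = 1 := by rw [← map_mul, mul_inv_cancel₀ hy, map_one]
    rw [e4, e3, mul_sub, mul_one, mul_assoc _ (σ y), hs', mul_one, mul_sub, ← mul_assoc,
      ← mul_assoc, ht, one_mul]
  obtain ⟨t, ht0, ht1⟩ := hK
  have hk1 : k = 1 := by
    -- Both `-t` and `-t + 1` are nonzero, and additivity relates the homomorphisms at these two
    -- points.
    have h2 := key (-t) (neg_ne_zero.2 ht0)
    have h3 := key (-t + 1) (by
      intro h0
      exact ht1 (neg_add_eq_zero.1 h0))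
    rw [map_add, map_add, map_one, map_one, mul_add, mul_one, add_sub_cancel_right,
      add_sub_cancel_right] at h3
    rw [h3] at h2
    exact (sub_right_inj.1 h2).symm
  subst hk1
  refine ⟨by simp, RingHom.ext fun y => ?_⟩
  by_cases hy : y = 0
  · simp [hy]
  · have := key y hy
    rw [one_mul] at this
    exact (sub_left_inj.1 this).symm

theorem IsLineLift.unique (hK : ∃ t : K, t ≠ 0 ∧ t ≠ 1) {Q' : Z} (hi : LinearIndependent K' ![γ p, γ q])
    (h : IsLineLift γ σ p P q Q) (h' : IsLineLift γ σ p P q Q') : Q = Q' :=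
  (lineLift_unique hK (hi.pair_congr h.span_left h.span_right)
    fun x => (h x).symm.trans (h' x)).1

/-- The plane theorem with a prescribed representative at `p`. Multiplying all vectors by `c` on the
left replaces `σ` by its conjugate by `c`. -/
theorem LinePreserving.exists_triangle_lift (hK : EnoughScalars K K') (hγ : LinePreserving K K' γ)
    (hi : LinearIndependent K' ![γ p, γ q, γ r])
    (hP : Submodule.span K' {γ p} = Submodule.span K' {P}) :
    ∃ (σ : K →+* K') (Q R : Z), ∀ x y, Submodule.span K' {γ (p + x • (q - p) + y • (r - p))} =
      Submodule.span K' {P + σ x • (Q - P) + σ y • (R - P)} := by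
  obtain ⟨σ, e, d₁, d₂, -, h⟩ := (hγ.comp_affine (fun u : K × K => p + u.1 • (q - p) + u.2 • (r - p))
    (by
      intro u v c
      simp only [Prod.fst_add, Prod.snd_add, Prod.smul_fst, Prod.smul_snd, Prod.fst_sub,
        Prod.snd_sub, add_smul, sub_smul, smul_eq_mul, mul_smul, smul_sub, smul_add]
      abel)).exists_plane_lift hK (by simpa using hi)
  simp only [Function.comp] at h
  have he : Submodule.span K' {P} = Submodule.span K' {e} := by
    rw [← hP]
    simpa using h 0 0
  obtain ⟨c, hc, rfl⟩ := span_singleton_eq_iff.1 he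
  refine ⟨{ toFun := fun x => c * σ x * c⁻¹
            map_one' := by simp [hc]
            map_mul' := fun x y => by simp [mul_assoc, hc]
            map_zero' := by simp
            map_add' := fun x y => by simp [mul_add, add_mul] }, c • (e + d₁), c • (e + d₂),
    fun x y => ?_⟩
  rw [h, ← span_smul_singleton hc]
  congr 2
  simp [smul_smul, smul_add, mul_assoc, hc]

/-- The lift of the triangle restricts on `pq` to the given one by `lineLift_unique`, so `σ` and `Q`
are kept and only the representative at `r` is new. -/
theorem IsLineLift.exists_third (hK : EnoughScalars K K') (hγ : LinePreserving K K' γ)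
    (hi : LinearIndependent K' ![γ p, γ q, γ r]) (h : IsLineLift γ σ p P q Q) :
    ∃ R, IsLineLift γ σ p P r R ∧ IsLineLift γ σ q Q r R := by
  obtain ⟨τ, Q', R, h'⟩ := hγ.exists_triangle_lift hK hi h.span_left
  have hpq := (linearIndependent_triple_iff_notMem.1 hi).1
  obtain ⟨rfl, rfl⟩ := lineLift_unique (τ := τ) (Q' := Q') hK.exists_ne
    (hpq.pair_congr h.span_left h.span_right) (fun x => by
      rw [← h x]
      simpa using h' x 0)
  refine ⟨R, fun y => by simpa using h' 0 y, fun x => ?_⟩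
  convert h' (1 - x) x using 3
  · congr 1
    simp only [sub_smul, one_smul, smul_sub]
    abel
  · simp only [map_sub, map_one, sub_smul, one_smul, smul_sub]
    abel

theorem exists_frame (hK : EnoughScalars K K') (hγ : LinePreserving K K' γ) {a : Fin 3 → H}
    (hi : LinearIndependent K' (γ ∘ a)) :
    ∃ (σ : K →+* K') (A : Fin 3 → Z), ∀ i j, i ≠ j → IsLineLift γ σ (a i) (A i) (a j) (A j) := by
  have hi' : LinearIndependent K' ![γ (a 0), γ (a 1), γ (a 2)] := by
    convert hi using 1
    ext i; fin_cases i <;> rfl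
  obtain ⟨σ, B, C, h⟩ := hγ.exists_triangle_lift hK hi' rfl
  have h01 : IsLineLift γ σ (a 0) (γ (a 0)) (a 1) B := fun x => by simpa using h x 0
  have h02 : IsLineLift γ σ (a 0) (γ (a 0)) (a 2) C := fun x => by simpa using h 0 x
  have h12 : IsLineLift γ σ (a 1) B (a 2) C := by
    intro x
    convert h (1 - x) x using 3
    · congr 1
      simp only [sub_smul, one_smul, smul_sub]
      abel
    · simp only [map_sub, map_one, sub_smul, one_smul, smul_sub]
      abel
  refine ⟨σ, ![γ (a 0), B, C], fun i j hij => ?_⟩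
  fin_cases i <;> fin_cases j
  · exact absurd rfl hij
  · exact h01
  · exact h02
  · exact h01.symm
  · exact absurd rfl hij
  · exact h12
  · exact h02.symm
  · exact h12.symm
  · exact absurd rfl hij

variable {a : Fin 3 → H} {A : Fin 3 → Z}

theorem LinearIndependent.triple_of_ne {M : Type*} [AddCommGroup M] [Module K M] {v : Fin 3 → M}
    (h : LinearIndependent K v) {i j k : Fin 3} (hij : i ≠ j) (hik : i ≠ k) (hjk : j ≠ k) :
    LinearIndependent K ![v i, v j, v k] := by
  have : ![v i, v j, v k] = v ∘ ![i, j, k] := by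
    ext l; fin_cases l <;> rfl
  rw [this]
  refine h.comp _ ?_
  intro x y
  fin_cases x <;> fin_cases y <;> simp_all [eq_comm]

theorem mem_span_singleton_of_mem_span_pair {M : Type*} [AddCommGroup M] [Module K M]
    {u v w z : M} (h : LinearIndependent K ![u, v, w]) (h1 : z ∈ Submodule.span K {u, w})
    (h2 : z ∈ Submodule.span K {v, w}) : z ∈ Submodule.span K {w} := by
  obtain ⟨x, y, rfl⟩ := Submodule.mem_span_pair.1 h1
  obtain ⟨x', y', e⟩ := Submodule.mem_span_pair.1 h2
  have E : (0 : K) • u + x' • v + y' • w = x • u + (0 : K) • v + y • w := by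
    simpa using e
  obtain ⟨e1, -, -⟩ := h.eq_of_triple E
  rw [← e1, zero_smul, zero_add]
  exact Submodule.smul_mem _ _ (Submodule.mem_span_singleton_self _)

/-- A point with nonzero image lies off some side of the frame, and the triangle on that side gives
`R`. For the remaining vertex a second triangle gives a representative that agrees with `R` on a
common edge. -/
theorem exists_lift_of_frame (hK : EnoughScalars K K') (hγ : LinePreserving K K' γ)
    (hi : LinearIndependent K' (γ ∘ a))
    (hL : ∀ i j, i ≠ j → IsLineLift γ σ (a i) (A i) (a j) (A j)) (hp : γ p ≠ 0) :
    ∃ R, ∀ i, γ p ∉ Submodule.span K' {γ (a i)} → IsLineLift γ σ (a i) (A i) p R := by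
  have main : ∀ i j k : Fin 3, i ≠ j → i ≠ k → j ≠ k →
      γ p ∉ Submodule.span K' {γ (a i), γ (a j)} → ∃ R, IsLineLift γ σ (a i) (A i) p R ∧
        IsLineLift γ σ (a j) (A j) p R ∧
        (γ p ∉ Submodule.span K' {γ (a k)} → IsLineLift γ σ (a k) (A k) p R) := by
    intro i j k hij hik hjk hp'
    have tri : ∀ {l m : Fin 3}, l ≠ m → γ p ∉ Submodule.span K' {γ (a l), γ (a m)} →
        LinearIndependent K' ![γ (a l), γ (a m), γ p] := by
      intro l m hlm hm
      refine linearIndependent_triple_iff_notMem.2 ⟨?_, hm⟩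
      obtain ⟨n, hn⟩ := (by decide : ∀ l m : Fin 3, ∃ n, n ≠ l ∧ n ≠ m) l m
      exact (linearIndependent_triple_iff_notMem.1
        (hi.triple_of_ne hlm hn.1.symm hn.2.symm)).1
    obtain ⟨R, hR1, hR2⟩ := (hL i j hij).exists_third hK hγ (tri hij hp')
    refine ⟨R, hR1, hR2, fun hk => ?_⟩
    have finish : ∀ l, l ≠ k → IsLineLift γ σ (a l) (A l) p R →
        γ p ∉ Submodule.span K' {γ (a l), γ (a k)} → IsLineLift γ σ (a k) (A k) p R := by
      intro l hlk hR hl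
      obtain ⟨R', h1, h2⟩ := (hL l k hlk).exists_third hK hγ (tri hlk hl)
      have hlp : LinearIndependent K' ![γ (a l), γ p] :=
        linearIndependent_pair_iff_notMem.2 ⟨hi.ne_zero l,
          fun h => hl (Submodule.span_mono (by simp) h)⟩
      rwa [hR.unique hK.exists_ne hlp h1]
    by_cases h1 : γ p ∈ Submodule.span K' {γ (a i), γ (a k)}
    · by_cases h2 : γ p ∈ Submodule.span K' {γ (a j), γ (a k)}
      · exact absurd (mem_span_singleton_of_mem_span_pair (hi.triple_of_ne hij hik hjk) h1 h2) hk
      · exact finish j hjk hR2 h2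
    · exact finish i hik hR1 h1
  have comb : ∀ i j k : Fin 3, i ≠ j → i ≠ k → j ≠ k →
      γ p ∉ Submodule.span K' {γ (a i), γ (a j)} →
      ∃ R, ∀ i, γ p ∉ Submodule.span K' {γ (a i)} → IsLineLift γ σ (a i) (A i) p R := by
    intro i j k hij hik hjk h
    obtain ⟨R, h1, h2, h3⟩ := main i j k hij hik hjk h
    refine ⟨R, fun l hl => ?_⟩
    have : l = i ∨ l = j ∨ l = k := by
      clear h h1 h2 h3 hl main
      revert i j k l; decide
    rcases this with rfl | rfl | rfl
    exacts [h1, h2, h3 hl]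
  by_cases h01 : γ p ∈ Submodule.span K' {γ (a 0), γ (a 1)}
  · by_cases h21 : γ p ∈ Submodule.span K' {γ (a 2), γ (a 1)}
    · refine comb 0 2 1 (by decide) (by decide) (by decide) fun h02 => hp ?_
      have h1 := mem_span_singleton_of_mem_span_pair
        (hi.triple_of_ne (i := 0) (j := 2) (k := 1) (by decide) (by decide) (by decide)) h01 h21
      obtain ⟨y, hy⟩ := Submodule.mem_span_singleton.1 h1
      change y • γ (a 1) = γ p at hy
      obtain ⟨u, v, huv⟩ := Submodule.mem_span_pair.1 h02
      have := linearIndependent_triple_iff.1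
        (hi.triple_of_ne (i := 0) (j := 2) (k := 1) (by decide) (by decide) (by decide)) u v (-y) (by
          simp only [Function.comp]
          rw [huv, neg_smul, hy, add_neg_cancel])
      rw [← hy, neg_eq_zero.1 this.2.2, zero_smul]
    · exact comb 2 1 0 (by decide) (by decide) (by decide) h21
  · exact comb 0 1 2 (by decide) (by decide) (by decide) h01

end LineLift

/-! ### The fundamental theorem for affine spaces -/

section AffineFundamental

variable {K K' H Z : Type*} [DivisionRing K] [DivisionRing K'] [AddCommGroup H] [Module K H]
  [AddCommGroup Z] [Module K' Z]

theorem mem_span_singleton_iff_of_span_eq {H : Type*} {γ Φ : H → Z}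
    (hS : ∀ p, Submodule.span K' {γ p} = Submodule.span K' {Φ p}) (p : H) (N : Submodule K' Z) :
    γ p ∈ N ↔ Φ p ∈ N := by
  rw [← Submodule.span_singleton_le_iff_mem, hS, Submodule.span_singleton_le_iff_mem]

/-- The frame assigns a representative to every point. For `p, q` with independent images, the
triangle on `p`, `q` and a frame vertex off their line shows that the two representatives fit
together. -/
theorem LinePreserving.exists_lift_nondegenerate (hK : EnoughScalars K K') {γ : H → Z}
    (hγ : LinePreserving K K' γ) {a : Fin 3 → H} (hi : LinearIndependent K' (γ ∘ a)) :
    ∃ (σ : K →+* K') (Φ : H → Z), (∀ p, Submodule.span K' {γ p} = Submodule.span K' {Φ p}) ∧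
      ∀ p q, LinearIndependent K' ![γ p, γ q] → ∀ x : K,
        Φ (p + x • (q - p)) = Φ p + σ x • (Φ q - Φ p) := by
  obtain ⟨σ, A, hL⟩ := exists_frame hK hγ hi
  have hex : ∀ p, ∃ R, (γ p = 0 → R = 0) ∧ (γ p ≠ 0 →
      ∀ i, γ p ∉ Submodule.span K' {γ (a i)} → IsLineLift γ σ (a i) (A i) p R) := by
    intro p
    -- The value 0 is imposed where the projective map is undefined.
    by_cases hp : γ p = 0
    · exact ⟨0, fun _ => rfl, fun h => absurd hp h⟩
    · obtain ⟨R, hR⟩ := exists_lift_of_frame hK hγ hi hL hp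
      exact ⟨R, fun h => absurd h hp, fun _ => hR⟩
  choose Φ hΦ0 hΦ using hex
  have hS : ∀ p, Submodule.span K' {γ p} = Submodule.span K' {Φ p} := by
    intro p
    by_cases hp : γ p = 0
    · rw [hp, hΦ0 p hp]
    · obtain ⟨i, hi'⟩ := hi.exists_notMem_span_pair (γ p) 0
      refine (hΦ p hp i fun h => hi' ?_).span_right
      have := span_singleton_eq_of_mem hp h
      exact Submodule.span_mono (by simp) (this ▸ Submodule.mem_span_singleton_self (γ (a i)))
  refine ⟨σ, Φ, hS, ?_⟩
  have hC : ∀ p q, LinearIndependent K' ![γ p, γ q] → IsLineLift γ σ p (Φ p) q (Φ q) := by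
    intro p q hpq
    obtain ⟨i, hi'⟩ := hi.exists_notMem_span_pair (γ p) (γ q)
    have htri : LinearIndependent K' ![γ (a i), γ p, γ q] :=
      (linearIndependent_triple_iff_notMem.2 ⟨hpq, hi'⟩).triple_perm
        (by simp [Set.insert_subset_iff])
    have h1 := (linearIndependent_triple_iff_notMem.1 htri).1
    have h2 : LinearIndependent K' ![γ (a i), γ q] :=
      (linearIndependent_triple_iff_notMem.1 (htri.triple_perm (p := γ (a i)) (q := γ q)
        (r := γ p) (by simp [Set.insert_subset_iff]))).1
    have l1 := hΦ p (hpq.ne_zero 0) i (linearIndependent_pair_iff_notMem.1 h1).2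
    have l2 := hΦ q (hpq.ne_zero 1) i (linearIndependent_pair_iff_notMem.1 h2).2
    obtain ⟨R, h3, h4⟩ := l1.exists_third hK hγ htri
    rwa [l2.unique hK.exists_ne h2 h3]
  intro p q hpq x
  by_cases hx : x = 0
  · simp [hx]
  have hpm : LinearIndependent K' ![γ p, γ (p + x • (q - p))] := by
    simpa using (hγ.span_line_eq hpq (x := 0) (y := x) (Ne.symm hx)).1
  exact (hC _ _ hpm).unique hK.exists_ne hpm ((hC p q hpq).restrict x)

section Degenerate

variable {γ Φ : H → Z} {σ : K →+* K'} (hK : ∃ t : K, t ≠ 0 ∧ t ≠ 1)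
  (hγ : LinePreserving K K' γ)
  (hS : ∀ p, Submodule.span K' {γ p} = Submodule.span K' {Φ p})
  (hA : ∀ p q, LinearIndependent K' ![γ p, γ q] → ∀ x : K,
        Φ (p + x • (q - p)) = Φ p + σ x • (Φ q - Φ p))
include hK hS hA

/-- The point is placed on a line joining a point of `pq` to a point of `pr`, as in
`LinePreserving.mem_of_plane`; when `x ≠ 0` these two points have independent images, so the formula
for lines applies. -/
theorem lift_plane {p q r : H} (hi : LinearIndependent K' ![γ p, γ q, γ r]) (x y : K) :
    Φ (p + x • (q - p) + y • (r - p)) = Φ p + σ x • (Φ q - Φ p) + σ y • (Φ r - Φ p) := by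
  have hpq := (linearIndependent_triple_iff_notMem.1 hi).1
  have hpr := (linearIndependent_triple_iff_notMem.1 (hi.triple_perm (p := γ p) (q := γ r)
    (r := γ q) (by simp [Set.insert_subset_iff]))).1
  by_cases hx : x = 0
  · simp [hx, hA p r hpr y]
  obtain ⟨t, h0, h1⟩ := hK
  have h1' : 1 - t ≠ 0 := sub_ne_zero.2 h1.symm
  obtain ⟨x', hx'⟩ : ∃ x', x = (1 - t) * x' :=
    ⟨(1 - t)⁻¹ * x, by rw [← mul_assoc, mul_inv_cancel₀ h1', one_mul]⟩
  obtain ⟨y', hy'⟩ : ∃ y', y = t * y' :=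
    ⟨t⁻¹ * y, by rw [← mul_assoc, mul_inv_cancel₀ h0, one_mul]⟩
  have hx'0 : σ x' ≠ 0 := by
    rw [map_ne_zero]; rintro rfl; simp [hx'] at hx
  have hiΦ : LinearIndependent K' ![Φ p, Φ q, Φ r] := hi.triple_congr (hS p) (hS q) (hS r)
  have hu := hA p q hpq x'
  have hv := hA p r hpr y'
  have huv : LinearIndependent K' ![γ (p + x' • (q - p)), γ (p + y' • (r - p))] := by
    refine LinearIndependent.pair_congr ?_ (hS _).symm (hS _).symm
    rw [hu, hv, LinearIndependent.pair_iff]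
    intro s t e
    have E : (s * (1 - σ x') + t * (1 - σ y')) • Φ p + (s * σ x') • Φ q + (t * σ y') • Φ r = 0 := by
      rw [← e]
      simp only [add_smul, mul_sub, mul_one, sub_smul, smul_add, smul_sub, mul_smul]
      abel
    obtain ⟨e1, e2, e3⟩ := linearIndependent_triple_iff.1 hiΦ _ _ _ E
    have hs : s = 0 := by simpa [hx'0] using e2
    subst hs
    refine ⟨rfl, ?_⟩
    rwa [zero_mul, zero_add, mul_sub, e3, mul_one, sub_zero] at e1
  have := hA _ _ huv t
  rw [hu, hv] at this
  convert this using 1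
  · congr 1
    rw [hx', hy']
    simp only [sub_mul, one_mul, sub_smul, smul_add, smul_sub, mul_smul]
    abel
  · rw [hx', hy']
    simp only [map_mul, map_sub, sub_mul, one_mul, sub_smul, smul_add, smul_sub, mul_smul]
    abel

include hγ

/-- The line `pq` is contracted by the map, so `m = p + x • (q - p)` is reached by another line,
through `a` and `b`, obtained by moving `p` and `q` parallel to `s - s'`. The values at `b`, and at
`a` when `γ p ≠ 0`, are known from `lift_plane`. -/
theorem lift_of_dependent {a : Fin 3 → H} (hi : LinearIndependent K' (γ ∘ a)) {p q : H}
    (hq : γ q ≠ 0) (hpq : γ p ∈ Submodule.span K' {γ q}) (x : K) :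
    Φ (p + x • (q - p)) = Φ p + σ x • (Φ q - Φ p) := by
  by_cases hx0 : x = 0
  · simp [hx0]
  by_cases hx1 : x = 1
  · simp [hx1]
  obtain ⟨s, s', hi3⟩ : ∃ s s', LinearIndependent K' ![γ q, γ s, γ s'] := by
    obtain ⟨i, hi1⟩ := hi.exists_notMem_span_pair (γ q) 0
    have h1 : LinearIndependent K' ![γ q, γ (a i)] := linearIndependent_pair_iff_notMem.2
      ⟨hq, fun h => hi1 (Submodule.span_mono (by simp) h)⟩
    obtain ⟨j, hj⟩ := hi.exists_notMem_span_pair (γ q) (γ (a i))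
    exact ⟨a i, a j, linearIndependent_triple_iff_notMem.2 ⟨h1, hj⟩⟩
  have hiΦ : LinearIndependent K' ![Φ q, Φ s, Φ s'] := hi3.triple_congr (hS _) (hS _) (hS _)
  have hx1' : 1 - x ≠ 0 := sub_ne_zero.2 (Ne.symm hx1)
  have hmem := mem_span_singleton_iff_of_span_eq hS
  -- The displacements are `y` at `p` and 1 at `q`; the equation `(1 - x) y + x = 0` makes them
  -- cancel at `m`.
  obtain ⟨y, hy⟩ : ∃ y, (1 - x) * y = -x :=
    ⟨(1 - x)⁻¹ * -x, by rw [← mul_assoc, mul_inv_cancel₀ hx1', one_mul]⟩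
  have hy0 : σ y ≠ 0 := by
    rw [map_ne_zero]; rintro rfl; simp at hy; exact hx0 hy
  have hm : p + x • (q - p) = (p + y • (s - p) + (-y) • (s' - p)) +
      x • ((q + (1 : K) • (s - q) + (-1 : K) • (s' - q)) - (p + y • (s - p) + (-y) • (s' - p))) := by
    have e1 : p + y • (s - p) + (-y) • (s' - p) = p + y • (s - s') := by
      simp only [neg_smul, smul_sub]; abel
    have e2 : q + (1 : K) • (s - q) + (-1 : K) • (s' - q) = q + (s - s') := by
      simp only [neg_smul, one_smul]; abel
    rw [e1, e2]
    have e3 : p + y • (s - s') + x • (q + (s - s') - (p + y • (s - s'))) =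
        p + x • (q - p) + (((1 - x) * y) • (s - s') + x • (s - s')) := by
      rw [sub_mul, one_mul, sub_smul, mul_smul]
      simp only [smul_add, smul_sub]
      abel
    rw [e3, hy, neg_smul, neg_add_cancel, add_zero]
  have hb := lift_plane hK hS hA hi3 1 (-1)
  have hb' : Φ (q + (1 : K) • (s - q) + (-1 : K) • (s' - q)) = Φ q + Φ s - Φ s' := by
    rw [hb]; simp only [map_one, map_neg, one_smul, neg_smul]; abel
  obtain ⟨a, ha⟩ : ∃ a, a = p + y • (s - p) + (-y) • (s' - p) := ⟨_, rfl⟩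
  obtain ⟨b, hb⟩ : ∃ b, b = q + (1 : K) • (s - q) + (-1 : K) • (s' - q) := ⟨_, rfl⟩
  obtain ⟨m, hm'⟩ : ∃ m, m = p + x • (q - p) := ⟨_, rfl⟩
  rw [← ha, ← hb, ← hm'] at hm
  rw [← hb] at hb'
  rw [← hm']
  have hγm : γ m ∈ Submodule.span K' {Φ q} := by
    rw [← hS, hm']
    refine Submodule.span_le.2 ?_ (hγ p q x)
    rintro _ (rfl | rfl)
    · exact hpq
    · exact Submodule.mem_span_singleton_self _
  obtain ⟨μ, hμ⟩ := Submodule.mem_span_singleton.1 ((hmem m _).1 hγm)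
  have hγmab : γ m ∈ Submodule.span K' {γ a, γ b} := by rw [hm]; exact hγ a b x
  -- if the image of `m` is a multiple of the image of `b`, it vanishes
  have hmb : γ m ∈ Submodule.span K' {γ b} → Φ m = 0 := by
    intro h
    rw [hS, hmem, hb'] at h
    obtain ⟨ν, hν⟩ := Submodule.mem_span_singleton.1 h
    have E : ν • Φ q + ν • Φ s + (-ν) • Φ s' = μ • Φ q + (0 : K') • Φ s + (0 : K') • Φ s' := by
      rw [zero_smul, zero_smul, add_zero, add_zero, hμ, ← hν, smul_sub, smul_add, neg_smul,
        sub_eq_add_neg]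
    obtain ⟨-, e2, -⟩ := hiΦ.eq_of_triple E
    rw [← hν, e2, zero_smul]
  by_cases hp : γ p = 0
  · have hΦp : Φ p = 0 := by simpa [hp] using (hmem p ⊥).1 (by simp [hp])
    rw [hΦp, zero_add, sub_zero]
    have hγa : γ a ∈ Submodule.span K' {Φ s, Φ s'} := by
      rw [ha, ← span_pair_congr (hS s) (hS s')]
      exact hγ.mem_of_plane hK (by simp [hp]) (Submodule.subset_span (by simp))
        (Submodule.subset_span (by simp)) _ _
    obtain ⟨u, v, huv⟩ := Submodule.mem_span_pair.1 ((hmem a _).1 hγa)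
    by_cases hab : LinearIndependent K' ![γ a, γ b]
    · have := hA a b hab x
      rw [← hm, hb', ← huv, ← hμ] at this
      have E : μ • Φ q + (0 : K') • Φ s + (0 : K') • Φ s' = σ x • Φ q +
          ((1 - σ x) * u + σ x) • Φ s + ((1 - σ x) * v - σ x) • Φ s' := by
        rw [zero_smul, zero_smul, add_zero, add_zero, this]
        simp only [add_smul, sub_mul, one_mul, sub_smul, smul_add, smul_sub, mul_smul]
        abel
      rw [← hμ, (hiΦ.eq_of_triple E).1]
    -- If `γ a` vanishes, then so does `γ m`, and `γ q` with it, as `q` is on the line `pm`.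
    -- Otherwise `Φ b` would be a multiple of `Φ a`, which has no component along `Φ q`.
    · exfalso
      rw [linearIndependent_pair_iff_notMem, not_and_or, not_not, not_not] at hab
      rcases hab with h0 | h0
      · have hm0 : γ m = 0 := by
          have h1 := hmb (by simpa [h0] using hγmab)
          simpa using (hmem m ⊥).2 (by simp [h1])
        apply hq
        have h1 := hγ p m x⁻¹
        rw [hp, hm0] at h1
        have h2 : p + x⁻¹ • (m - p) = q := by
          rw [hm', add_sub_cancel_left, smul_smul, inv_mul_cancel₀ hx0, one_smul]; abel
        rw [h2] at h1
        simpa using h1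
      · rw [hmem, hS, hb', ← huv] at h0
        obtain ⟨c, hc⟩ := Submodule.mem_span_singleton.1 h0
        have E : (0 : K') • Φ q + (c * u) • Φ s + (c * v) • Φ s' =
            (1 : K') • Φ q + (1 : K') • Φ s + (-1 : K') • Φ s' := by
          rw [zero_smul, zero_add, mul_smul, mul_smul, ← smul_add, hc]
          simp only [one_smul, neg_smul]
          abel
        exact zero_ne_one (hiΦ.eq_of_triple E).1
  · have hsp : Submodule.span K' {γ p} = Submodule.span K' {Φ q} := by
      rw [← hS]; exact span_singleton_eq_of_mem hp hpq
    obtain ⟨lam, hlam⟩ := Submodule.mem_span_singleton.1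
      ((hmem p _).1 (hsp ▸ Submodule.mem_span_singleton_self _))
    have ha' := lift_plane hK hS hA (hi3.triple_congr
      (span_singleton_eq_of_mem hp hpq).symm rfl rfl) y (-y)
    rw [← ha] at ha'
    have ha'' : Φ a = lam • Φ q + σ y • Φ s + (-σ y) • Φ s' := by
      rw [ha', ← hlam]; simp only [map_neg, neg_smul, smul_sub]; abel
    have hyx : (1 - σ x) * σ y = - σ x := by rw [← map_one σ, ← map_sub, ← map_mul, hy, map_neg]
    by_cases hab : LinearIndependent K' ![γ a, γ b]
    · rw [hm, hA a b hab x, ha'', hb', ← hlam]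
      have E : lam • Φ q + σ y • Φ s + (-σ y) • Φ s' +
          σ x • (Φ q + Φ s - Φ s' - (lam • Φ q + σ y • Φ s + (-σ y) • Φ s')) =
          lam • Φ q + σ x • (Φ q - lam • Φ q) + (((1 - σ x) * σ y) • (Φ s - Φ s') +
            σ x • (Φ s - Φ s')) := by
        simp only [neg_smul, sub_mul, one_mul, sub_smul, smul_add, smul_sub, mul_smul, smul_neg]
        abel
      rw [E, hyx, neg_smul, neg_add_cancel, add_zero]
    -- The line `ab` is contracted as well. Then `Φ m` lies both on `Φ b` and on `Φ q`, hence
    -- vanishes, and `lam = σ y` makes the other side vanish too.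
    · rw [linearIndependent_pair_iff_notMem, not_and_or, not_not, not_not] at hab
      have ha0 : γ a ≠ 0 := by
        intro h0
        have h1 : Φ a = 0 := by simpa [h0] using (hmem a ⊥).1 (by simp [h0])
        rw [ha''] at h1
        exact hy0 (linearIndependent_triple_iff.1 hiΦ _ _ _ h1).2.1
      have hba := hab.resolve_left ha0
      rw [hmem, hS] at hba
      obtain ⟨c, hc⟩ := Submodule.mem_span_singleton.1 hba
      have E : (c * lam) • Φ q + (c * σ y) • Φ s + (-(c * σ y)) • Φ s' =
          (1 : K') • Φ q + (1 : K') • Φ s + (-1 : K') • Φ s' := by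
        have h1 : c • Φ a = Φ q + Φ s - Φ s' := by rw [hc, hb']
        rw [ha''] at h1
        simp only [smul_add, smul_smul, mul_neg] at h1
        rw [h1]
        simp only [one_smul, neg_smul]
        abel
      obtain ⟨e1, e2, -⟩ := hiΦ.eq_of_triple E
      have hc0 : c ≠ 0 := by rintro rfl; simp at e1
      have hly : lam = σ y := mul_left_cancel₀ hc0 (e1.trans e2.symm)
      have h0 : Φ m = 0 := by
        refine hmb (Submodule.span_le.2 ?_ hγmab)
        rintro _ (rfl | rfl)
        · have hb0 : γ b ≠ 0 := by
            intro h0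
            have h1 : Φ b = 0 := by simpa [h0] using (hmem b ⊥).1 (by simp [h0])
            rw [← hc, smul_eq_zero] at h1
            refine ha0 ?_
            simpa using (hmem a ⊥).2 (by simp [h1.resolve_left hc0])
          have := span_singleton_eq_of_mem hb0 (hab.resolve_left ha0)
          rw [this]
          exact Submodule.mem_span_singleton_self _
        · exact Submodule.mem_span_singleton_self _
      rw [h0, ← hlam, hly]
      have E2 : σ y • Φ q + σ x • (Φ q - σ y • Φ q) = ((1 - σ x) * σ y) • Φ q + σ x • Φ q := by
        simp only [sub_mul, one_mul, sub_smul, smul_sub, mul_smul]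
        abel
      rw [E2, hyx, neg_smul, neg_add_cancel]

end Degenerate

/-- The fundamental theorem of affine geometry, for partial maps from an affine space to a
projective space, not necessarily injective. -/
theorem LinePreserving.exists_semilinear (hK : EnoughScalars K K') {γ : H → Z}
    (hγ : LinePreserving K K' γ) {a : Fin 3 → H} (hi : LinearIndependent K' (γ ∘ a)) :
    ∃ (σ : K →+* K') (e : Z) (Φ : H →ₛₗ[σ] Z),
      ∀ p, Submodule.span K' {γ p} = Submodule.span K' {e + Φ p} := by
  obtain ⟨σ, Φ, hS, hA⟩ := hγ.exists_lift_nondegenerate hK hi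
  have hmem := mem_span_singleton_iff_of_span_eq hS
  have hall : ∀ p q (x : K), Φ (p + x • (q - p)) = Φ p + σ x • (Φ q - Φ p) := by
    have h1 : ∀ {p q}, γ q ≠ 0 → γ p ∈ Submodule.span K' {γ q} → ∀ x : K,
        Φ (p + x • (q - p)) = Φ p + σ x • (Φ q - Φ p) := fun {p q} =>
      lift_of_dependent hK.exists_ne hγ hS hA hi
    intro p q x
    by_cases hq : γ q = 0
    · by_cases hp : γ p = 0
      · have hm : γ (p + x • (q - p)) = 0 := by simpa [hp, hq] using hγ p q x
        have h0 : ∀ {u}, γ u = 0 → Φ u = 0 := fun {u} hu => by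
          simpa [hu] using (hmem u ⊥).1 (by simp [hu])
        rw [h0 hm, h0 hp, h0 hq]
        simp
      · have := h1 hp (p := q) (by simp [hq]) (1 - x)
        convert this using 1
        · congr 1
          simp only [sub_smul, one_smul, smul_sub]
          abel
        · simp only [map_sub, map_one, sub_smul, one_smul, smul_sub]
          abel
    · by_cases hpq : γ p ∈ Submodule.span K' {γ q}
      · exact h1 hq hpq x
      · exact hA p q (linearIndependent_pair_of_notMem_left hq hpq) x
  obtain ⟨t, ht0, ht1⟩ := hK.exists_ne
  have hsmul : ∀ (x : K) q, Φ (x • q) - Φ 0 = σ x • (Φ q - Φ 0) := by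
    intro x q
    have := hall 0 q x
    rw [sub_zero, zero_add] at this
    rw [this, add_sub_cancel_left]
  refine ⟨σ, Φ 0, { toFun := fun h => Φ h - Φ 0, map_add' := fun u v => ?_, map_smul' := hsmul },
    fun p => ?_⟩
  -- The sum `u + v` is the point with parameter `t` on the line through `u / (1 - t)` and `v / t`,
  -- which avoids dividing by 2.
  · have h1' : 1 - t ≠ 0 := sub_ne_zero.2 (Ne.symm ht1)
    have h1 := hall ((1 - t)⁻¹ • u) (t⁻¹ • v) t
    have h2 : (1 - t)⁻¹ • u + t • (t⁻¹ • v - (1 - t)⁻¹ • u) = u + v := by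
      have h3 : u = (1 - t) • ((1 - t)⁻¹ • u) := by rw [smul_smul, mul_inv_cancel₀ h1', one_smul]
      have h4 : v = t • (t⁻¹ • v) := by rw [smul_smul, mul_inv_cancel₀ ht0, one_smul]
      conv_rhs => rw [h3, h4]
      rw [sub_smul, one_smul, smul_sub]
      abel
    rw [h2] at h1
    have h5 := hsmul (1 - t) ((1 - t)⁻¹ • u)
    have h6 := hsmul t (t⁻¹ • v)
    rw [smul_smul, mul_inv_cancel₀ h1', one_smul] at h5
    rw [smul_smul, mul_inv_cancel₀ ht0, one_smul] at h6
    rw [h5, h6, h1]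
    simp only [map_sub, map_one, sub_smul, one_smul, smul_sub]
    abel
  · rw [hS]
    simp

end AffineFundamental

/-! ### Comparing and gluing semilinear maps -/

section Semilinear

variable {K K' V Z : Type*} [DivisionRing K] [DivisionRing K'] [AddCommGroup V] [Module K V]
  [AddCommGroup Z] [Module K' Z] {σ τ : K →+* K'}

/-- Semilinear maps that are projectively equal off a hyperplane are proportional. -/
theorem exists_smul_eq_of_span_eq (hK : ∃ t : K, t ≠ 0 ∧ t ≠ 1) {Φ : V →ₛₗ[σ] Z} {Ψ : V →ₛₗ[τ] Z}
    {W : Submodule K V} (hW : IsCoatom W)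
    (h : ∀ v ∉ W, Submodule.span K' {Φ v} = Submodule.span K' {Ψ v})
    {v₁ v₂ : V} (hi : LinearIndependent K' ![Φ v₁, Φ v₂]) :
    ∃ c : K', c ≠ 0 ∧ (∀ v, Ψ v = c • Φ v) ∧ ∀ k, τ k * c = c * σ k := by
  have step : ∀ v w, v ∉ W → w - v ∈ W → LinearIndependent K' ![Φ v, Φ w] → ∀ a : K', a ≠ 0 →
      Ψ v = a • Φ v → Ψ w = a • Φ w ∧ ∀ k, τ k * a = a * σ k := by
    intro v w hv hvw hi a ha hva
    -- Conjugating by `a` turns `Ψ` into a map that agrees with `Φ` at `v`. The line through `v` and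
    -- `w` avoids `W`, so `lineLift_unique` applies to it.
    let τ' : K →+* K' :=
      { toFun := fun x => a⁻¹ * τ x * a
        map_one' := by simp [ha]
        map_mul' := fun x y => by simp [mul_assoc, ha]
        map_zero' := by simp
        map_add' := fun x y => by simp [mul_add, add_mul] }
    have hτ' : ∀ x, τ' x = a⁻¹ * τ x * a := fun x => rfl
    obtain ⟨h1, h2⟩ := lineLift_unique (σ := σ) (τ := τ') (Q' := a⁻¹ • Ψ w) hK hi (by
      intro x
      have hx : v + x • (w - v) ∉ W := fun hx => hv (by
        have := W.sub_mem hx (W.smul_mem x hvw)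
        simpa using this)
      have h3 := h _ hx
      rw [map_add, map_add, LinearMap.map_smulₛₗ, LinearMap.map_smulₛₗ, map_sub, map_sub] at h3
      rw [h3, hτ', ← span_smul_singleton (inv_ne_zero ha), hva]
      congr 2
      simp [smul_smul, smul_add, smul_sub, mul_assoc, ha])
    refine ⟨by rw [h1, smul_smul, mul_inv_cancel₀ ha, one_smul], fun k => ?_⟩
    rw [h2, hτ', ← mul_assoc, ← mul_assoc, mul_inv_cancel₀ ha, one_mul]
  obtain ⟨o, -, ho⟩ := SetLike.exists_of_lt hW.lt_top
  have hdecomp : ∀ v, ∃ k : K, ∃ w ∈ W, v = k • o + w := by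
    intro v
    have : v ∈ Submodule.span K {o} ⊔ W := by
      rw [hW.2 _ (right_lt_sup.2 fun h => ho (h (Submodule.mem_span_singleton_self o)))]
      trivial
    obtain ⟨_, h1, w, hw, rfl⟩ := Submodule.mem_sup.1 this
    obtain ⟨k, rfl⟩ := Submodule.mem_span_singleton.1 h1
    exact ⟨k, w, hw, rfl⟩
  have hoW : ∀ {w}, w ∈ W → o + w ∉ W := fun hw h => ho (by simpa using W.sub_mem h hw)
  -- If all the `Φ (o + w)` were proportional, `Φ` would have values in a single line, contrary to
  -- `hi`.
  obtain ⟨w₁, hw₁, w₂, hw₂, hi'⟩ : ∃ w₁ ∈ W, ∃ w₂ ∈ W,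
      LinearIndependent K' ![Φ (o + w₁), Φ (o + w₂)] := by
    by_contra! hcon
    have hexists : ∃ z : Z, ∀ w ∈ W, Φ (o + w) ∈ Submodule.span K' {z} := by
      by_cases h0 : ∃ w ∈ W, Φ (o + w) ≠ 0
      · obtain ⟨w, hw, hw0⟩ := h0
        refine ⟨Φ (o + w), fun w' hw' => ?_⟩
        by_contra hne
        exact hcon w hw w' hw' (linearIndependent_pair_iff_notMem.2 ⟨hw0, hne⟩)
      · push Not at h0
        exact ⟨0, fun w hw => by rw [h0 w hw]; exact Submodule.zero_mem _⟩
    obtain ⟨z, hz⟩ := hexists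
    have hall : ∀ v, Φ v ∈ Submodule.span K' {z} := by
      intro v
      obtain ⟨k, w, hw, rfl⟩ := hdecomp v
      have ho := hz 0 W.zero_mem
      rw [add_zero] at ho
      have hw' : Φ w ∈ Submodule.span K' {z} := by
        have := Submodule.sub_mem _ (hz w hw) ho
        rwa [map_add, add_sub_cancel_left] at this
      rw [map_add, LinearMap.map_smulₛₗ]
      exact Submodule.add_mem _ (Submodule.smul_mem _ _ ho) hw'
    obtain ⟨a, ha⟩ := Submodule.mem_span_singleton.1 (hall v₁)
    obtain ⟨b, hb⟩ := Submodule.mem_span_singleton.1 (hall v₂)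
    have ha0 : a ≠ 0 := by rintro rfl; exact hi.ne_zero 0 (by simpa using ha.symm)
    refine (linearIndependent_pair_iff_notMem.1 hi).2 (Submodule.mem_span_singleton.2
      ⟨b * a⁻¹, ?_⟩)
    rw [← ha, ← hb, smul_smul, mul_assoc, inv_mul_cancel₀ ha0, mul_one]
  obtain ⟨a, ha, hva⟩ := span_singleton_eq_iff.1 (h _ (hoW hw₁)).symm
  obtain ⟨hw₂a, hcomm⟩ := step _ _ (hoW hw₁) (by simpa using W.sub_mem hw₂ hw₁) hi' a ha hva
  -- A nonzero `Φ (o + w)` is independent of the value at `w₁` or of the value at `w₂`, so the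
  -- scalar `a` spreads to it.
  have hall : ∀ w ∈ W, Ψ (o + w) = a • Φ (o + w) := by
    intro w hw
    by_cases h0 : Φ (o + w) = 0
    · have := h _ (hoW hw)
      rw [h0] at this
      rw [h0, smul_zero]
      exact Submodule.span_singleton_eq_bot.1 (this ▸ Submodule.span_singleton_eq_bot.2 rfl)
    by_cases h1 : Φ (o + w) ∈ Submodule.span K' {Φ (o + w₁)}
    · have h2 : LinearIndependent K' ![Φ (o + w₂), Φ (o + w)] :=
        hi'.pair_swap.pair_congr rfl (span_singleton_eq_of_mem h0 h1).symm
      exact (step _ _ (hoW hw₂) (by simpa using W.sub_mem hw hw₂) h2 a ha hw₂a).1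
    · exact (step _ _ (hoW hw₁) (by simpa using W.sub_mem hw hw₁)
        (linearIndependent_pair_iff_notMem.2 ⟨hi'.ne_zero 0, h1⟩) a ha hva).1
  refine ⟨a, ha, fun v => ?_, hcomm⟩
  obtain ⟨k, w, hw, rfl⟩ := hdecomp v
  have h0 := hall 0 W.zero_mem
  rw [add_zero] at h0
  have h1 := hall w hw
  rw [map_add, map_add, h0, smul_add, add_right_inj] at h1
  rw [map_add, map_add, LinearMap.map_smulₛₗ, LinearMap.map_smulₛₗ, h0, h1, smul_add, smul_smul,
    smul_smul, hcomm]

/-- Compatible semilinear maps modulo two disjoint subspaces come from a semilinear map. -/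
theorem exists_glue {A B : Submodule K' Z} (hAB : A ⊓ B = ⊥) (Φ : V →ₛₗ[σ] Z ⧸ A)
    (Ψ : V →ₛₗ[σ] Z ⧸ B)
    (h : ∀ v, Submodule.factor (le_sup_left : A ≤ A ⊔ B) (Φ v) =
      Submodule.factor (le_sup_right : B ≤ A ⊔ B) (Ψ v)) :
    ∃ Θ : V →ₛₗ[σ] Z, ∀ v, A.mkQ (Θ v) = Φ v ∧ B.mkQ (Θ v) = Ψ v := by
  -- The pairs of classes in `Z/A` and `Z/B` that agree in `Z/(A ⊔ B)` come from `Z`, and from only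
  -- one element because `A ⊓ B = ⊥`.
  have hex : ∀ v, ∃ z, A.mkQ z = Φ v ∧ B.mkQ z = Ψ v := by
    intro v
    obtain ⟨z₁, h₁⟩ := A.mkQ_surjective (Φ v)
    obtain ⟨z₂, h₂⟩ := B.mkQ_surjective (Ψ v)
    have h3 := h v
    rw [← h₁, ← h₂] at h3
    have h4 : z₁ - z₂ ∈ A ⊔ B := by
      rw [← Submodule.Quotient.eq]
      exact h3
    obtain ⟨a, ha, b, hb, hab⟩ := Submodule.mem_sup.1 h4
    refine ⟨z₁ - a, ?_, ?_⟩
    · rw [map_sub, h₁, (Submodule.Quotient.mk_eq_zero A).2 ha |> fun e => (e : A.mkQ a = 0),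
        sub_zero]
    · have : z₁ - a = z₂ + b := by
        rw [sub_eq_iff_eq_add, add_assoc, add_comm b a, hab]; abel
      rw [this, map_add, h₂, (Submodule.Quotient.mk_eq_zero B).2 hb |> fun e => (e : B.mkQ b = 0),
        add_zero]
  have huniq : ∀ z z', A.mkQ z = A.mkQ z' → B.mkQ z = B.mkQ z' → z = z' := by
    intro z z' h1 h2
    have : z - z' ∈ A ⊓ B := ⟨(Submodule.Quotient.eq A).1 h1, (Submodule.Quotient.eq B).1 h2⟩
    rw [hAB, Submodule.mem_bot] at this
    exact sub_eq_zero.1 this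
  choose Θ hA hB using hex
  refine ⟨{ toFun := Θ
            map_add' := fun u v => huniq _ _ ?_ ?_
            map_smul' := fun k v => huniq _ _ ?_ ?_ }, fun v => ⟨hA v, hB v⟩⟩
  · rw [map_add, hA, hA, hA, map_add]
  · rw [map_add, hB, hB, hB, map_add]
  · rw [map_smul, hA, hA, LinearMap.map_smulₛₗ]
  · rw [map_smul, hB, hB, LinearMap.map_smulₛₗ]

theorem mkQ_mem_span_pair {N : Submodule K' Z} {u v w : Z} :
    N.mkQ w ∈ Submodule.span K' {N.mkQ u, N.mkQ v} ↔ w ∈ N ⊔ Submodule.span K' {u, v} := by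
  rw [← Set.image_pair, Submodule.span_image, ← Submodule.mem_comap, Submodule.comap_map_mkQ]

theorem mkQ_mem_span_singleton {N : Submodule K' Z} {u w : Z} :
    N.mkQ w ∈ Submodule.span K' {N.mkQ u} ↔ w ∈ N ⊔ Submodule.span K' {u} := by
  rw [← Set.image_singleton, Submodule.span_image, ← Submodule.mem_comap, Submodule.comap_map_mkQ]

theorem mkQ_span_mem_span_pair {x u v w : Z} :
    (Submodule.span K' {x}).mkQ w ∈
      Submodule.span K' {(Submodule.span K' {x}).mkQ u, (Submodule.span K' {x}).mkQ v} ↔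
      w ∈ Submodule.span K' {x, u, v} := by
  rw [mkQ_mem_span_pair, Submodule.span_insert x]

theorem mkQ_span_mem_span_singleton {x u w : Z} :
    (Submodule.span K' {x}).mkQ w ∈ Submodule.span K' {(Submodule.span K' {x}).mkQ u} ↔
      w ∈ Submodule.span K' {x, u} := by
  rw [mkQ_mem_span_singleton, Submodule.span_insert x]

end Semilinear

/-! ### The local theorem: lifting after projection from a point -/

section LocalMorphism

variable {K K' V V' ι : Type*} [DivisionRing K] [DivisionRing K'] [AddCommGroup V] [Module K V]
  [AddCommGroup V'] [Module K' V']

variable (K K') in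
/-- The points `⟨r x⟩` form a locally affino-projective subset of `ℙ(V)`, and `⟨r x⟩ ↦ ⟨s x⟩`
is a morphism to `ℙ(V')` whose image is not contained in a plane. -/
structure IsLocalMorphism (r : ι → V) (s : ι → V') : Prop where
  flat : ∀ N : Submodule K' V', ∃ W : Submodule K V, ∀ x, s x ∈ N ↔ r x ∈ W
  locally : ∀ x, ∃ W : Submodule K V, IsCoatom W ∧ r x ∈ W ∧
    ∀ v ∉ W, ∃ y, r y ∈ Submodule.span K {r x, v} ∧ r y ∉ Submodule.span K {r x}
  rank : ∀ a b c : V', ∃ x, s x ∉ Submodule.span K' {a, b, c}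

variable {r : ι → V} {s : ι → V'} {σ τ : K →+* K'}

/-- The semilinear map `Φ` to the quotient by `N` induces the map `⟨r x⟩ ↦ ⟨s x⟩` modulo `N`. -/
def IsLift (r : ι → V) (s : ι → V') (N : Submodule K' V') (Φ : V →ₛₗ[σ] V' ⧸ N) : Prop :=
  ∀ y, Submodule.span K' {Φ (r y)} = Submodule.span K' {N.mkQ (s y)}

theorem IsLocalMorphism.mem_span (h : IsLocalMorphism K K' r s) {x y z w : ι}
    (hw : r w ∈ Submodule.span K {r x, r y, r z}) : s w ∈ Submodule.span K' {s x, s y, s z} := by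
  obtain ⟨W, hW⟩ := h.flat (Submodule.span K' {s x, s y, s z})
  rw [hW]
  refine Submodule.span_le.2 ?_ hw
  rintro _ (rfl | rfl | rfl)
  · exact (hW _).1 (Submodule.subset_span (by simp))
  · exact (hW _).1 (Submodule.subset_span (by simp))
  · exact (hW _).1 (Submodule.subset_span (by simp))

theorem eq_zero_of_mem_span_singleton {M : Type*} [AddCommGroup M] [Module K M] {u v z : M}
    (h : LinearIndependent K ![u, v]) (h1 : z ∈ Submodule.span K {u})
    (h2 : z ∈ Submodule.span K {v}) : z = 0 := by
  by_contra hz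
  refine (linearIndependent_pair_iff_notMem.1 h).2 ?_
  rw [← span_singleton_eq_of_mem hz h1, span_singleton_eq_of_mem hz h2]
  exact Submodule.mem_span_singleton_self v

/-- The local extension theorem: near a point, a morphism is induced by a semilinear map. -/
theorem IsLocalMorphism.exists_isLift (hK : EnoughScalars K K') (h : IsLocalMorphism K K' r s)
    (x : ι) : ∃ (σ : K →+* K') (Φ : V →ₛₗ[σ] V' ⧸ Submodule.span K' {s x}),
      IsLift r s (Submodule.span K' {s x}) Φ := by
  obtain ⟨W, hW, hxW, hY⟩ := h.locally x
  have : Nonempty ι := ⟨x⟩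
  choose! Y hY1 hY2 using hY
  have hY3 : ∀ v ∉ W, v ∈ Submodule.span K {r x, r (Y v)} := fun v hv =>
    mem_span_pair_exchange (hY1 v hv) (hY2 v hv)
  obtain ⟨π, hπ⟩ : ∃ π, π = (Submodule.span K' {s x}).mkQ := ⟨_, rfl⟩
  have hπ2 : ∀ {y z w}, r w ∈ Submodule.span K {r x, r y, r z} →
      π (s w) ∈ Submodule.span K' {π (s y), π (s z)} := by
    intro y z w hw
    rw [hπ, mkQ_span_mem_span_pair]
    exact h.mem_span hw
  have hπ1 : ∀ {y w}, r w ∈ Submodule.span K {r x, r y} →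
      π (s w) ∈ Submodule.span K' {π (s y)} := by
    intro y w hw
    have := hπ2 (w := w) (y := y) (z := y) (by simpa using hw)
    simpa using this
  -- After projection from `s x`, the image depends only on the line through `x`, not on the point
  -- chosen on it.
  have hsame : ∀ {v y}, v ∉ W → r y ∈ Submodule.span K {r x, v} → r y ∉ Submodule.span K {r x} →
      Submodule.span K' {π (s y)} = Submodule.span K' {π (s (Y v))} := by
    intro v y hv h1 h2
    have h3 : v ∈ Submodule.span K {r x, r y} := mem_span_pair_exchange h1 h2
    apply le_antisymm
    · refine Submodule.span_le.2 (Set.singleton_subset_iff.2 (hπ1 ?_))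
      refine Submodule.span_le.2 ?_ h1
      rintro _ (rfl | rfl)
      · exact Submodule.subset_span (by simp)
      · exact hY3 _ hv
    · refine Submodule.span_le.2 (Set.singleton_subset_iff.2 (hπ1 ?_))
      refine Submodule.span_le.2 ?_ (hY1 v hv)
      rintro _ (rfl | rfl)
      · exact Submodule.subset_span (by simp)
      · exact h3
  obtain ⟨o, -, ho⟩ := SetLike.exists_of_lt hW.lt_top
  have hoW : ∀ w : W, o + w.1 ∉ W := fun w h => ho (by simpa using W.sub_mem h w.2)
  -- The affine space is `o + W`. To `o + w` is attached the projected image of a point of `X`,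
  -- different from `x`, on the line joining `x` to `o + w`.
  let γ : W → V' ⧸ Submodule.span K' {s x} := fun w => π (s (Y (o + w.1)))
  have hγdef : ∀ w, γ w = π (s (Y (o + w.1))) := fun w => rfl
  have hγ : LinePreserving K K' γ := by
    intro p q c
    refine hπ2 ?_
    have hp : o + p.1 ∈ Submodule.span K {r x, r (Y (o + p.1)), r (Y (o + q.1))} :=
      Submodule.span_mono (by simp [Set.insert_subset_iff]) (hY3 _ (hoW p))
    have hq : o + q.1 ∈ Submodule.span K {r x, r (Y (o + p.1)), r (Y (o + q.1))} :=
      Submodule.span_mono (by simp [Set.insert_subset_iff]) (hY3 _ (hoW q))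
    refine Submodule.span_le.2 ?_ (hY1 _ (hoW _))
    rintro _ (rfl | rfl)
    · exact Submodule.subset_span (by simp)
    · have : o + (p + c • (q - p) : W).1 = (o + p.1) + c • ((o + q.1) - (o + p.1)) := by
        simp [add_assoc]
      rw [this]
      exact Submodule.add_mem _ hp (Submodule.smul_mem _ _ (Submodule.sub_mem _ hq hp))
  -- Were all values of `γ` on a line, the preimage of a plane through `s x` would contain `o + W`,
  -- hence everything, and the image of the morphism would be in that plane.
  have hrank : ∀ u v, ∃ w, γ w ∉ Submodule.span K' {u, v} := by
    intro u v
    by_contra! hcon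
    obtain ⟨u, rfl⟩ := (Submodule.span K' {s x}).mkQ_surjective u
    obtain ⟨v, rfl⟩ := (Submodule.span K' {s x}).mkQ_surjective v
    obtain ⟨y, hy⟩ := h.rank (s x) u v
    obtain ⟨U, hU⟩ := h.flat (Submodule.span K' {s x, u, v})
    have hxU : r x ∈ U := (hU x).1 (Submodule.subset_span (by simp))
    have hoU : ∀ w : W, o + w.1 ∈ U := by
      intro w
      have h1 := hcon w
      rw [hγdef, hπ, mkQ_span_mem_span_pair, hU] at h1
      refine Submodule.span_le.2 ?_ (hY3 _ (hoW w))
      rintro _ (rfl | rfl)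
      · exact hxU
      · exact h1
    have ho' : o ∈ U := by simpa using hoU 0
    have hWU : W ≤ U := fun w hw => by simpa using U.sub_mem (hoU ⟨w, hw⟩) ho'
    have hUtop : U = ⊤ := hW.2 U (lt_of_le_of_ne hWU fun e => ho (e ▸ ho'))
    exact hy ((hU y).2 (hUtop ▸ Submodule.mem_top))
  obtain ⟨a, ha⟩ : ∃ a : Fin 3 → W, LinearIndependent K' (γ ∘ a) := by
    obtain ⟨w₁, h₁⟩ := hrank 0 0
    obtain ⟨w₂, h₂⟩ := hrank (γ w₁) 0
    obtain ⟨w₃, h₃⟩ := hrank (γ w₁) (γ w₂)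
    refine ⟨![w₁, w₂, w₃], ?_⟩
    have : γ ∘ ![w₁, w₂, w₃] = ![γ w₁, γ w₂, γ w₃] := by
      ext i; fin_cases i <;> rfl
    rw [this]
    refine linearIndependent_triple_iff_notMem.2 ⟨linearIndependent_pair_iff_notMem.2
      ⟨fun h0 => h₁ (by simp [h0]), fun hm => h₂ (Submodule.span_mono (by simp) hm)⟩, h₃⟩
  obtain ⟨σ, e, Φ₀, hΦ₀⟩ := hγ.exists_semilinear hK ha
  obtain ⟨lam, hlo, hlW⟩ : ∃ lam : V →ₗ[K] K, lam o = 1 ∧ ∀ v, lam v = 0 ↔ v ∈ W := by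
    obtain ⟨f, hf, hWf⟩ := Submodule.exists_le_ker_of_lt_top W hW.lt_top
    have hker : LinearMap.ker f = W := by
      by_contra hne
      exact hf (LinearMap.ker_eq_top.1 (hW.2 _ (lt_of_le_of_ne hWf (Ne.symm hne))))
    have hfo : f o ≠ 0 := fun h0 => ho (hker ▸ LinearMap.mem_ker.2 h0)
    refine ⟨(LinearMap.toSpanSingleton K K (f o)⁻¹).comp f, by simp [hfo], fun v => ?_⟩
    rw [← hker, LinearMap.mem_ker]
    simp [hfo]
  have hpr : ∀ v, v - lam v • o ∈ W := fun v => (hlW _).1 (by simp [hlo])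
  -- The affine map `w ↦ e + Φ₀ w` is homogenized along the decomposition of `V` as the sum of the
  -- line of `o` and `W`.
  let Φ : V →ₛₗ[σ] V' ⧸ Submodule.span K' {s x} :=
    { toFun := fun v => σ (lam v) • e + Φ₀ ⟨v - lam v • o, hpr v⟩
      map_add' := fun u v => by
        have : (⟨u + v - lam (u + v) • o, hpr _⟩ : W) =
            ⟨u - lam u • o, hpr u⟩ + ⟨v - lam v • o, hpr v⟩ := by
          ext
          simp only [map_add, add_smul, Submodule.coe_add]
          abel
        rw [this, map_add, map_add, map_add, add_smul]
        abel
      map_smul' := fun k v => by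
        have : (⟨k • v - lam (k • v) • o, hpr _⟩ : W) = k • ⟨v - lam v • o, hpr v⟩ := by
          ext
          simp [smul_sub, smul_smul]
        rw [this, LinearMap.map_smulₛₗ Φ₀, LinearMap.map_smul lam, smul_eq_mul, map_mul, smul_add, mul_smul] }
  have hΦdef : ∀ v, Φ v = σ (lam v) • e + Φ₀ ⟨v - lam v • o, hpr v⟩ := fun v => rfl
  have hΦo : ∀ w : W, Φ (o + w.1) = e + Φ₀ w := by
    intro w
    have h1 : lam (o + w.1) = 1 := by rw [map_add, hlo, (hlW _).2 w.2, add_zero]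
    have h2 : (⟨o + w.1 - lam (o + w.1) • o, hpr _⟩ : W) = w := by
      ext
      simp [h1]
    rw [hΦdef, h2, h1, map_one, one_smul]
  have hΦY : ∀ v ∉ W, Submodule.span K' {Φ v} = Submodule.span K' {π (s (Y v))} := by
    intro v hv
    have hk : lam v ≠ 0 := fun h0 => hv ((hlW v).1 h0)
    obtain ⟨w, hw⟩ : ∃ w : W, v = lam v • (o + w.1) := by
      refine ⟨(lam v)⁻¹ • ⟨v - lam v • o, hpr v⟩, ?_⟩
      simp [smul_add, smul_smul, hk]
    have h1 : Submodule.span K' {Φ v} = Submodule.span K' {γ w} := by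
      have h0 : Φ v = σ (lam v) • Φ (o + w.1) := by
        conv_lhs => rw [hw]
        exact LinearMap.map_smulₛₗ _ _ _
      rw [hΦ₀, ← hΦo, h0, span_smul_singleton]
      simpa using hk
    rw [h1]
    refine hsame hv ?_ (hY2 _ (hoW w))
    refine Submodule.span_le.2 ?_ (hY1 _ (hoW w))
    rintro _ (rfl | rfl)
    · exact Submodule.subset_span (by simp)
    · have : o + w.1 = (lam v)⁻¹ • v := by
        rw [eq_inv_smul_iff₀ hk]; exact hw.symm
      rw [this]
      exact Submodule.smul_mem _ _ (Submodule.subset_span (by simp))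
  have hΦind : ∀ u v : V' ⧸ Submodule.span K' {s x}, ∃ w ∉ W, Φ w ∉ Submodule.span K' {u, v} := by
    intro u v
    obtain ⟨w, hw⟩ := hrank u v
    refine ⟨o + w.1, hoW w, fun h1 => hw ?_⟩
    have h2 := hΦY _ (hoW w)
    exact Submodule.span_le.2 (Set.singleton_subset_iff.2 h1)
      (h2 ▸ Submodule.mem_span_singleton_self (γ w))
  have hzero : ∀ z, (∀ v ∉ W, z ∈ Submodule.span K' {Φ v}) → z = 0 := by
    intro z hz
    obtain ⟨v₁, hv₁, h1⟩ := hΦind 0 0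
    obtain ⟨v₂, hv₂, h2⟩ := hΦind (Φ v₁) 0
    refine eq_zero_of_mem_span_singleton (linearIndependent_pair_iff_notMem.2
      ⟨fun h0 => h1 (by simp [h0]), fun hm => h2 (Submodule.span_mono (by simp) hm)⟩)
      (hz v₁ hv₁) (hz v₂ hv₂)
  have hadd : ∀ {v w}, v ∉ W → w ∈ W → v + w ∉ W := fun hv hw h =>
    hv (by simpa using W.sub_mem h hw)
  -- Adding `r x` to `v` does not change the line joining it to `x`; hence `Φ (r x)` is a multiple
  -- of `Φ v` for every `v ∉ W`, and these vectors are not all proportional.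
  have hΦx : Φ (r x) = 0 := by
    refine hzero _ fun v hv => ?_
    have h1 : Submodule.span K' {Φ (v + r x)} = Submodule.span K' {Φ v} := by
      rw [hΦY _ hv, hΦY _ (hadd hv hxW)]
      refine hsame hv ?_ (hY2 _ (hadd hv hxW))
      refine Submodule.span_le.2 ?_ (hY1 _ (hadd hv hxW))
      rintro _ (rfl | rfl)
      · exact Submodule.subset_span (by simp)
      · exact Submodule.add_mem _ (Submodule.subset_span (by simp)) (Submodule.subset_span (by simp))
    have h2 : Φ (v + r x) ∈ Submodule.span K' {Φ v} := h1 ▸ Submodule.mem_span_singleton_self _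
    rw [map_add] at h2
    exact (Submodule.add_mem_iff_right _ (Submodule.mem_span_singleton_self _)).1 h2
  refine ⟨σ, Φ, fun y => ?_⟩
  rw [← hπ]
  by_cases hyW : r y ∈ W
  -- A point `y` in the hyperplane lies, modulo `x`, on the line through `v` and `v + r y`, which
  -- are both off `W`. Varying `v` pins down its image.
  · have hgen : ∀ v ∉ W, π (s y) ∈ Submodule.span K' {Φ v, Φ (r y)} := by
      intro v hv
      have hu := hadd hv hyW
      have h1 : π (s y) ∈ Submodule.span K' {π (s (Y v)), π (s (Y (v + r y)))} := by
        refine hπ2 ?_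
        have h2 : v + r y ∈ Submodule.span K {r x, r (Y v), r (Y (v + r y))} :=
          Submodule.span_mono (by simp [Set.insert_subset_iff]) (hY3 _ hu)
        have h3 : v ∈ Submodule.span K {r x, r (Y v), r (Y (v + r y))} :=
          Submodule.span_mono (by simp [Set.insert_subset_iff]) (hY3 _ hv)
        simpa using Submodule.sub_mem _ h2 h3
      rw [span_pair_congr (hΦY v hv).symm (hΦY _ hu).symm] at h1
      refine Submodule.span_le.2 ?_ h1
      rintro _ (rfl | rfl)
      · exact Submodule.subset_span (by simp)
      · rw [map_add]
        exact Submodule.add_mem _ (Submodule.subset_span (by simp)) (Submodule.subset_span (by simp))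
    have hsub : π (s y) ∈ Submodule.span K' {Φ (r y)} := by
      by_cases h0 : Φ (r y) = 0
      · rw [hzero (π (s y)) fun v hv => by
          have := hgen v hv
          rwa [h0, Set.pair_comm, Submodule.span_insert_zero] at this]
        exact Submodule.zero_mem _
      · obtain ⟨v₁, hv₁, h1⟩ := hΦind (Φ (r y)) 0
        obtain ⟨v₂, hv₂, h2⟩ := hΦind (Φ (r y)) (Φ v₁)
        have hi := linearIndependent_triple_iff_notMem.2 ⟨linearIndependent_pair_iff_notMem.2
          ⟨h0, fun hm => h1 (Submodule.span_mono (by simp) hm)⟩, h2⟩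
        exact mem_span_singleton_of_mem_span_pair (hi.triple_perm (p := Φ v₁) (q := Φ v₂)
          (r := Φ (r y)) (by simp [Set.insert_subset_iff])) (hgen v₁ hv₁) (hgen v₂ hv₂)
    by_cases h0 : π (s y) = 0
    -- Conversely, if `y` has the same image as `x`, then `v` and `v + r y` have proportional images
    -- for all `v ∉ W`, so `Φ (r y)` vanishes.
    · rw [h0, hzero (Φ (r y)) fun v hv => ?_]
      have hu := hadd hv hyW
      have h1 : π (s (Y (v + r y))) ∈ Submodule.span K' {π (s (Y v)), π (s y)} := by
        refine hπ2 (Submodule.span_le.2 ?_ (hY1 _ hu))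
        rintro _ (rfl | rfl)
        · exact Submodule.subset_span (by simp)
        · exact Submodule.add_mem _
            (Submodule.span_mono (by simp [Set.insert_subset_iff]) (hY3 v hv))
            (Submodule.subset_span (by simp))
      have h2 : π (s (Y (v + r y))) ∈ Submodule.span K' {Φ v} := by
        rw [hΦY v hv]
        rwa [h0, Set.pair_comm, Submodule.span_insert_zero] at h1
      have h3 := Submodule.span_le.2 (Set.singleton_subset_iff.2 h2)
      rw [← hΦY _ hu, Submodule.span_singleton_le_iff_mem, map_add] at h3
      exact (Submodule.add_mem_iff_right _ (Submodule.mem_span_singleton_self _)).1 h3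
    · exact (span_singleton_eq_of_mem h0 hsub).symm
  · rw [hΦY _ hyW]
    exact (hsame hyW (Submodule.subset_span (by simp)) fun hm => hyW
      (Submodule.span_le.2 (Set.singleton_subset_iff.2 hxW) hm)).symm

end LocalMorphism

/-! ### Gluing the local lifts into a global semilinear map -/

section LocalMorphism

variable {K K' V V' ι : Type*} [DivisionRing K] [DivisionRing K'] [AddCommGroup V] [Module K V]
  [AddCommGroup V'] [Module K' V'] {r : ι → V} {s : ι → V'} {σ τ : K →+* K'}

theorem mkQ_eq_zero_of_mem {N : Submodule K' V'} {z : V'} (hz : z ∈ N) : N.mkQ z = 0 :=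
  (Submodule.Quotient.mk_eq_zero N).2 hz

theorem IsLift.factor {N N' : Submodule K' V'} {Φ : V →ₛₗ[σ] V' ⧸ N} (h : IsLift r s N Φ)
    (hN : N ≤ N') : IsLift r s N' ((Submodule.factor hN).comp Φ) := by
  intro y
  have h1 := congr_arg (Submodule.map (Submodule.factor hN)) (h y)
  rw [Submodule.map_span, Submodule.map_span, Set.image_singleton, Set.image_singleton] at h1
  exact h1

/-- Lifts modulo a small subspace are unique up to a scalar. -/
theorem IsLocalMorphism.isLift_unique (hK : EnoughScalars K K') (h : IsLocalMorphism K K' r s)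
    {N : Submodule K' V'} {x : ι} (hx : s x ∈ N) {a b : V'} (hN : N ≤ Submodule.span K' {a, b})
    {Φ : V →ₛₗ[σ] V' ⧸ N} {Ψ : V →ₛₗ[τ] V' ⧸ N} (hΦ : IsLift r s N Φ) (hΨ : IsLift r s N Ψ) :
    ∃ c : K', c ≠ 0 ∧ (∀ v, Ψ v = c • Φ v) ∧ ∀ k, τ k * c = c * σ k := by
  obtain ⟨W, hW, hxW, hY⟩ := h.locally x
  have hΦx : Φ (r x) = 0 := by
    have := hΦ x
    rwa [mkQ_eq_zero_of_mem hx, Submodule.span_zero_singleton, Submodule.span_singleton_eq_bot]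
      at this
  have hΨx : Ψ (r x) = 0 := by
    have := hΨ x
    rwa [mkQ_eq_zero_of_mem hx, Submodule.span_zero_singleton, Submodule.span_singleton_eq_bot]
      at this
  obtain ⟨y, hy⟩ := h.rank a b 0
  obtain ⟨z, hz⟩ := h.rank a b (s y)
  have hi : LinearIndependent K' ![Φ (r y), Φ (r z)] := by
    refine LinearIndependent.pair_congr (a := N.mkQ (s y)) (b := N.mkQ (s z)) ?_
      (hΦ y).symm (hΦ z).symm
    refine linearIndependent_pair_iff_notMem.2 ⟨fun h0 => hy ?_, fun hm => hz ?_⟩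
    · have h1 : s y ∈ N := (Submodule.Quotient.mk_eq_zero N).1 h0
      exact Submodule.span_mono (by simp [Set.insert_subset_iff]) (hN h1)
    · rw [mkQ_mem_span_singleton] at hm
      refine sup_le (hN.trans (Submodule.span_mono (by simp [Set.insert_subset_iff])))
        (Submodule.span_mono (by simp)) hm
  -- Both lifts kill `r x`, and any `v` off the hyperplane at `x` is joined to `x` by a line with
  -- another point of `X`, where the two lifts have proportional values.
  refine exists_smul_eq_of_span_eq hK.exists_ne hW (fun v hv => ?_) hi
  obtain ⟨y, hy1, hy2⟩ := hY v hv
  obtain ⟨α, β, hαβ⟩ := Submodule.mem_span_pair.1 hy1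
  have hβ : β ≠ 0 := by
    rintro rfl
    exact hy2 (Submodule.mem_span_singleton.2 ⟨α, by simpa using hαβ⟩)
  have h1 := (hΦ y).trans (hΨ y).symm
  rwa [← hαβ, map_add, map_add, LinearMap.map_smulₛₗ, LinearMap.map_smulₛₗ, LinearMap.map_smulₛₗ,
    LinearMap.map_smulₛₗ, hΦx, hΨx, smul_zero, smul_zero, zero_add, zero_add,
    span_smul_singleton (by simpa using hβ), span_smul_singleton (by simpa using hβ)] at h1

theorem span_singleton_inf_eq_bot {M : Type*} [AddCommGroup M] [Module K M] {a b : M}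
    (h : LinearIndependent K ![a, b]) : Submodule.span K {a} ⊓ Submodule.span K {b} = ⊥ :=
  (Submodule.eq_bot_iff _).2 fun _ hz => eq_zero_of_mem_span_singleton h hz.1 hz.2

theorem span_pair_inf_span_pair {M : Type*} [AddCommGroup M] [Module K M] {a b c : M}
    (h : LinearIndependent K ![a, b, c]) :
    Submodule.span K {a, c} ⊓ Submodule.span K {b, c} ≤ Submodule.span K {c} :=
  fun _ hz => mem_span_singleton_of_mem_span_pair h hz.1 hz.2

/-- Lifts modulo two distinct points are, off the line spanned by these points, lifts. -/
theorem span_eq_of_isLift {x u y : ι} {Θ : V →ₛₗ[σ] V'}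
    (hi : LinearIndependent K' ![s x, s u, s y])
    (hx : IsLift r s (Submodule.span K' {s x}) ((Submodule.mkQ _).comp Θ))
    (hu : IsLift r s (Submodule.span K' {s u}) ((Submodule.mkQ _).comp Θ)) :
    Submodule.span K' {Θ (r y)} = Submodule.span K' {s y} := by
  have key : ∀ {w}, IsLift r s (Submodule.span K' {s w}) ((Submodule.mkQ _).comp Θ) →
      Θ (r y) ∈ Submodule.span K' {s w, s y} := by
    intro w hw
    rw [← mkQ_span_mem_span_singleton, ← hw y]
    exact Submodule.mem_span_singleton_self _
  refine span_singleton_eq_of_mem (fun h0 => ?_)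
    (mem_span_singleton_of_mem_span_pair hi (key hx) (key hu))
  have h1 := hx y
  rw [LinearMap.comp_apply, h0, map_zero, Submodule.span_zero_singleton, eq_comm,
    Submodule.span_singleton_eq_bot] at h1
  have h2 : s y ∈ Submodule.span K' {s x} := (Submodule.Quotient.mk_eq_zero _).1 h1
  have h3 := hi.triple_perm (p := s x) (q := s y) (r := s u) (by simp [Set.insert_subset_iff])
  exact (linearIndependent_pair_iff_notMem.1 (linearIndependent_triple_iff_notMem.1 h3).1).2 h2

/-- Lifts at two points with different images agree up to a scalar modulo the line joining these
images, and glue to `Θ`. For points mapped onto that line, `Θ` is shown to be a lift modulo a third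
centre as well. -/
theorem IsLocalMorphism.exists_semilinear (hK : EnoughScalars K K')
    (h : IsLocalMorphism K K' r s) : ∃ (σ : K →+* K') (Θ : V →ₛₗ[σ] V'),
      ∀ y, Submodule.span K' {Θ (r y)} = Submodule.span K' {s y} := by
  obtain ⟨x, hx⟩ := h.rank 0 0 0
  obtain ⟨u, hu⟩ := h.rank (s x) 0 0
  have hxu : LinearIndependent K' ![s x, s u] := linearIndependent_pair_iff_notMem.2
    ⟨fun h0 => hx (by simp [h0]), fun hm => hu (Submodule.span_mono (by simp) hm)⟩
  obtain ⟨σ, Φ, hΦ⟩ := h.exists_isLift hK x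
  obtain ⟨τ, Ψ, hΨ⟩ := h.exists_isLift hK u
  obtain ⟨c, hc, hcΨ, hcomm⟩ := h.isLift_unique hK (x := x) (a := s x) (b := s u)
    (Submodule.mem_sup_left (Submodule.mem_span_singleton_self _))
    (sup_le (Submodule.span_mono (by simp)) (Submodule.span_mono (by simp)))
    (hΦ.factor (le_sup_left : _ ≤ Submodule.span K' {s x} ⊔ Submodule.span K' {s u}))
    (hΨ.factor (le_sup_right : _ ≤ Submodule.span K' {s x} ⊔ Submodule.span K' {s u}))
  -- Dividing by `c` makes the two lifts equal modulo the line and, by `hcomm`, turns the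
  -- homomorphism `τ` into `σ`.
  let Ψ' : V →ₛₗ[σ] V' ⧸ Submodule.span K' {s u} :=
    { toFun := fun v => c⁻¹ • Ψ v
      map_add' := fun v w => by rw [map_add, smul_add]
      map_smul' := fun k v => by
        rw [LinearMap.map_smulₛₗ, smul_smul, smul_smul]
        congr 1
        rw [eq_mul_inv_iff_mul_eq₀ hc, mul_assoc, hcomm, inv_mul_cancel_left₀ hc] }
  have hΨ' : ∀ v, Ψ' v = c⁻¹ • Ψ v := fun v => rfl
  obtain ⟨Θ, hΘ⟩ := exists_glue (span_singleton_inf_eq_bot hxu) Φ Ψ' (fun v => by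
    have := hcΨ v
    rw [LinearMap.comp_apply, LinearMap.comp_apply] at this
    rw [hΨ', map_smul, this, smul_smul, inv_mul_cancel₀ hc, one_smul])
  have hΘx : IsLift r s (Submodule.span K' {s x}) ((Submodule.mkQ _).comp Θ) := by
    intro y
    rw [LinearMap.comp_apply, (hΘ _).1]
    exact hΦ y
  have hΘu : IsLift r s (Submodule.span K' {s u}) ((Submodule.mkQ _).comp Θ) := by
    intro y
    rw [LinearMap.comp_apply, (hΘ _).2, hΨ', span_smul_singleton (inv_ne_zero hc)]
    exact hΨ y
  -- `Θ` is also a lift modulo any point off the line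
  have hΘz : ∀ {z}, LinearIndependent K' ![s x, s u, s z] →
      IsLift r s (Submodule.span K' {s z}) ((Submodule.mkQ _).comp Θ) := by
    intro z hi
    obtain ⟨ρ, Ω, hΩ⟩ := h.exists_isLift hK z
    have compare : ∀ w, IsLift r s (Submodule.span K' {s w}) ((Submodule.mkQ _).comp Θ) →
        ∃ c : K', c ≠ 0 ∧ ∀ v z', (Submodule.mkQ _) z' = Ω v →
          z' - c • Θ v ∈ Submodule.span K' {s w, s z} := by
      intro w hw
      have hle : Submodule.span K' {s w} ⊔ Submodule.span K' {s z} ≤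
          Submodule.span K' {s w, s z} := (Submodule.span_insert _ _).ge
      obtain ⟨c, hc, hcv, -⟩ := h.isLift_unique hK (x := z) (a := s w) (b := s z)
        (Submodule.mem_sup_right (Submodule.mem_span_singleton_self _)) hle
        (hw.factor (le_sup_left : _ ≤ Submodule.span K' {s w} ⊔ Submodule.span K' {s z}))
        (hΩ.factor (le_sup_right : _ ≤ Submodule.span K' {s w} ⊔ Submodule.span K' {s z}))
      refine ⟨c, hc, fun v z' hz' => hle ?_⟩
      have h1 := hcv v
      rw [LinearMap.comp_apply, ← hz'] at h1
      exact (Submodule.Quotient.eq _).1 h1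
    obtain ⟨c₁, hc₁, h₁⟩ := compare x hΘx
    obtain ⟨c₂, hc₂, h₂⟩ := compare u hΘu
    -- A point off the plane of the three centres compares the scalars found from `x` and from `u`:
    -- if they differed, `Θ (r y)` would lie in that plane.
    obtain ⟨y, hy⟩ := h.rank (s x) (s u) (s z)
    have hyi : LinearIndependent K' ![s x, s u, s y] := linearIndependent_triple_iff_notMem.2
      ⟨hxu, fun hm => hy (Submodule.span_mono (by simp [Set.insert_subset_iff]) hm)⟩
    have hy' := span_eq_of_isLift hyi hΘx hΘu
    have hcc : c₁ = c₂ := by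
      by_contra hne
      apply hy
      obtain ⟨z', hz'⟩ := (Submodule.span K' {s z}).mkQ_surjective (Ω (r y))
      have e1 := Submodule.span_mono (s := {s x, s z}) (t := {s x, s u, s z})
        (by simp [Set.insert_subset_iff]) (h₁ _ z' hz')
      have e2 := Submodule.span_mono (s := {s u, s z}) (t := {s x, s u, s z})
        (by simp) (h₂ _ z' hz')
      have e3 : (c₁ - c₂) • Θ (r y) ∈ Submodule.span K' {s x, s u, s z} := by
        convert Submodule.sub_mem _ e2 e1 using 1
        rw [sub_smul]; abel
      have e4 := (Submodule.smul_mem_iff _ (sub_ne_zero.2 hne)).1 e3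
      exact Submodule.span_le.2 (Set.singleton_subset_iff.2 e4)
        (hy' ▸ Submodule.mem_span_singleton_self (s y))
    intro y
    rw [← hΩ y]
    obtain ⟨z', hz'⟩ := (Submodule.span K' {s z}).mkQ_surjective (Ω (r y))
    have e1 : z' - c₁ • Θ (r y) ∈ Submodule.span K' {s z} :=
      span_pair_inf_span_pair hi ⟨h₁ _ z' hz', hcc ▸ h₂ _ z' hz'⟩
    have e2 : Ω (r y) = c₁ • (Submodule.span K' {s z}).mkQ (Θ (r y)) := by
      rw [← hz', ← map_smul]
      exact (Submodule.Quotient.eq _).2 e1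
    rw [e2, span_smul_singleton hc₁, LinearMap.comp_apply]
  refine ⟨σ, Θ, fun y => ?_⟩
  by_cases hy : s y ∈ Submodule.span K' {s x, s u}
  · obtain ⟨z, hz⟩ := h.rank (s x) (s u) 0
    have hi : LinearIndependent K' ![s x, s u, s z] := linearIndependent_triple_iff_notMem.2
      ⟨hxu, fun hm => hz (Submodule.span_mono (by simp [Set.insert_subset_iff]) hm)⟩
    have hi' : LinearIndependent K' ![s x, s z, s u] :=
      hi.triple_perm (by simp [Set.insert_subset_iff])
    have hi'' : LinearIndependent K' ![s u, s z, s x] :=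
      hi.triple_perm (by simp [Set.insert_subset_iff])
    have hxz := (linearIndependent_triple_iff_notMem.1 hi').1
    have huz := (linearIndependent_triple_iff_notMem.1 hi'').1
    -- A nonzero vector cannot lie on all three sides of the triangle of centres, so one pair of
    -- centres determines it. What remains is `s y = 0`.
    by_cases hy1 : s y ∈ Submodule.span K' {s x, s z}
    · by_cases hy2 : s y ∈ Submodule.span K' {s u, s z}
      · have h1 : s y ∈ Submodule.span K' {s x} := mem_span_singleton_of_mem_span_pair hi''
          (by rwa [Set.pair_comm]) (by rwa [Set.pair_comm])
        have h2 : s y ∈ Submodule.span K' {s z} := mem_span_singleton_of_mem_span_pair hi hy1 hy2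
        have h0 := eq_zero_of_mem_span_singleton hxz h1 h2
        have m1 := hΘx y
        have m2 := hΘu y
        rw [h0, map_zero, Submodule.span_zero_singleton, Submodule.span_singleton_eq_bot] at m1 m2
        have := eq_zero_of_mem_span_singleton hxu ((Submodule.Quotient.mk_eq_zero _).1 m1)
          ((Submodule.Quotient.mk_eq_zero _).1 m2)
        rw [this, h0]
      · exact span_eq_of_isLift (linearIndependent_triple_iff_notMem.2 ⟨huz, hy2⟩) hΘu (hΘz hi)
    · exact span_eq_of_isLift (linearIndependent_triple_iff_notMem.2 ⟨hxz, hy1⟩) hΘx (hΘz hi)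
  · exact span_eq_of_isLift (linearIndependent_triple_iff_notMem.2 ⟨hxu, hy⟩) hΘx hΘu

/-- Modulo each of two centres the maps are proportional; a point off their line shows that the two
factors coincide, and the two centres have zero intersection. -/
theorem IsLocalMorphism.semilinear_unique (hK : EnoughScalars K K')
    (h : IsLocalMorphism K K' r s) {Θ : V →ₛₗ[σ] V'} {Θ' : V →ₛₗ[τ] V'}
    (hΘ : ∀ y, Submodule.span K' {Θ (r y)} = Submodule.span K' {s y})
    (hΘ' : ∀ y, Submodule.span K' {Θ' (r y)} = Submodule.span K' {s y}) :
    ∃ c : K', c ≠ 0 ∧ ∀ v, Θ' v = c • Θ v := by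
  obtain ⟨x, hx⟩ := h.rank 0 0 0
  obtain ⟨u, hu⟩ := h.rank (s x) 0 0
  have hxu : LinearIndependent K' ![s x, s u] := linearIndependent_pair_iff_notMem.2
    ⟨fun h0 => hx (by simp [h0]), fun hm => hu (Submodule.span_mono (by simp) hm)⟩
  have lift : ∀ {ρ : K →+* K'} {Ω : V →ₛₗ[ρ] V'} (N : Submodule K' V'),
      (∀ y, Submodule.span K' {Ω (r y)} = Submodule.span K' {s y}) → IsLift r s N (N.mkQ.comp Ω) := by
    intro ρ Ω N hΩ y
    have h1 := congr_arg (Submodule.map N.mkQ) (hΩ y)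
    rw [Submodule.map_span, Submodule.map_span, Set.image_singleton, Set.image_singleton] at h1
    exact h1
  have compare : ∀ w, ∃ c : K', c ≠ 0 ∧ ∀ v, Θ' v - c • Θ v ∈ Submodule.span K' {s w} := by
    intro w
    obtain ⟨c, hc, hcv, -⟩ := h.isLift_unique hK (x := w) (a := s w) (b := s w)
      (Submodule.mem_span_singleton_self _) (Submodule.span_mono (by simp))
      (lift (Submodule.span K' {s w}) hΘ) (lift (Submodule.span K' {s w}) hΘ')
    exact ⟨c, hc, fun v => (Submodule.Quotient.eq _).1 (hcv v)⟩
  obtain ⟨c₁, hc₁, h₁⟩ := compare x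
  obtain ⟨c₂, hc₂, h₂⟩ := compare u
  have hcc : c₁ = c₂ := by
    by_contra hne
    obtain ⟨y, hy⟩ := h.rank (s x) (s u) 0
    apply hy
    have e1 := Submodule.span_mono (s := {s x}) (t := {s x, s u, 0}) (by simp) (h₁ (r y))
    have e2 := Submodule.span_mono (s := {s u}) (t := {s x, s u, 0}) (by simp) (h₂ (r y))
    have e3 : (c₁ - c₂) • Θ (r y) ∈ Submodule.span K' {s x, s u, 0} := by
      convert Submodule.sub_mem _ e2 e1 using 1
      rw [sub_smul]; abel
    have e4 := (Submodule.smul_mem_iff _ (sub_ne_zero.2 hne)).1 e3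
    exact Submodule.span_le.2 (Set.singleton_subset_iff.2 e4)
      (hΘ y ▸ Submodule.mem_span_singleton_self (s y))
  exact ⟨c₁, hc₁, fun v => sub_eq_zero.1
    (eq_zero_of_mem_span_singleton hxu (h₁ v) (hcc ▸ h₂ v))⟩

end LocalMorphism

/-! ### From the geometry of subspaces to linear algebra -/

section ProjectiveGeometry

variable {K V : Type*} [DivisionRing K] [AddCommGroup V] [Module K V]

theorem rep_mem_iff {W : Submodule K V} {p : ℙ K V} : p.rep ∈ W ↔ p ∈ projSet W := by
  conv_rhs => rw [← p.mk_rep]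
  exact (mk_mem_projSet p.rep_nonzero).symm

theorem isFlat_projSet (W : Submodule K V) : (projGeometry K V).IsFlat (projSet W) := ⟨W, rfl⟩

theorem rep_mem_span_singleton_iff {p q : ℙ K V} : p.rep ∈ Submodule.span K {q.rep} ↔ p = q := by
  constructor
  · intro h
    rw [← p.mk_rep, ← q.mk_rep, Projectivization.mk_eq_mk_iff']
    exact Submodule.mem_span_singleton.1 h
  · rintro rfl
    exact Submodule.mem_span_singleton_self _

theorem closure_projGeometry_image {ι : Type*} (p : ι → ℙ K V) (I : Set ι) :
    (projGeometry K V).closure (p '' I) =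
      projSet (Submodule.span K ((fun i => (p i).rep) '' I)) := by
  apply Set.Subset.antisymm
  · refine PointGeometry.closure_subset _ (isFlat_projSet _) ?_
    rintro _ ⟨i, hi, rfl⟩
    exact rep_mem_iff.1 (Submodule.subset_span ⟨i, hi, rfl⟩)
  · obtain ⟨W, hW⟩ := (projGeometry K V).isFlat_closure (p '' I)
    rw [hW, projSet_subset_iff, Submodule.span_le]
    rintro _ ⟨i, hi, rfl⟩
    have : p i ∈ projSet W := hW ▸ (projGeometry K V).subset_closure _ ⟨i, hi, rfl⟩
    exact rep_mem_iff.2 this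

theorem hasRank_projSet {n : ℕ} {p : Fin n → ℙ K V}
    (h : LinearIndependent K fun i => (p i).rep) :
    (projGeometry K V).HasRank (projSet (Submodule.span K (Set.range fun i => (p i).rep))) n := by
  refine ⟨isFlat_projSet _, Set.range p, ?_, ?_, ?_⟩
  · rintro _ ⟨i, rfl⟩ hi
    have hsub : Set.range p \ {p i} ⊆ p '' {i}ᶜ := by
      rintro _ ⟨⟨j, rfl⟩, hj⟩
      exact ⟨j, fun e => hj (by rw [Set.mem_singleton_iff.1 e]; rfl), rfl⟩
    have h1 := (projGeometry K V).closure_subset ((projGeometry K V).isFlat_closure _)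
      (hsub.trans ((projGeometry K V).subset_closure _)) hi
    rw [closure_projGeometry_image, ← rep_mem_iff] at h1
    have := linearIndependent_iff_notMem_span.1 h i
    rw [← Set.compl_eq_univ_sdiff] at this
    exact this h1
  · rw [← Set.image_univ, closure_projGeometry_image, Set.image_univ]
  · have hinj : Function.Injective p := by
      intro i j hij
      exact h.injective (congr_arg Projectivization.rep hij)
    rw [← Set.image_univ, hinj.encard_image, Set.encard_univ]
    simp

/-- The three vectors may be dependent; the points of a basis of their span show that the rank is at
most 3. -/
theorem containedInPlane_of_subset {A : Set (ℙ K V)} {a b c : V}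
    (h : A ⊆ projSet (Submodule.span K {a, b, c})) : (projGeometry K V).ContainedInPlane A := by
  obtain ⟨N, hN⟩ : ∃ N, N = Submodule.span K {a, b, c} := ⟨_, rfl⟩
  have : FiniteDimensional K N := hN ▸ FiniteDimensional.span_of_finite K (by simp)
  have hcard : Module.finrank K N ≤ 3 := by
    rw [hN, ← range_triple]
    exact (finrank_range_le_card _).trans (by simp)
  let b := Module.finBasis K N
  have hb0 : ∀ i, (b i : V) ≠ 0 := fun i h0 => b.ne_zero i (by exact_mod_cast h0)
  choose c hc using fun i => Projectivization.exists_smul_eq_mk_rep K (b i : V) (hb0 i)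
  have hli : LinearIndependent K fun i => (b i : V) :=
    b.linearIndependent.map' N.subtype N.ker_subtype
  have hrep : (fun i => (Projectivization.mk K (b i : V) (hb0 i)).rep) = fun i => c i • (b i : V) :=
    funext fun i => (hc i).symm
  have hi : LinearIndependent K fun i => (Projectivization.mk K (b i : V) (hb0 i)).rep := by
    rw [hrep]
    exact hli.units_smul c
  refine ⟨_, _, hcard, hasRank_projSet hi, ?_⟩
  refine h.trans ?_
  rw [← hN, projSet_subset_iff]
  have : FiniteDimensional K (Submodule.span K (Set.range fun i =>
      (Projectivization.mk K (b i : V) (hb0 i)).rep)) :=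
    FiniteDimensional.span_of_finite K (Set.finite_range _)
  refine (Submodule.eq_of_le_of_finrank_le (Submodule.span_le.2 ?_) ?_).ge
  · rintro _ ⟨i, rfl⟩
    rw [hrep]
    exact N.smul_of_tower_mem (c i) (b i).2
  · rw [finrank_span_eq_card hi, Fintype.card_fin]

theorem isHyperplane_quotient_iff {x : ℙ K V} {H : Set ((projGeometry K V).QuotSpace {x})} :
    ((projGeometry K V).quotient ((projGeometry K V).isFlat_singleton x)).IsHyperplane H ↔
      ∃ W : Submodule K V, IsCoatom W ∧ x ∈ projSet W ∧
        H = (projGeometry K V).quotImage {x} (projSet W) := by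
  have huniv : (projGeometry K V).quotImage {x} (projSet (⊤ : Submodule K V)) = Set.univ := by
    refine Set.eq_univ_of_forall fun q => ?_
    obtain ⟨y, rfl⟩ := (projGeometry K V).toQuot_surjective q
    exact ⟨y, rep_mem_iff.1 trivial, rfl⟩
  have hle : ∀ {W W' : Submodule K V}, x ∈ projSet W' →
      ((projGeometry K V).quotImage {x} (projSet W) ⊆ (projGeometry K V).quotImage {x} (projSet W')
        ↔ W ≤ W') := fun {W W'} hx => by
    rw [(projGeometry K V).quotImage_subset_iff (isFlat_projSet W') (by simpa using hx),
      projSet_subset_iff]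
  constructor
  · rintro ⟨⟨_, ⟨W, rfl⟩, hx, rfl⟩, hne, hmax⟩
    rw [Set.singleton_subset_iff] at hx
    refine ⟨W, ⟨?_, fun W' hW' => ?_⟩, hx, rfl⟩
    · rintro rfl
      exact hne huniv
    · have hx' : x ∈ projSet W' := projSet_subset_iff.2 hW'.le hx
      have := hmax _ ⟨projSet W', isFlat_projSet W', by simpa using hx', rfl⟩
        ⟨(hle hx').2 hW'.le, fun h => hW'.not_ge ((hle hx).1 h)⟩
      rw [← huniv] at this
      exact top_le_iff.1 ((hle hx').1 this.ge)
  · rintro ⟨W, hW, hx, rfl⟩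
    refine ⟨⟨_, isFlat_projSet W, by simpa using hx, rfl⟩, fun h => ?_, ?_⟩
    · rw [← huniv] at h
      exact hW.1 (top_le_iff.1 ((hle hx).1 h.ge))
    · rintro _ ⟨_, ⟨W', rfl⟩, hx', rfl⟩ hlt
      rw [Set.singleton_subset_iff] at hx'
      have : W < W' := lt_of_le_not_ge ((hle hx').1 hlt.1) fun h => hlt.2 ((hle hx).2 h)
      rw [hW.2 _ this, huniv]

/-- Hyperplanes of the quotient by `x` are the hyperplanes through `x`, so the covering condition
says that every line through `x` not contained in `W` has a second point in `X`. -/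
theorem isLocallyAffinoProjective_iff {X : Set (ℙ K V)} :
    (projGeometry K V).IsLocallyAffinoProjective X ↔ ∀ x ∈ X, ∃ W : Submodule K V, IsCoatom W ∧
      x.rep ∈ W ∧ ∀ v ∉ W, ∃ y ∈ X, y.rep ∈ Submodule.span K {x.rep, v} ∧
        y.rep ∉ Submodule.span K {x.rep} := by
  have hcl : ∀ x p : ℙ K V, (projGeometry K V).closure (insert p {x}) =
      projSet (Submodule.span K {x.rep, p.rep}) := by
    intro x p
    have := closure_projGeometry_image (fun q : ℙ K V => q) {x, p}
    rwa [Set.image_id', Set.image_pair, Set.pair_comm x p] at this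
  refine forall₂_congr fun x hx => ?_
  simp only [PointGeometry.IsAffinoProjective, isHyperplane_quotient_iff]
  constructor
  · rintro ⟨_, ⟨W, hW, hxW, rfl⟩, hun⟩
    refine ⟨W, hW, rep_mem_iff.2 hxW, fun v hv => ?_⟩
    have hv0 : v ≠ 0 := by rintro rfl; exact hv W.zero_mem
    obtain ⟨p, hp⟩ : ∃ p, p = Projectivization.mk K v hv0 := ⟨_, rfl⟩
    have hpW : p ∉ projSet W := by rw [hp, mk_mem_projSet]; exact hv
    have hpx : p ∉ ({x} : Set (ℙ K V)) := by rintro rfl; exact hpW hxW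
    have h1 := Set.eq_univ_iff_forall.1 hun ((projGeometry K V).toQuot ⟨p, hpx⟩)
    rcases h1 with ⟨y, hyX, hy⟩ | h1
    · rw [PointGeometry.toQuot_eq_iff] at hy
      refine ⟨y.1, hyX, ?_, fun h => y.2 (rep_mem_span_singleton_iff.1 h)⟩
      have h2 := (projGeometry K V).subset_closure _ (Set.mem_insert y.1 {x})
      rw [hy, hcl, ← rep_mem_iff] at h2
      refine Submodule.span_le.2 ?_ h2
      rintro _ (rfl | rfl)
      · exact Submodule.subset_span (by simp)
      · obtain ⟨c, hc⟩ := Projectivization.exists_smul_eq_mk_rep K v hv0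
        change p.rep ∈ _
        rw [hp, ← hc]
        exact Submodule.smul_of_tower_mem _ c (Submodule.subset_span (by simp))
    · exact absurd ((PointGeometry.mk_mem_quotImage _ (isFlat_projSet W) (by simpa using hxW) _).1 h1)
        hpW
  · rintro ⟨W, hW, hxW, h⟩
    refine ⟨_, ⟨W, hW, rep_mem_iff.1 hxW, rfl⟩, Set.eq_univ_of_forall fun q => ?_⟩
    obtain ⟨p, rfl⟩ := (projGeometry K V).toQuot_surjective q
    by_cases hp : p.1 ∈ projSet W
    · exact Or.inr ⟨p, hp, rfl⟩
    · left
      obtain ⟨y, hyX, hy1, hy2⟩ := h p.1.rep (fun hm => hp (rep_mem_iff.1 hm))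
      have hyx : y ∉ ({x} : Set (ℙ K V)) := fun e => hy2 (rep_mem_span_singleton_iff.2 e)
      refine ⟨⟨y, hyx⟩, hyX, ?_⟩
      rw [PointGeometry.toQuot_eq_iff]
      refine PointGeometry.closure_insert_eq _ ((projGeometry K V).isFlat_singleton x) hyx ?_
      rw [hcl]
      exact rep_mem_iff.1 hy1

end ProjectiveGeometry

/-! ### Existence and uniqueness of the partial projective extension -/

section Morphism

variable {K K' V V' : Type*} [DivisionRing K] [DivisionRing K'] [AddCommGroup V]
  [AddCommGroup V'] [Module K V] [Module K' V']

theorem isLocalMorphism_of_isMorphism {X : Set (ℙ K V)}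
    (hX : (projGeometry K V).IsLocallyAffinoProjective X) {f : X → ℙ K' V'}
    (hf : ((projGeometry K V).restrict X).IsMorphism (projGeometry K' V') f)
    (hrank : ¬ (projGeometry K' V').ContainedInPlane (Set.range f)) :
    IsLocalMorphism K K' (fun x : X => x.1.rep) (fun x : X => (f x).rep) where
  flat N := by
    obtain ⟨_, ⟨W, rfl⟩, hW⟩ := hf _ (isFlat_projSet N)
    refine ⟨W, fun x => ?_⟩
    rw [rep_mem_iff, rep_mem_iff]
    exact Set.ext_iff.1 hW x
  locally x := by
    obtain ⟨W, hW, hxW, h⟩ := isLocallyAffinoProjective_iff.1 hX x.1 x.2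
    refine ⟨W, hW, hxW, fun v hv => ?_⟩
    obtain ⟨y, hyX, hy⟩ := h v hv
    exact ⟨⟨y, hyX⟩, hy⟩
  rank a b c := by
    by_contra! h
    refine hrank (containedInPlane_of_subset (a := a) (b := b) (c := c) ?_)
    rintro _ ⟨x, rfl⟩
    exact rep_mem_iff.1 (h x)

theorem mem_partialProj_iff {σ : K →+* K'} {Φ : V →ₛₗ[σ] V'} {p : ℙ K V} {q : ℙ K' V'} :
    q ∈ partialProj Φ p ↔ Submodule.span K' {Φ p.rep} = Submodule.span K' {q.rep} := by
  conv_lhs => rw [← p.mk_rep]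
  rw [mem_partialProj_mk]
  constructor
  · rintro ⟨h, rfl⟩
    obtain ⟨c, hc⟩ := Projectivization.exists_smul_eq_mk_rep K' _ h
    rw [← hc, Units.smul_def, span_smul_singleton c.ne_zero]
  · intro h
    obtain ⟨c, hc, e⟩ := span_singleton_eq_iff.1 h
    refine ⟨by rw [e]; exact smul_ne_zero hc q.rep_nonzero, ?_⟩
    conv_lhs => rw [← q.mk_rep]
    rw [Projectivization.mk_eq_mk_iff']
    exact ⟨c⁻¹, by rw [e, smul_smul, inv_mul_cancel₀ hc, one_smul]⟩

theorem partialProj_eq_of_smul {σ τ : K →+* K'} {Φ : V →ₛₗ[σ] V'} {Ψ : V →ₛₗ[τ] V'} {c : K'}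
    (hc : c ≠ 0) (h : ∀ v, Ψ v = c • Φ v) : partialProj Ψ = partialProj Φ := by
  funext p
  ext q
  rw [mem_partialProj_iff, mem_partialProj_iff, h, span_smul_singleton hc]

theorem existsUnique_partialProjective (hK : EnoughScalars K K') {X : Set (ℙ K V)}
    (hX : (projGeometry K V).IsLocallyAffinoProjective X) {f : X → ℙ K' V'}
    (hf : ((projGeometry K V).restrict X).IsMorphism (projGeometry K' V') f)
    (hrank : ¬ (projGeometry K' V').ContainedInPlane (Set.range f)) :
    ∃! φ : ℙ K V →. ℙ K' V', IsPartialProjective φ ∧ ∀ x : X, f x ∈ φ x := by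
  have h := isLocalMorphism_of_isMorphism hX hf hrank
  obtain ⟨σ, Θ, hΘ⟩ := h.exists_semilinear hK
  refine ⟨partialProj Θ, ⟨⟨σ, Θ, rfl⟩, fun x => mem_partialProj_iff.2 (hΘ x)⟩, ?_⟩
  rintro _ ⟨⟨τ, Ψ, rfl⟩, hΨ⟩
  obtain ⟨c, hc, hcv⟩ := h.semilinear_unique hK hΘ fun x => mem_partialProj_iff.1 (hΨ x)
  exact partialProj_eq_of_smul hc hcv

end Morphism

/-! ### A linear criterion for having enough points -/

section EnoughPoints

variable {K V : Type*} [DivisionRing K] [AddCommGroup V] [Module K V]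

theorem linearIndependent_rep_mk {n : ℕ} {w : Fin n → V} (hw : LinearIndependent K w) :
    LinearIndependent K fun i => (Projectivization.mk K (w i) (hw.ne_zero i)).rep := by
  choose c hc using fun i => Projectivization.exists_smul_eq_mk_rep K (w i) (hw.ne_zero i)
  have : (fun i => (Projectivization.mk K (w i) (hw.ne_zero i)).rep) = fun i => c i • w i :=
    funext fun i => (hc i).symm
  rw [this]
  exact hw.units_smul c

theorem closure_restrict_range {X : Set (ℙ K V)} {ι : Type*} (p : ι → X) (I : Set ι) :
    ((projGeometry K V).restrict X).closure (p '' I) =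
      Subtype.val ⁻¹' projSet (Submodule.span K ((fun i => (p i).1.rep) '' I)) := by
  refine (PointGeometry.flatClosure_restrict _ _ _).trans ?_
  rw [Set.image_image, closure_projGeometry_image fun i => (p i).1]

theorem indep_restrict_range_iff {X : Set (ℙ K V)} {ι : Type*} {p : ι → X}
    (hp : Function.Injective p) : ((projGeometry K V).restrict X).Indep (Set.range p) ↔
      LinearIndependent K fun i => (p i).1.rep := by
  rw [linearIndependent_iff_notMem_span, PointGeometry.Indep, Set.forall_mem_range]
  refine forall_congr' fun i => ?_
  rw [← Set.image_univ, ← Set.image_singleton, ← Set.image_sdiff hp, closure_restrict_range,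
    Set.mem_preimage, ← rep_mem_iff]

theorem exists_eq_range_of_encard {α : Type*} {B : Set α} {n : ℕ} (h : B.encard = n) :
    ∃ p : Fin n → α, Function.Injective p ∧ Set.range p = B := by
  have hfin : B.Finite := Set.finite_of_encard_eq_coe h
  have := hfin.to_subtype
  have hc : Nat.card B = n := by
    rw [Nat.card_coe_set_eq, Set.ncard, h, ENat.toNat_natCast]
  let e := (Finite.equivFinOfCardEq hc).symm
  exact ⟨fun i => (e i).1, Subtype.val_injective.comp e.injective, by
    ext x
    exact ⟨by rintro ⟨i, rfl⟩; exact (e i).2, fun hx => ⟨e.symm ⟨x, hx⟩, by simp⟩⟩⟩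

theorem exists_of_hasRank_restrict {X : Set (ℙ K V)} {S : Set X} {n : ℕ}
    (h : ((projGeometry K V).restrict X).HasRank S n) : ∃ p : Fin n → X,
      LinearIndependent K (fun i => (p i).1.rep) ∧
      S = Subtype.val ⁻¹' projSet (Submodule.span K (Set.range fun i => (p i).1.rep)) := by
  obtain ⟨-, B, hB, rfl, hn⟩ := h
  obtain ⟨p, hp, rfl⟩ := exists_eq_range_of_encard hn
  refine ⟨p, (indep_restrict_range_iff hp).1 hB, ?_⟩
  rw [← Set.image_univ, closure_restrict_range, Set.image_univ]

theorem encard_range_of_injective {α : Type*} {n : ℕ} {p : Fin n → α}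
    (hp : Function.Injective p) : (Set.range p).encard = n := by
  rw [← Set.image_univ, hp.encard_image, Set.encard_univ]
  simp

/-- Any three of the four points are the points `w (k.succAbove i)` for the omitted index `k`; being
independent, they cannot lie in the span of the two points of a basis of a line. -/
theorem hasEnoughPoints_restrict {X : Set (ℙ K V)}
    (h₀ : ∃ e : Fin 3 → V, LinearIndependent K e ∧ ∀ i h, Projectivization.mk K (e i) h ∈ X)
    (h₁ : ∀ e : Fin 3 → V, LinearIndependent K e → (∀ i h, Projectivization.mk K (e i) h ∈ X) →
      ∃ w : Fin 4 → V, (∀ i, w i ∈ Submodule.span K (Set.range e)) ∧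
        (∀ i h, Projectivization.mk K (w i) h ∈ X) ∧
        ∀ k : Fin 4, LinearIndependent K fun i : Fin 3 => w (k.succAbove i)) :
    ((projGeometry K V).restrict X).HasEnoughPoints := by
  constructor
  · obtain ⟨e, he, heX⟩ := h₀
    have hli := linearIndependent_rep_mk he
    have hinj : Function.Injective fun i =>
        (⟨Projectivization.mk K (e i) (he.ne_zero i), heX i _⟩ : X) := fun i j hij =>
      hli.injective (congr_arg (fun x : X => x.1.rep) hij)
    exact ⟨_, (indep_restrict_range_iff hinj).2 hli, encard_range_of_injective hinj⟩
  · intro S hS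
    obtain ⟨p, hp, rfl⟩ := exists_of_hasRank_restrict hS
    obtain ⟨w, hwp, hwX, hw⟩ := h₁ _ hp fun i h => by rw [Projectivization.mk_rep]; exact (p i).2
    have hsep : ∀ i j : Fin 4, i ≠ j → ∃ (k : Fin 4) (a b : Fin 3),
      k.succAbove a = i ∧ k.succAbove b = j ∧ a ≠ b := by decide
    have hw0 : ∀ i, w i ≠ 0 := by
      intro i
      obtain ⟨j, hj⟩ := exists_ne i
      obtain ⟨k, a, b, rfl, -⟩ := hsep i j hj.symm
      exact (hw k).ne_zero a
    obtain ⟨q, hq⟩ : ∃ q : Fin 4 → X, ∀ i, (q i).1 = Projectivization.mk K (w i) (hw0 i) :=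
      ⟨fun i => ⟨_, hwX i (hw0 i)⟩, fun i => rfl⟩
    have hli : ∀ k : Fin 4, LinearIndependent K fun i : Fin 3 => (q (k.succAbove i)).1.rep := by
      intro k
      simp only [hq]
      exact linearIndependent_rep_mk (hw k)
    have hinj : Function.Injective q := by
      intro i j hij
      by_contra hne
      obtain ⟨k, a, b, rfl, rfl, hab⟩ := hsep i j hne
      exact hab ((hli k).injective (congr_arg (fun x : X => x.1.rep) hij))
    refine ⟨Set.range q, ?_, encard_range_of_injective hinj, ?_⟩
    · rintro _ ⟨i, rfl⟩
      rw [Set.mem_preimage, hq, mk_mem_projSet]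
      exact hwp i
    · rintro T hT hT3 ⟨L, hL, hTL⟩
      obtain ⟨l, -, rfl⟩ := exists_of_hasRank_restrict hL
      obtain ⟨k, hk⟩ : ∃ k, q k ∉ T := by
        by_contra! h
        have : (Set.range q).encard ≤ T.encard :=
          Set.encard_le_encard (Set.range_subset_iff.2 h)
        rw [encard_range_of_injective hinj, hT3] at this
        exact absurd this (by norm_cast)
      have hsub : T ⊆ Set.range fun i => q (k.succAbove i) := by
        intro t ht
        obtain ⟨j, rfl⟩ := hT ht
        obtain ⟨i, rfl⟩ := Fin.exists_succAbove_eq (x := j) (y := k) (by rintro rfl; exact hk ht)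
        exact ⟨i, rfl⟩
      have heq : T = Set.range fun i => q (k.succAbove i) := by
        refine (Set.finite_of_encard_eq_coe hT3).eq_of_subset_of_encard_le hsub ?_
        rw [hT3]
        exact (encard_range_of_injective (hinj.comp Fin.succAbove_right_injective)).le
      have hle : Submodule.span K (Set.range fun i => (q (k.succAbove i)).1.rep) ≤
          Submodule.span K (Set.range fun i => (l i).1.rep) := by
        rw [Submodule.span_le]
        rintro _ ⟨i, rfl⟩
        exact rep_mem_iff.2 (hTL (heq ▸ ⟨i, rfl⟩))
      have : FiniteDimensional K (Submodule.span K (Set.range fun i => (l i).1.rep)) :=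
        FiniteDimensional.span_of_finite K (Set.finite_range _)
      have h3 := Submodule.finrank_mono hle
      rw [finrank_span_eq_card (hli k), Fintype.card_fin] at h3
      have h2 := finrank_range_le_card (R := K) (fun i => (l i).1.rep)
      rw [Fintype.card_fin, Set.finrank] at h2
      omega

end EnoughPoints

/-! ### Plane sections of real quadrics -/

section Quadric

open QuadraticMap

variable {V : Type*} [AddCommGroup V] [Module ℝ V] (Q : QuadraticForm ℝ V)

/-- A regular zero of the quadratic form `Q`: a representative of a nonsingular point of the
quadric `Q = 0`. -/
def IsRegularZero (v : V) : Prop := Q v = 0 ∧ ∃ w, polar Q v w ≠ 0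

variable {Q}

theorem IsRegularZero.ne_zero {v : V} (h : IsRegularZero Q v) : v ≠ 0 := by
  rintro rfl
  obtain ⟨-, w, hw⟩ := h
  exact hw (polar_zero_left Q w)

theorem IsRegularZero.smul_iff {v : V} {c : ℝ} (hc : c ≠ 0) :
    IsRegularZero Q (c • v) ↔ IsRegularZero Q v := by
  simp [IsRegularZero, QuadraticMap.map_smul, polar_smul_left, hc]

theorem map_combination_of_isotropic {a b c : V} (ha : Q a = 0) (hb : Q b = 0) (hc : Q c = 0)
    (x y z : ℝ) : Q (x • a + y • b + z • c) =
      polar Q a b * (x * y) + polar Q b c * (y * z) + polar Q a c * (x * z) := by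
  rw [QuadraticMap.map_add Q, QuadraticMap.map_add Q, polar_add_left]
  simp only [QuadraticMap.map_smul, polar_smul_left, polar_smul_right, ha, hb, hc, smul_eq_mul]
  ring

theorem polar_combination_left (a b c v : V) (x y z : ℝ) :
    polar Q (x • a + y • b + z • c) v = x * polar Q a v + y * polar Q b v + z * polar Q c v := by
  simp only [polar_add_left, polar_smul_left, smul_eq_mul]

variable (Q) in
/-- Four regular zeros of `Q` in the subspace `N`, any three of which are linearly independent. -/
def HasFourRegularZeros (N : Submodule ℝ V) : Prop :=
  ∃ a b c d : V, (a ∈ N ∧ b ∈ N ∧ c ∈ N ∧ d ∈ N) ∧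
    (IsRegularZero Q a ∧ IsRegularZero Q b ∧ IsRegularZero Q c ∧ IsRegularZero Q d) ∧
    LinearIndependent ℝ ![a, b, c] ∧ LinearIndependent ℝ ![a, b, d] ∧
    LinearIndependent ℝ ![a, c, d] ∧ LinearIndependent ℝ ![b, c, d]

theorem hasFourRegularZeros_of_combination {N : Submodule ℝ V} {a b c : V}
    (hN : a ∈ N ∧ b ∈ N ∧ c ∈ N) (hli : LinearIndependent ℝ ![a, b, c])
    (ha : IsRegularZero Q a) (hb : IsRegularZero Q b) (hc : IsRegularZero Q c) {x y z : ℝ}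
    (hx : x ≠ 0) (hy : y ≠ 0) (hz : z ≠ 0) (hd : IsRegularZero Q (x • a + y • b + z • c)) :
    HasFourRegularZeros Q N := by
  refine ⟨a, b, c, _, ⟨hN.1, hN.2.1, hN.2.2, N.add_mem (N.add_mem (N.smul_mem x hN.1)
    (N.smul_mem y hN.2.1)) (N.smul_mem z hN.2.2)⟩, ⟨ha, hb, hc, hd⟩, hli, ?_⟩
  rw [linearIndependent_triple_iff] at hli
  simp only [linearIndependent_triple_iff]
  refine ⟨fun s t r h => ?_, fun s t r h => ?_, fun s t r h => ?_⟩
  · obtain ⟨h1, h2, h3⟩ := hli (s + r * x) (t + r * y) (r * z) (by rw [← h]; module)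
    have hr : r = 0 := by simpa [hz] using h3
    subst hr
    exact ⟨by simpa using h1, by simpa using h2, rfl⟩
  · obtain ⟨h1, h2, h3⟩ := hli (s + r * x) (r * y) (t + r * z) (by rw [← h]; module)
    have hr : r = 0 := by simpa [hy] using h2
    subst hr
    exact ⟨by simpa using h1, by simpa using h3, rfl⟩
  · obtain ⟨h1, h2, h3⟩ := hli (r * x) (s + r * y) (t + r * z) (by rw [← h]; module)
    have hr : r = 0 := by simpa [hx] using h1
    subst hr
    exact ⟨by simpa using h2, by simpa using h3, rfl⟩

/-- In the basis `a, b, c` the form is a combination of `xy`, `yz`, `xz` with at least two nonzero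
coefficients, and such a conic has a zero with three nonzero coordinates. The scalar `t` is chosen
so that the equation, linear in `z`, is solvable. -/
theorem hasFourRegularZeros_of_polar_ne_zero {N : Submodule ℝ V} {a b c : V}
    (hN : a ∈ N ∧ b ∈ N ∧ c ∈ N) (hli : LinearIndependent ℝ ![a, b, c])
    (ha : IsRegularZero Q a) (hb : IsRegularZero Q b) (hc : IsRegularZero Q c)
    (hbc : polar Q b c ≠ 0) (hac : polar Q a c ≠ 0) : HasFourRegularZeros Q N := by
  by_cases hab : polar Q a b = 0
  · refine hasFourRegularZeros_of_combination hN hli ha hb hc hbc (neg_ne_zero.2 hac) one_ne_zero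
      ⟨?_, a, ?_⟩
    · rw [map_combination_of_isotropic ha.1 hb.1 hc.1, hab]
      ring
    · rw [polar_combination_left, polar_self, ha.1, polar_comm Q b a, polar_comm Q c a, hab]
      simpa using hac
  · obtain ⟨t, ht, ht'⟩ : ∃ t : ℝ, t ≠ 0 ∧ polar Q b c + t * polar Q a c ≠ 0 := by
      by_cases h : polar Q b c + polar Q a c = 0
      · exact ⟨2, two_ne_zero, fun h' => hac (by linarith)⟩
      · exact ⟨1, one_ne_zero, by rwa [one_mul]⟩
    refine hasFourRegularZeros_of_combination hN hli ha hb hc ht one_ne_zero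
      (z := -(polar Q a b * t) / (polar Q b c + t * polar Q a c))
      (div_ne_zero (neg_ne_zero.2 (mul_ne_zero hab ht)) ht') ⟨?_, c, ?_⟩
    · rw [map_combination_of_isotropic ha.1 hb.1 hc.1]
      field_simp
      ring
    · rw [polar_combination_left, polar_self, hc.1]
      simpa [add_comm] using ht'

/-- The section is the pair of lines `xz = 0` through `b`; two points are taken on each line, away
from `b`. -/
theorem hasFourRegularZeros_of_polar_eq_zero {N : Submodule ℝ V} {a b c : V}
    (hN : a ∈ N ∧ b ∈ N ∧ c ∈ N) (hli : LinearIndependent ℝ ![a, b, c])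
    (ha : IsRegularZero Q a) (hb : IsRegularZero Q b) (hc : IsRegularZero Q c)
    (hab : polar Q a b = 0) (hbc : polar Q b c = 0) (hac : polar Q a c ≠ 0) :
    HasFourRegularZeros Q N := by
  have hac' : polar Q c a ≠ 0 := by rwa [polar_comm]
  refine ⟨a, a + b, c, c + b, ⟨hN.1, N.add_mem hN.1 hN.2.1, hN.2.2, N.add_mem hN.2.2 hN.2.1⟩,
    ⟨ha, ⟨?_, c, ?_⟩, hc, ⟨?_, a, ?_⟩⟩, ?_⟩
  · rw [QuadraticMap.map_add Q, ha.1, hb.1, hab]; simp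
  · rwa [polar_add_left, hbc, add_zero]
  · rw [QuadraticMap.map_add Q, hc.1, hb.1, polar_comm, hbc]; simp
  · rwa [polar_add_left, polar_comm Q b, hab, add_zero]
  rw [linearIndependent_triple_iff] at hli
  simp only [linearIndependent_triple_iff]
  refine ⟨fun s t r h => ?_, fun s t r h => ?_, fun s t r h => ?_, fun s t r h => ?_⟩
  · obtain ⟨h1, h2, h3⟩ := hli (s + t) t r (by rw [← h]; module)
    exact ⟨by linarith, by linarith, by linarith⟩
  · obtain ⟨h1, h2, h3⟩ := hli (s + t) (t + r) r (by rw [← h]; module)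
    exact ⟨by linarith, by linarith, by linarith⟩
  · obtain ⟨h1, h2, h3⟩ := hli s r (t + r) (by rw [← h]; module)
    exact ⟨by linarith, by linarith, by linarith⟩
  · obtain ⟨h1, h2, h3⟩ := hli s (s + r) (t + r) (by rw [← h]; module)
    exact ⟨by linarith, by linarith, by linarith⟩

theorem hasFourRegularZeros {N : Submodule ℝ V} {a b c : V}
    (hN : a ∈ N ∧ b ∈ N ∧ c ∈ N) (hli : LinearIndependent ℝ ![a, b, c])
    (ha : IsRegularZero Q a) (hb : IsRegularZero Q b) (hc : IsRegularZero Q c)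
    (h : ¬ (polar Q a b = 0 ∧ polar Q b c = 0 ∧ polar Q a c = 0)) : HasFourRegularZeros Q N := by
  have hbac : LinearIndependent ℝ ![b, a, c] := hli.triple_perm (by grind)
  have hacb : LinearIndependent ℝ ![a, c, b] := hli.triple_perm (by grind)
  by_cases hab : polar Q a b = 0 <;> by_cases hbc : polar Q b c = 0 <;>
    by_cases hac : polar Q a c = 0
  · exact absurd ⟨hab, hbc, hac⟩ h
  · exact hasFourRegularZeros_of_polar_eq_zero hN hli ha hb hc hab hbc hac
  · exact hasFourRegularZeros_of_polar_eq_zero ⟨hN.2.1, hN.1, hN.2.2⟩ hbac hb ha hc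
      (by rwa [polar_comm]) hac hbc
  · exact hasFourRegularZeros_of_polar_ne_zero hN hli ha hb hc hbc hac
  · exact hasFourRegularZeros_of_polar_eq_zero ⟨hN.1, hN.2.2, hN.2.1⟩ hacb ha hc hb hac
      (by rwa [polar_comm]) hab
  · exact hasFourRegularZeros_of_polar_ne_zero ⟨hN.2.2, hN.2.1, hN.1⟩
      (hli.triple_perm (by grind)) hc hb ha (by rwa [polar_comm]) (by rwa [polar_comm])
  · exact hasFourRegularZeros_of_polar_ne_zero ⟨hN.1, hN.2.2, hN.2.1⟩ hacb ha hc hb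
      (by rwa [polar_comm]) hab
  · exact hasFourRegularZeros_of_polar_ne_zero hN hli ha hb hc hbc hac

variable (Q) in
/-- In the coordinates given by `u₁`, `u₂`, `n`, the form `Q` is `x² + y² - z²`. -/
def IsIndefiniteOn (u₁ u₂ n : V) : Prop :=
  ∀ x y z : ℝ, Q (x • u₁ + y • u₂ + z • n) = x ^ 2 + y ^ 2 - z ^ 2

/-- A totally isotropic space of dimension 3 would meet the positive definite plane of `u₁, u₂`
nontrivially, as both are in dimension at most 4. -/
theorem IsIndefiniteOn.exists_polar_ne_zero [FiniteDimensional ℝ V]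
    (hV : Module.finrank ℝ V ≤ 4) {u₁ u₂ n : V} (hQ : IsIndefiniteOn Q u₁ u₂ n) {a b c : V}
    (hli : LinearIndependent ℝ ![a, b, c]) (ha : Q a = 0) (hb : Q b = 0) (hc : Q c = 0) :
    ¬ (polar Q a b = 0 ∧ polar Q b c = 0 ∧ polar Q a c = 0) := by
  rintro ⟨hab, hbc, hac⟩
  have hdep : ¬ LinearIndependent ℝ ![a, b, c, u₁, u₂] := fun h => by
    have := h.fintype_card_le_finrank
    rw [Fintype.card_fin] at this
    omega
  obtain ⟨g, hg, i, hi⟩ := Fintype.not_linearIndependent_iff.1 hdep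
  rw [Fin.sum_univ_five] at hg
  change g 0 • a + g 1 • b + g 2 • c + g 3 • u₁ + g 4 • u₂ = 0 at hg
  have heq : g 0 • a + g 1 • b + g 2 • c = (-g 3) • u₁ + (-g 4) • u₂ + (0 : ℝ) • n := by
    rw [← sub_eq_zero, ← hg]
    module
  have h1 := map_combination_of_isotropic ha hb hc (g 0) (g 1) (g 2)
  rw [heq, hQ, hab, hbc, hac] at h1
  have h3 : g 3 = 0 := by nlinarith [sq_nonneg (g 3), sq_nonneg (g 4)]
  have h4 : g 4 = 0 := by nlinarith [sq_nonneg (g 3), sq_nonneg (g 4)]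
  rw [h3, h4] at heq
  obtain ⟨h0, h1, h2⟩ := linearIndependent_triple_iff.1 hli _ _ _ (heq.trans (by simp))
  apply hi
  fin_cases i <;> assumption

theorem IsIndefiniteOn.linearIndependent {u₁ u₂ n : V} (hQ : IsIndefiniteOn Q u₁ u₂ n) :
    LinearIndependent ℝ ![u₁, u₂, n] := by
  rw [linearIndependent_triple_iff]
  intro x y z h
  have h0 := hQ x y z
  have hQ' : ∀ x' y' z' : ℝ, Q (x' • u₁ + y' • u₂ + z' • n) =
      (x + x') ^ 2 + (y + y') ^ 2 - (z + z') ^ 2 := by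
    intro x' y' z'
    rw [← hQ, ← zero_add (x' • u₁ + y' • u₂ + z' • n), ← h]
    congr 1
    module
  have h1 := hQ' 1 0 0
  have h2 := hQ' 0 1 0
  have h3 := hQ' 0 0 1
  rw [hQ] at h1 h2 h3
  rw [h, QuadraticMap.map_zero] at h0
  exact ⟨by linarith, by linarith, by linarith⟩

theorem IsIndefiniteOn.exists_regularZeros {u₁ u₂ n : V} (hQ : IsIndefiniteOn Q u₁ u₂ n) :
    ∃ a b c : V, LinearIndependent ℝ ![a, b, c] ∧
      IsRegularZero Q a ∧ IsRegularZero Q b ∧ IsRegularZero Q c := by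
  have h : ∀ x y z x' y' z' : ℝ, polar Q (x • u₁ + y • u₂ + z • n) (x' • u₁ + y' • u₂ + z' • n) =
      2 * (x * x' + y * y' - z * z') := by
    intro x y z x' y' z'
    have : x • u₁ + y • u₂ + z • n + (x' • u₁ + y' • u₂ + z' • n) =
        (x + x') • u₁ + (y + y') • u₂ + (z + z') • n := by module
    rw [polar, this, hQ, hQ, hQ]
    ring
  refine ⟨(1 : ℝ) • u₁ + (0 : ℝ) • u₂ + (1 : ℝ) • n, (0 : ℝ) • u₁ + (1 : ℝ) • u₂ + (1 : ℝ) • n,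
    (-1 : ℝ) • u₁ + (0 : ℝ) • u₂ + (1 : ℝ) • n, ?_, ⟨?_, (1 : ℝ) • u₁ + (0 : ℝ) • u₂ + (0 : ℝ) • n,
    ?_⟩, ⟨?_, (0 : ℝ) • u₁ + (1 : ℝ) • u₂ + (0 : ℝ) • n, ?_⟩,
    ⟨?_, (1 : ℝ) • u₁ + (0 : ℝ) • u₂ + (0 : ℝ) • n, ?_⟩⟩
  · have hli := hQ.linearIndependent
    rw [linearIndependent_triple_iff] at hli ⊢
    intro x y z e
    obtain ⟨h1, h2, h3⟩ := hli (x - z) y (x + y + z) (by rw [← e]; module)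
    exact ⟨by linarith, by linarith, by linarith⟩
  all_goals first | rw [hQ] | rw [h]
  all_goals norm_num

end Quadric

/-! ### The Möbius, Minkowski and Laguerre geometries -/

section RealQuadric

open QuadraticMap

variable {Q : QuadraticForm ℝ (Fin 4 → ℝ)}

theorem mk_mem_quadric_diff_singularPoints {v : Fin 4 → ℝ} (hv : v ≠ 0) :
    Projectivization.mk ℝ v hv ∈ quadric Q \ singularPoints Q ↔ IsRegularZero Q v := by
  obtain ⟨c, hc⟩ := Projectivization.exists_smul_eq_mk_rep ℝ v hv
  rw [← IsRegularZero.smul_iff c.ne_zero, ← Units.smul_def, hc]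
  simp only [quadric, singularPoints, Set.mem_sdiff, Set.mem_ofPred_eq, not_and, not_forall,
    IsRegularZero]
  tauto

theorem mem_quadric_diff_singularPoints {p : ℙ ℝ (Fin 4 → ℝ)} :
    p ∈ quadric Q \ singularPoints Q ↔ IsRegularZero Q p.rep := by
  rw [← mk_mem_quadric_diff_singularPoints p.rep_nonzero, p.mk_rep]

/-- The hyperplane at `x` is the tangent one, the kernel of the polar form at `x`. On a line through
`x` and `v` outside it, the equation of the quadric is linear after removing `x`; its solution `y`
is regular because its polar value with `x` is not 0. -/
theorem isLocallyAffinoProjective_quadric_diff_singularPoints :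
    (projGeometry ℝ (Fin 4 → ℝ)).IsLocallyAffinoProjective (quadric Q \ singularPoints Q) := by
  rw [isLocallyAffinoProjective_iff]
  intro x hx
  obtain ⟨hx0, w, hw⟩ := mem_quadric_diff_singularPoints.1 hx
  have hker : ∀ v, v ∈ LinearMap.ker (polarBilin Q x.rep) ↔ polar Q x.rep v = 0 := fun v => by
    rw [LinearMap.mem_ker, polarBilin_apply_apply]
  refine ⟨LinearMap.ker (polarBilin Q x.rep), LinearMap.isCoatom_ker_of_surjective
    (LinearMap.surjective fun h => hw ?_), ?_, fun v hv => ?_⟩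
  · rw [← polarBilin_apply_apply, h, LinearMap.zero_apply]
  · rw [hker, polar_self, hx0, smul_zero]
  · rw [hker] at hv
    obtain ⟨y, hy⟩ : ∃ y, y = v - (Q v / polar Q x.rep v) • x.rep := ⟨_, rfl⟩
    have hyx : polar Q x.rep y = polar Q x.rep v := by
      rw [hy, polar_sub_right, polar_smul_right, polar_self, hx0]
      simp
    have hreg : IsRegularZero Q y := by
      refine ⟨?_, x.rep, by rwa [polar_comm, hyx]⟩
      have : Q y = Q v + Q (-(Q v / polar Q x.rep v) • x.rep) +
          polar Q v (-(Q v / polar Q x.rep v) • x.rep) := by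
        rw [← QuadraticMap.map_add Q, hy, neg_smul, sub_eq_add_neg]
      rw [this, QuadraticMap.map_smul, hx0, polar_smul_right, polar_comm Q v, smul_eq_mul,
        smul_eq_mul]
      field_simp
      ring
    obtain ⟨c, hc⟩ := Projectivization.exists_smul_eq_mk_rep ℝ y hreg.ne_zero
    refine ⟨_, (mk_mem_quadric_diff_singularPoints hreg.ne_zero).2 hreg, ?_, fun h => ?_⟩
    · rw [← hc, hy]
      refine Submodule.smul_of_tower_mem _ c (Submodule.sub_mem _ (Submodule.subset_span (by simp))
        (Submodule.smul_mem _ _ (Submodule.subset_span (by simp))))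
    · obtain ⟨d, hd⟩ := Submodule.mem_span_singleton.1 h
      have h1 : polar Q x.rep (c • y) = 0 := by
        rw [hc, ← hd, polar_smul_right, polar_self, hx0]
        simp
      rw [Units.smul_def, polar_smul_right, hyx] at h1
      exact smul_ne_zero c.ne_zero hv h1

theorem IsIndefiniteOn.hasEnoughPoints {u₁ u₂ n : Fin 4 → ℝ} (hQ : IsIndefiniteOn Q u₁ u₂ n) :
    ((projGeometry ℝ (Fin 4 → ℝ)).restrict (quadric Q \ singularPoints Q)).HasEnoughPoints := by
  apply hasEnoughPoints_restrict
  · obtain ⟨a, b, c, hli, ha, hb, hc⟩ := hQ.exists_regularZeros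
    refine ⟨![a, b, c], hli, fun i h => (mk_mem_quadric_diff_singularPoints h).2 ?_⟩
    fin_cases i
    exacts [ha, hb, hc]
  · intro e he heX
    have hreg : ∀ i, IsRegularZero Q (e i) := fun i =>
      (mk_mem_quadric_diff_singularPoints (he.ne_zero i)).1 (heX i _)
    have hmem : ∀ i, e i ∈ Submodule.span ℝ (Set.range e) := fun i =>
      Submodule.subset_span ⟨i, rfl⟩
    have heq : ![e 0, e 1, e 2] = e := by
      ext i
      fin_cases i <;> rfl
    have hli : LinearIndependent ℝ ![e 0, e 1, e 2] := heq.symm ▸ he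
    obtain ⟨a, b, c, d, ⟨haN, hbN, hcN, hdN⟩, ⟨ha, hb, hc, hd⟩, habc, habd, hacd, hbcd⟩ :=
      hasFourRegularZeros (Q := Q) ⟨hmem 0, hmem 1, hmem 2⟩ hli (hreg 0) (hreg 1) (hreg 2)
        (hQ.exists_polar_ne_zero (by simp) hli (hreg 0).1 (hreg 1).1 (hreg 2).1)
    have hcongr : ∀ {v w : Fin 3 → Fin 4 → ℝ}, LinearIndependent ℝ v → (∀ i, w i = v i) →
        LinearIndependent ℝ w := fun h e => (funext e).symm ▸ h
    refine ⟨![a, b, c, d], fun i => ?_,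
      fun i h => (mk_mem_quadric_diff_singularPoints h).2 ?_, fun k => ?_⟩
    · fin_cases i
      exacts [haN, hbN, hcN, hdN]
    · fin_cases i
      exacts [ha, hb, hc, hd]
    · fin_cases k
      · exact hcongr hbcd fun i => by fin_cases i <;> rfl
      · exact hcongr hacd fun i => by fin_cases i <;> rfl
      · exact hcongr habd fun i => by fin_cases i <;> rfl
      · exact hcongr habc fun i => by fin_cases i <;> rfl

theorem singularPoints_eq_empty {w : Fin 4 → ℝ} (hw : ∀ i, w i ≠ 0)
    (hQ : Q.Equivalent (weightedSumSquares ℝ w)) : singularPoints Q = ∅ := by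
  obtain ⟨φ⟩ := hQ
  refine Set.eq_empty_of_forall_notMem fun p hp => p.rep_nonzero ?_
  have h : ∀ i, φ p.rep i = 0 := by
    intro i
    have h1 := hp.2 (φ.symm (Pi.single i 1))
    have h2 : polar (weightedSumSquares ℝ w) (φ p.rep) (Pi.single i 1) = 0 := by
      rw [← h1]
      simp only [polar, ← φ.map_app, map_add]
      simp
    have h3 : polar (weightedSumSquares ℝ w) (φ p.rep) (Pi.single i 1) =
        ∑ j, 2 * w j * (φ p.rep j * (Pi.single i 1 : Fin 4 → ℝ) j) := by
      simp only [polar, weightedSumSquares_apply, ← Finset.sum_sub_distrib, Pi.add_apply,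
        smul_eq_mul]
      exact Finset.sum_congr rfl fun j _ => by ring
    rw [h3, Finset.sum_eq_single i (fun j _ hj => by simp [hj]) (by simp)] at h2
    simpa [hw i] using h2
  exact φ.toLinearEquiv.map_eq_zero_iff.1 (funext h)

theorem exists_isIndefiniteOn {w : Fin 4 → ℝ} {k : Fin 4} (h0 : w 0 = 1) (h1 : w 1 = 1)
    (hk : w k = -1) (hQ : Q.Equivalent (weightedSumSquares ℝ w)) :
    ∃ u₁ u₂ n, IsIndefiniteOn Q u₁ u₂ n := by
  obtain ⟨φ⟩ := hQ
  refine ⟨φ.symm (Pi.single 0 1), φ.symm (Pi.single 1 1), φ.symm (Pi.single k 1), fun x y z => ?_⟩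
  have h : φ (x • φ.symm (Pi.single 0 1) + y • φ.symm (Pi.single 1 1) +
      z • φ.symm (Pi.single k 1)) = x • Pi.single 0 1 + y • Pi.single 1 1 + z • Pi.single k 1 := by
    simp
  rw [← φ.map_app, h, weightedSumSquares_apply, Fin.sum_univ_four]
  fin_cases k
  · norm_num [h0] at hk
  · norm_num [h1] at hk
  all_goals
    simp at hk
    simp [h0, h1, hk]
    ring

end RealQuadric

theorem mainTheorem3 :
    (∀ (K K' V V' : Type*) [DivisionRing K] [DivisionRing K'] [AddCommGroup V] [AddCommGroup V']
      [Module K V] [Module K' V'],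
      (4 ≤ Cardinal.mk K ∨ (Cardinal.mk K = 3 ∧ ringChar K' = 3)) →
      ∀ X : Set (ℙ K V),
        (projGeometry K V).IsLocallyAffinoProjective X →
        ((projGeometry K V).restrict X).HasEnoughPoints →
        ∀ f : X → ℙ K' V',
          ((projGeometry K V).restrict X).IsMorphism (projGeometry K' V') f →
          ¬ (projGeometry K' V').ContainedInPlane (Set.range f) →
          ∃! φ : ℙ K V →. ℙ K' V', IsPartialProjective φ ∧ ∀ x : X, f x ∈ φ x) ∧
    (∀ X : Set (ℙ ℝ (Fin 4 → ℝ)),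
      IsMoebiusGeometry X ∨ IsLaguerreGeometry X ∨ IsMinkowskiGeometry X →
        (projGeometry ℝ (Fin 4 → ℝ)).IsLocallyAffinoProjective X ∧
        ((projGeometry ℝ (Fin 4 → ℝ)).restrict X).HasEnoughPoints) := by
  constructor
  · intro K K' V V' _ _ _ _ _ _ hK X hX _ f hf hrank
    exact existsUnique_partialProjective (enoughScalars_of_card hK) hX hf hrank
  -- All three families are quadrics without their singular points. For the first two signatures
  -- with four nonzero weights there is nothing to remove, and each form restricts to `x² + y² - z²`
  -- on three coordinates.
  · suffices h : ∀ X : Set (ℙ ℝ (Fin 4 → ℝ)),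
        IsMoebiusGeometry X ∨ IsLaguerreGeometry X ∨ IsMinkowskiGeometry X →
        ∃ Q : QuadraticForm ℝ (Fin 4 → ℝ), X = quadric Q \ singularPoints Q ∧
          ∃ u₁ u₂ n, IsIndefiniteOn Q u₁ u₂ n by
      intro X hX
      obtain ⟨Q, rfl, u₁, u₂, n, hQ⟩ := h X hX
      exact ⟨isLocallyAffinoProjective_quadric_diff_singularPoints, hQ.hasEnoughPoints⟩
    rintro _ (⟨Q, hQ, rfl⟩ | ⟨Q, hQ, rfl⟩ | ⟨Q, hQ, rfl⟩)
    · refine ⟨Q, ?_, exists_isIndefiniteOn (k := 3) rfl rfl rfl hQ⟩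
      rw [singularPoints_eq_empty (fun i => by fin_cases i <;> norm_num) hQ, Set.sdiff_empty]
    · exact ⟨Q, rfl, exists_isIndefiniteOn (k := 2) rfl rfl rfl hQ⟩
    · refine ⟨Q, ?_, exists_isIndefiniteOn (k := 2) rfl rfl rfl hQ⟩
      rw [singularPoints_eq_empty (fun i => by fin_cases i <;> norm_num) hQ, Set.sdiff_empty]
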